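/- Let $L_1,L_2>0$ and let $\mathbb T^2=[0,L_1]\times[0,L_2]$ with periodic boundary conditions. Let $\mathbf v\in L^\infty((0,\infty);L^2(\mathbb T^2))$ be a vector field with $\operatorname{div}\mathbf v=0$ in the sense of distributions, let $\phi_0\in L^2(\mathbb T^2)$ be real-valued, and let $0<T<\infty$. Put $\tilde{\mathbf k}=2\pi(k_1/L_1,k_2/L_2)$ for $\mathbf k\in\mathbb Z^2$, and let $e^{-t\mathcal L}$, $\mathcal L=\Delta^2+\Delta$, be the operator that multiplies the $\mathbf k$-th Fourier coefficient by $e^{-t(|\tilde{\mathbf k}|^4-|\tilde{\mathbf k}|^2)}$. Consider the advective Kuramoto–Sivashinsky equation $$\partial_t\phi+\mathbf v\cdot\nabla\phi+\tfrac12|\nabla\phi|^2=-\Delta^2\phi-\Delta\phi .\qquad (1)$$ Let $\phi$ be a mild solution of (1) on $[0,T]$ with initial data $\phi_0$, that is, $\phi\in C([0,T];L^2(\mathbb T^2))$, $\nabla\phi$ is locally integrable, and for all $0\le t\le T$, with Bochner integrals in $L^2(\mathbb T^2)$, $$\phi(t)=e^{-t\mathcal L}\phi_0-\frac12\int_0^te^{-(t-\tau)\mathcal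 L}|\nabla\phi(\tau)|^2\,d\tau-\int_0^te^{-(t-\tau)\mathcal L}\big(\mathbf v(\tau)\cdot\nabla\phi(\tau)\big)\,d\tau ,$$ and assume that $\sup_{0<t\le T}t^{1/4}\|\nabla\phi(t)\|_{L^2}<\infty$ (the class in which the local mild solution is constructed and unique). Then: 1. $\phi$ is a weak solution of (1) on $[0,T]$ with initial value $\phi_0$: $\phi\in L^\infty(0,T;L^2(\mathbb T^2))\cap L^2(0,T;H^2(\mathbb T^2))$, $\partial_t\phi\in L^2(0,T;H^{-2}(\mathbb T^2))$, and for every $\varphi\in C_c^\infty([0,T)\times\mathbb T^2)$ $$\int_{\mathbb T^2}\phi_0\,\varphi(0)\,dx+\int_0^T\!\!\int_{\mathbb T^2}\phi\,\partial_t\varphi\,dx\,dt=\int_0^T\!\!\int_{\mathbb T^2}\Delta\phi\,\Delta\varphi\,dx\,dt-\int_0^T\!\!\int_{\mathbb T^2}\nabla\phi\cdot\nabla\varphi\,dx\,dt+\frac12\int_0^T\!\!\int_{\mathbb T^2}|\nabla\phi|^2\varphi\,dx\,dt+\int_0^T\!\!\int_{\mathbb T^2}\varphi\,\mathbf v\cdot\nabla\phi\,dx\,dt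 .$$ 2. $|\Delta\phi|^2$, $|\nabla\phi|^2$ and $\phi|\nabla\phi|^2$ are integrable on $(0,T)\times\mathbb T^2$, and for every $0\le t<T$ $$\|\phi(t)\|_{L^2}^2+2\int_0^t\|\Delta\phi(s)\|_{L^2}^2\,ds=\|\phi_0\|_{L^2}^2+2\int_0^t\|\nabla\phi(s)\|_{L^2}^2\,ds-\int_0^t\!\int_{\mathbb T^2}\phi(s)\,|\nabla\phi(s)|^2\,dx\,ds .$$ -/

import Mathlib

open MeasureTheory Set
open scoped ContDiff

noncomputable section

namespace AdvectiveKSE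

/-- The plane with its Euclidean norm, where gradients and velocities take their values. -/
abbrev Vec : Type := EuclideanSpace ℝ (Fin 2)

/-- The two-dimensional torus with periods `L 0` and `L 1`. Its measure `volume` is the product of
the Lebesgue measures on the two circles, so it has total mass `L 0 * L 1`. -/
abbrev Torus (L : Fin 2 → ℝ) : Type := (j : Fin 2) → AddCircle (L j)

/-- The covering map from the plane onto the torus. -/
def cover (L : Fin 2 → ℝ) (y : Fin 2 → ℝ) : Torus L := fun j => (y j : AddCircle (L j))

/-- Smooth real functions on the torus. -/
def SmoothOnTorus (L : Fin 2 → ℝ) (ψ : Torus L → ℝ) : Prop :=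
  ContDiff ℝ ∞ (fun y : Fin 2 → ℝ => ψ (cover L y))

/-- The classical partial derivative in the `j`-th coordinate direction. -/
def pd (L : Fin 2 → ℝ) (j : Fin 2) (ψ : Torus L → ℝ) (x : Torus L) : ℝ :=
  deriv (fun h : ℝ => ψ (x + Pi.single j (h : AddCircle (L j)))) 0

/-- The classical gradient. -/
def grad (L : Fin 2 → ℝ) (ψ : Torus L → ℝ) (x : Torus L) : Vec :=
  WithLp.toLp 2 (fun j => pd L j ψ x)

/-- The classical Laplacian. -/
def lap (L : Fin 2 → ℝ) (ψ : Torus L → ℝ) (x : Torus L) : ℝ :=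
  ∑ j, pd L j (pd L j ψ) x

/-- Smooth functions on `[0, T) × torus`, up to the time `0`, with compact support in
`[0, T) × torus`, given as restrictions of smooth functions on `ℝ × torus` which vanish from some
time before `T` on. -/
structure IsTestFunction (L : Fin 2 → ℝ) (T : ℝ) (ψ : ℝ → Torus L → ℝ) : Prop where
  smooth : ContDiff ℝ ∞ (fun p : ℝ × (Fin 2 → ℝ) => ψ p.1 (cover L p.2))
  support : ∃ T' < T, ∀ t, T' ≤ t → ∀ x, ψ t x = 0

/-- The squared length `|k̃|²` of the frequency `k̃ = 2π (k₁ / L₁, k₂ / L₂)`. -/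
def freqSq (L : Fin 2 → ℝ) (k : Fin 2 → ℤ) : ℝ := ∑ j, (2 * Real.pi * k j / L j) ^ 2

/-- The symbol `|k̃|⁴ - |k̃|²` of the operator `Δ² + Δ`. -/
def symbol (L : Fin 2 → ℝ) (k : Fin 2 → ℤ) : ℝ := freqSq L k ^ 2 - freqSq L k

/-- The square of the `H^s` norm of the distribution with Fourier coefficients `a`, that is
`∑ₖ (1 + |k̃|²)^s |a k|²`, with the value `⊤` if the distribution is not in `H^s`. -/
def sobolevNormSq (L : Fin 2 → ℝ) (s : ℝ) (a : (Fin 2 → ℤ) → ℂ) : ENNReal :=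
  ∑' k, ENNReal.ofReal ((1 + freqSq L k) ^ s * ‖a k‖ ^ 2)

section

variable (L : Fin 2 → ℝ) [∀ j, Fact (0 < L j)]

/-- The real space `L²` of the torus. -/
abbrev L2 : Type := Lp ℝ 2 (volume : Measure (Torus L))

/-- The space `L²` of vector fields on the torus. -/
abbrev L2Vec : Type := Lp Vec 2 (volume : Measure (Torus L))

/-- `G` is an integrable weak (distributional) gradient of `f`. -/
def HasWeakGrad (f : L2 L) (G : Torus L → Vec) : Prop :=
  Integrable G volume ∧ ∀ ψ : Torus L → ℝ, SmoothOnTorus L ψ → ∀ j : Fin 2,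
    ∫ x, f x * pd L j ψ x = - ∫ x, G x j * ψ x

/-- `g` is an integrable weak (distributional) Laplacian of `f`. -/
def HasWeakLap (f : L2 L) (g : Torus L → ℝ) : Prop :=
  Integrable g volume ∧ ∀ ψ : Torus L → ℝ, SmoothOnTorus L ψ →
    ∫ x, f x * lap L ψ x = ∫ x, g x * ψ x

open Classical in
/-- The weak gradient of `f` (unique up to a null set), if there is one. -/
def weakGrad (f : L2 L) : Torus L → Vec :=
  if h : ∃ G, HasWeakGrad L f G then h.choose else 0

open Classical in
/-- The weak Laplacian of `f` (unique up to a null set), if there is one. -/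
def weakLap (f : L2 L) : Torus L → ℝ :=
  if h : ∃ g, HasWeakLap L f g then h.choose else 0

/-- The Fourier coefficient `(L₁ L₂)⁻¹ ∫ f(x) exp(-i k̃ ⋅ x) dx`, where `k̃ⱼ = 2π kⱼ / Lⱼ`. -/
def fourierCoefficient (f : Torus L → ℝ) (k : Fin 2 → ℤ) : ℂ :=
  ((∏ j, L j : ℝ) : ℂ)⁻¹ * ∫ x : Torus L, (f x : ℂ) * ∏ j, fourier (-(k j)) (x j)

open Classical in
/-- The semigroup generated by `-(Δ² + Δ)`, applied to an integrable function `f`: the element of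
`L²` whose Fourier coefficients are `exp(-t (|k̃|⁴ - |k̃|²))` times those of `f`. There is exactly
one if `t > 0`, or if `t = 0` and `f` is square integrable. -/
def semigroup (t : ℝ) (f : Torus L → ℝ) : L2 L :=
  if h : ∃ g : L2 L, ∀ k, fourierCoefficient L g k =
      (Real.exp (-t * symbol L k) : ℂ) * fourierCoefficient L f k
  then h.choose else 0

/-- The velocity field is divergence free in the sense of distributions, at almost every time. -/
def IsDivFree (v : ℝ → L2Vec L) : Prop :=
  ∀ᵐ t ∂(volume.restrict (Ioi (0 : ℝ))), ∀ ψ : Torus L → ℝ, SmoothOnTorus L ψ →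
    ∫ x, inner ℝ (v t x) (grad L ψ x) = 0

/-- Mild solutions on `[0, T]` with initial value `φ₀`. -/
structure IsMildSolution (v : ℝ → L2Vec L) (T : ℝ) (φ₀ : L2 L) (φ : ℝ → L2 L) : Prop where
  continuousOn : ContinuousOn φ (Icc 0 T)
  /-- `∇φ` is a (locally) integrable function on `[0, T] × torus`. -/
  hasWeakGrad : ∀ᵐ t ∂(volume.restrict (Ioc 0 T)), ∃ G, HasWeakGrad L (φ t) G
  integrable_grad : IntegrableOn (fun t => ∫ x, ‖weakGrad L (φ t) x‖) (Ioc 0 T)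
  /-- The two integrals exist as Bochner integrals in `L²`. -/
  integrable_nonlinear : ∀ t ∈ Icc 0 T, IntervalIntegrable
    (fun τ => semigroup L (t - τ) (fun x => ‖weakGrad L (φ τ) x‖ ^ 2)) volume 0 t
  integrable_advection : ∀ t ∈ Icc 0 T, IntervalIntegrable
    (fun τ => semigroup L (t - τ) (fun x => inner ℝ (v τ x) (weakGrad L (φ τ) x))) volume 0 t
  duhamel : ∀ t ∈ Icc 0 T, φ t = semigroup L t φ₀
    - (1 / 2 : ℝ) • (∫ τ in (0 : ℝ)..t,
        semigroup L (t - τ) (fun x => ‖weakGrad L (φ τ) x‖ ^ 2))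
    - ∫ τ in (0 : ℝ)..t,
        semigroup L (t - τ) (fun x => inner ℝ (v τ x) (weakGrad L (φ τ) x))

/-- `sup_{0 < t ≤ T} t^{1/4} ‖∇φ(t)‖_{L²} < ∞`. -/
def HasGradBound (T : ℝ) (φ : ℝ → L2 L) : Prop :=
  ∃ C : NNReal, ∀ t ∈ Ioc 0 T, (∃ G, HasWeakGrad L (φ t) G) ∧
    ENNReal.ofReal (t ^ (1 / 4 : ℝ)) * eLpNorm (weakGrad L (φ t)) 2 volume ≤ C

/-- `∂ₜφ ∈ L²(0, T; H^s)`: there is a function `g` of time in `L²(0, T; H^s)`, given by the Fourier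
coefficients of its values, which is the weak time derivative of `φ`. (Measurability into the
separable Hilbert space `H^s` is measurability of all the Fourier coefficients.) -/
def TimeDerivMemL2Sobolev (s T : ℝ) (φ : ℝ → L2 L) : Prop :=
  ∃ g : ℝ → (Fin 2 → ℤ) → ℂ,
    (∀ k, AEStronglyMeasurable (fun t => g t k) (volume.restrict (Ioo 0 T))) ∧
    (∫⁻ t in Ioo 0 T, sobolevNormSq L s (g t)) < ⊤ ∧
    ∀ η : ℝ → ℝ, ContDiff ℝ ∞ η → HasCompactSupport η → tsupport η ⊆ Ioo 0 T → ∀ k,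
      ∫ t in Ioo 0 T, ((deriv η t : ℝ) : ℂ) * fourierCoefficient L (φ t) k
        = - ∫ t in Ioo 0 T, ((η t : ℝ) : ℂ) * g t k

/-- Weak solutions on `[0, T)` with initial value `φ₀`. -/
structure IsWeakSolution (v : ℝ → L2Vec L) (T : ℝ) (φ₀ : L2 L) (φ : ℝ → L2 L) : Prop where
  /-- `φ ∈ L^∞(0, T; L²)`. -/
  memLp_top : MemLp φ ⊤ (volume.restrict (Ioo 0 T))
  /-- `φ ∈ L²(0, T; H²)`. -/
  memL2_sobolev : (∫⁻ t in Ioo 0 T, sobolevNormSq L 2 (fourierCoefficient L (φ t))) < ⊤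
  /-- `∂ₜφ ∈ L²(0, T; H⁻²)`. -/
  timeDeriv : TimeDerivMemL2Sobolev L (-2) T φ
  weak_form : ∀ ψ : ℝ → Torus L → ℝ, IsTestFunction L T ψ →
    (∫ x, φ₀ x * ψ 0 x) + (∫ t in (0 : ℝ)..T, ∫ x, φ t x * deriv (fun s => ψ s x) t)
      = (∫ t in (0 : ℝ)..T, ∫ x, weakLap L (φ t) x * lap L (ψ t) x)
        - (∫ t in (0 : ℝ)..T, ∫ x, inner ℝ (weakGrad L (φ t) x) (grad L (ψ t) x))
        + (1 / 2) * (∫ t in (0 : ℝ)..T, ∫ x, ‖weakGrad L (φ t) x‖ ^ 2 * ψ t x)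
        + (∫ t in (0 : ℝ)..T, ∫ x, ψ t x * inner ℝ (v t x) (weakGrad L (φ t) x))

end

end AdvectiveKSE

end

/-!
The proof works with the Fourier coefficients `φₖ(t)`. For a mild solution they are absolutely
continuous in time and satisfy `φₖ' = -(|k̃|⁴ - |k̃|²) φₖ - Nₖ`, where `Nₖ` are the coefficients of
the nonlinearity `N = |∇φ|² / 2 + v ⋅ ∇φ` (`IsMildSolution.fourierCoefficient_eq_integral`). Both claims
are sums over `k` of identities for these scalar equations, and the question is only whether the
sums converge.

Convergence follows from `φ ∈ L²(0, T; H²)`. As `N` is bounded in `L¹`, all its coefficients satisfy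
`|Nₖ| ≤ ‖∇φ‖² + K`, where norms of functions are normalized by the area and `K` comes from the bound
on the velocity. In two dimensions `∑ₖ 1 / (1 + |k̃|⁴)` converges, so `∑ₖ |φₖ|` is controlled by the
norm of `φ` in `H²`. The pairing `∑ₖ |Nₖ| |φₖ|` in the energy identity is therefore controlled by
`‖Δφ‖² + ‖∇φ‖⁴`, and `‖∇φ‖⁴ ≤ ‖φ‖² ‖Δφ‖²`. This is critical, with a constant that need not be small:
it becomes small after a finite number of frequencies has been set aside, and for those frequencies
the bound `‖∇φ(t)‖² ≤ C t^{-1/2}` suffices, since its right-hand side is integrable. This is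
`mode_regularity`; its argument starts at positive times, where `∇φ` is bounded, in order to know
beforehand that the quantity to be absorbed is finite.

Given this regularity, `∑ₖ ∫ |Nₖ| |bₖ| dt` converges for the coefficients `bₖ` of a test function
and for `bₖ = φₖ`, so sums and time integrals may be exchanged (`hasSum_integral_mul_conj`). Parseval's
identity for an integrable function and a function with summable Fourier coefficients
(`hasSum_fourierCoefficient_mul_conj_of_summable`) identifies the sums with integrals over the
torus. With a test function this gives the weak formulation; with `φ` itself it gives the energy
equality, in which the transport term vanishes because `φ` is a uniform limit of trigonometric
polynomials and `v` is divergence free (`integral_mul_inner_grad_eq_zero`).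
-/

namespace AdvectiveKSE

open scoped ComplexConjugate

/-! ### The Fourier basis of the torus -/

section
variable (L : Fin 2 → ℝ)

/-- The exponential monomial `x ↦ exp (i k̃ ⋅ x)` on the torus. -/
noncomputable def character (k : Fin 2 → ℤ) : C(Torus L, ℂ) where
  toFun x := ∏ j, fourier (k j) (x j)
  continuous_toFun := by fun_prop

variable {L}

theorem character_apply (k : Fin 2 → ℤ) (x : Torus L) :
    character L k x = ∏ j, fourier (k j) (x j) := rfl

theorem character_neg (k : Fin 2 → ℤ) (x : Torus L) :
    character L (-k) x = conj (character L k x) := by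
  simp only [character_apply, Pi.neg_apply, fourier_neg, map_prod]

theorem character_add (k l : Fin 2 → ℤ) (x : Torus L) :
    character L (k + l) x = character L k x * character L l x := by
  simp only [character_apply, Pi.add_apply, fourier_add, ← Finset.prod_mul_distrib]

theorem character_zero (x : Torus L) : character L 0 x = 1 := by
  simp [character_apply]

theorem norm_character (k : Fin 2 → ℤ) (x : Torus L) : ‖character L k x‖ = 1 := by
  simp [character_apply, fourier_apply, Circle.norm_coe]

theorem character_single (z : Torus L) (i : Fin 2) :
    character L (Pi.single i 1) z = fourier 1 (z i) := by
  rw [character_apply, Fintype.prod_eq_single i]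
  · simp
  · intro j hj
    simp [Pi.single_eq_of_ne hj]

end

section
variable (L : Fin 2 → ℝ) [∀ j, Fact (0 < L j)]

/-- The area of the torus. -/
noncomputable def area (L : Fin 2 → ℝ) : ℝ := ∏ j, L j

theorem area_pos : 0 < area L := Finset.prod_pos fun _ _ => Fact.out

theorem measureReal_univ : (volume : Measure (Torus L)).real univ = area L := by
  rw [measureReal_def, ← Set.pi_univ univ, volume_pi_pi]
  simp only [AddCircle.measure_univ, ENNReal.toReal_prod, area]
  exact Finset.prod_congr rfl fun j _ => ENNReal.toReal_ofReal (Fact.out : 0 < L j).le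

theorem integral_character (k : Fin 2 → ℤ) :
    ∫ x : Torus L, character L k x = if k = 0 then (area L : ℂ) else 0 := by
  split_ifs with h
  · subst h
    simp [character_zero, measureReal_univ]
  · simp only [character_apply]
    obtain ⟨i, hi⟩ := Function.ne_iff.mp h
    rw [integral_fintype_prod_volume_eq_prod (fun j (y : AddCircle (L j)) => fourier (k j) y)]
    refine Finset.prod_eq_zero (Finset.mem_univ i) ?_
    exact integral_eq_zero_of_add_right_eq_neg (μ := volume)
      (fourier_add_half_inv_index hi (Fact.out : 0 < L i))

/-- Stone–Weierstrass: trigonometric polynomials are dense in the continuous functions. -/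
theorem span_character_closure_eq_top :
    (Submodule.span ℂ (range (character L))).topologicalClosure = ⊤ := by
  let A : StarSubalgebra ℂ C(Torus L, ℂ) :=
    { toSubalgebra := Algebra.adjoin ℂ (range (character L))
      star_mem' := by
        change Algebra.adjoin ℂ (range (character L)) ≤
          star (Algebra.adjoin ℂ (range (character L)))
        refine Algebra.adjoin_le ?_
        rintro _ ⟨n, rfl⟩
        refine Algebra.subset_adjoin ⟨-n, ?_⟩
        ext1 x
        simp only [character_neg, starRingEnd_apply, ContinuousMap.star_apply] }
  have hspan : A.toSubalgebra.toSubmodule = Submodule.span ℂ (range (character L)) := by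
    apply Algebra.adjoin_eq_span_of_subset
    refine .trans (fun x ↦ Submonoid.closure_induction (fun _ ↦ id) ⟨0, ?_⟩ ?_)
      Submodule.subset_span
    · ext z
      simp [character_zero]
    · rintro _ _ _ _ ⟨m, rfl⟩ ⟨n, rfl⟩
      refine ⟨m + n, ?_⟩
      ext z
      simp [character_add]
  have hsep : A.SeparatesPoints := by
    intro x y hxy
    obtain ⟨i, hi⟩ := Function.ne_iff.mp hxy
    refine ⟨_, ⟨character L (Pi.single i 1), Algebra.subset_adjoin ⟨Pi.single i 1, rfl⟩, rfl⟩, ?_⟩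
    dsimp only
    rw [character_single, character_single, fourier_one, fourier_one]
    intro h
    exact hi (AddCircle.injective_toCircle (Fact.out : 0 < L i).ne' (Circle.coe_injective h))
  rw [← hspan]
  exact congr_arg (Subalgebra.toSubmodule <| StarSubalgebra.toSubalgebra ·)
    (ContinuousMap.starSubalgebra_topologicalClosure_eq_top_of_separatesPoints A hsep)

/-- The exponential monomials, normalized to have norm `1` in the complex `L²` space. -/
noncomputable def normalizedCharacter (k : Fin 2 → ℤ) : Lp ℂ 2 (volume : Measure (Torus L)) :=
  ((Real.sqrt (area L) : ℂ)⁻¹) • ContinuousMap.toLp (E := ℂ) 2 volume ℂ (character L k)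

theorem orthonormal_normalizedCharacter : Orthonormal ℂ (normalizedCharacter L) := by
  rw [orthonormal_iff_ite]
  intro m n
  have hA := area_pos L
  have hs : (Real.sqrt (area L) : ℂ) * (Real.sqrt (area L) : ℂ) = (area L : ℂ) := by
    rw [← Complex.ofReal_mul, Real.mul_self_sqrt hA.le]
  have hs0 : (Real.sqrt (area L) : ℂ) ≠ 0 := by
    simpa using (Real.sqrt_pos.2 hA).ne'
  simp only [normalizedCharacter, inner_smul_left, inner_smul_right, ContinuousMap.inner_toLp,
    ← character_neg, ← character_add]
  simp only [map_inv₀, Complex.conj_ofReal, integral_character]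
  by_cases h : m = n
  · subst h
    simp
    rw [← hs]; field_simp
  · have : ¬ (n + -m = 0) := fun h' => h (neg_add_eq_zero.1 ((add_comm _ _).trans h'))
    simp [h, this]

theorem span_normalizedCharacter_closure_eq_top :
    (Submodule.span ℂ (range (normalizedCharacter L))).topologicalClosure = ⊤ := by
  have h1 : (Submodule.span ℂ (range (fun k => ContinuousMap.toLp (E := ℂ) 2
      (volume : Measure (Torus L)) ℂ (character L k)))).topologicalClosure = ⊤ := by
    simpa only [Submodule.map_span, ContinuousLinearMap.coe_coe, ← range_comp,
      Function.comp_def] using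
      (ContinuousMap.toLp_denseRange ℂ (volume : Measure (Torus L)) ℂ
        (p := 2) (by simp)).topologicalClosure_map_submodule (span_character_closure_eq_top L)
  rw [← top_le_iff, ← h1]
  refine Submodule.topologicalClosure_mono (Submodule.span_le.2 ?_)
  rintro _ ⟨k, rfl⟩
  have hs0 : (Real.sqrt (area L) : ℂ) ≠ 0 := by
    simpa using (Real.sqrt_pos.2 (area_pos L)).ne'
  have := Submodule.smul_mem (Submodule.span ℂ (range (normalizedCharacter L)))
    (Real.sqrt (area L) : ℂ) (Submodule.subset_span ⟨k, rfl⟩)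
  simpa [normalizedCharacter, smul_smul, hs0] using this

/-- The Hilbert basis of normalized exponential monomials. -/
noncomputable def characterBasis :
    HilbertBasis (Fin 2 → ℤ) ℂ (Lp ℂ 2 (volume : Measure (Torus L))) :=
  HilbertBasis.mk (orthonormal_normalizedCharacter L)
    (span_normalizedCharacter_closure_eq_top L).ge

theorem coe_characterBasis : ⇑(characterBasis L) = normalizedCharacter L := HilbertBasis.coe_mk _ _

/-- The Fourier coefficient of a complex function on the torus. -/
noncomputable def coeffC (f : Torus L → ℂ) (k : Fin 2 → ℤ) : ℂ :=
  (area L : ℂ)⁻¹ * ∫ x : Torus L, f x * conj (character L k x)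

theorem fourierCoefficient_eq (f : Torus L → ℝ) (k : Fin 2 → ℤ) :
    fourierCoefficient L f k =
      (area L : ℂ)⁻¹ * ∫ x : Torus L, (f x : ℂ) * conj (character L k x) := by
  simp only [fourierCoefficient, area, ← character_neg]
  rfl

theorem characterBasis_repr (f : Lp ℂ 2 (volume : Measure (Torus L))) (k : Fin 2 → ℤ) :
    (characterBasis L).repr f k = (Real.sqrt (area L) : ℂ) * coeffC L f k := by
  have hA := area_pos L
  have hs : (Real.sqrt (area L) : ℂ) * (Real.sqrt (area L) : ℂ) = (area L : ℂ) := by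
    rw [← Complex.ofReal_mul, Real.mul_self_sqrt hA.le]
  have hs0 : (Real.sqrt (area L) : ℂ) ≠ 0 := by
    simpa using (Real.sqrt_pos.2 hA).ne'
  rw [HilbertBasis.repr_apply_apply, coe_characterBasis, normalizedCharacter, inner_smul_left,
    L2.inner_def, coeffC, ← hs]
  have : ∫ x, inner ℂ (ContinuousMap.toLp (E := ℂ) 2 (volume : Measure (Torus L)) ℂ
      (character L k) x) (f x) = ∫ x, f x * conj (character L k x) := by
    refine integral_congr_ae ?_
    filter_upwards [ContinuousMap.coeFn_toLp (𝕜 := ℂ) (p := 2) (volume : Measure (Torus L))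
      (character L k)] with x hx
    rw [hx]; simp [RCLike.inner_apply]
  rw [this]
  simp only [map_inv₀, Complex.conj_ofReal]
  field_simp

end

/-! ### Fourier coefficients of real functions -/

section
variable (L : Fin 2 → ℝ) [∀ j, Fact (0 < L j)]

theorem fourierCoefficient_eq_coeffC (f : Torus L → ℝ) (k : Fin 2 → ℤ) :
    fourierCoefficient L f k = coeffC L (fun x => (f x : ℂ)) k := fourierCoefficient_eq L f k

variable {L}

theorem integrable_complexOfReal {f : Torus L → ℝ} (hf : Integrable f volume) :
    Integrable (fun x => (f x : ℂ)) volume := hf.ofReal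

theorem memLp_complexOfReal {f : Torus L → ℝ} (hf : MemLp f 2 volume) :
    MemLp (fun x => (f x : ℂ)) 2 volume := hf.ofReal

theorem integrable_mul_conj_character {f : Torus L → ℂ} (hf : Integrable f volume)
    (k : Fin 2 → ℤ) : Integrable (fun x => f x * conj (character L k x)) volume := by
  refine hf.mul_bdd (c := 1) ?_ ?_
  · exact (Complex.continuous_conj.comp (character L k).continuous).aestronglyMeasurable
  · exact Filter.Eventually.of_forall fun x => by simp [norm_character]

theorem fourierCoefficient_congr {f g : Torus L → ℝ} (h : f =ᵐ[volume] g) (k : Fin 2 → ℤ) :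
    fourierCoefficient L f k = fourierCoefficient L g k := by
  rw [fourierCoefficient_eq, fourierCoefficient_eq]
  congr 1
  refine integral_congr_ae ?_
  filter_upwards [h] with x hx
  rw [hx]

theorem norm_fourierCoefficient_le (f : Torus L → ℝ) (k : Fin 2 → ℤ) :
    ‖fourierCoefficient L f k‖ ≤ (area L)⁻¹ * ∫ x, |f x| := by
  rw [fourierCoefficient_eq, norm_mul, norm_inv, Complex.norm_real,
    Real.norm_of_nonneg (area_pos L).le]
  refine mul_le_mul_of_nonneg_left ?_ (inv_nonneg.2 (area_pos L).le)
  refine (norm_integral_le_integral_norm _).trans (le_of_eq ?_)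
  refine integral_congr_ae (Filter.Eventually.of_forall fun x => ?_)
  simp [norm_character]

theorem fourierCoefficient_neg (f : Torus L → ℝ) (k : Fin 2 → ℤ) :
    fourierCoefficient L f (-k) = conj (fourierCoefficient L f k) := by
  rw [fourierCoefficient_eq, fourierCoefficient_eq, map_mul, map_inv₀, Complex.conj_ofReal,
    ← integral_conj]
  simp [character_neg]

theorem fourierCoefficient_add {f g : Torus L → ℝ} (hf : Integrable f volume)
    (hg : Integrable g volume) (k : Fin 2 → ℤ) :
    fourierCoefficient L (fun x => f x + g x) k =
      fourierCoefficient L f k + fourierCoefficient L g k := by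
  rw [fourierCoefficient_eq, fourierCoefficient_eq, fourierCoefficient_eq, ← mul_add]
  rw [← integral_add (integrable_mul_conj_character (integrable_complexOfReal hf) k)
    (integrable_mul_conj_character (integrable_complexOfReal hg) k)]
  simp [add_mul]

theorem fourierCoefficient_const_mul (c : ℝ) (f : Torus L → ℝ) (k : Fin 2 → ℤ) :
    fourierCoefficient L (fun x => c * f x) k = c * fourierCoefficient L f k := by
  simp only [fourierCoefficient_eq, Complex.ofReal_mul, mul_assoc, integral_const_mul]
  ring

theorem coeffC_congr {f g : Torus L → ℂ} (h : f =ᵐ[volume] g) (k : Fin 2 → ℤ) :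
    coeffC L f k = coeffC L g k := by
  rw [coeffC, coeffC]
  congr 1
  refine integral_congr_ae ?_
  filter_upwards [h] with x hx
  rw [hx]

/-- **Parseval's identity** for real square integrable functions. -/
theorem hasSum_fourierCoefficient_mul_conj {f g : Torus L → ℝ} (hf : MemLp f 2 volume)
    (hg : MemLp g 2 volume) :
    HasSum (fun k => fourierCoefficient L f k * conj (fourierCoefficient L g k))
      (((area L)⁻¹ * ∫ x, f x * g x : ℝ) : ℂ) := by
  have hA := area_pos L
  have hs : (Real.sqrt (area L) : ℂ) * (Real.sqrt (area L) : ℂ) = (area L : ℂ) := by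
    rw [← Complex.ofReal_mul, Real.mul_self_sqrt hA.le]
  have hA0 : (area L : ℂ) ≠ 0 := by simpa using hA.ne'
  have key := (characterBasis L).hasSum_inner_mul_inner (memLp_complexOfReal hg).toLp
    (memLp_complexOfReal hf).toLp
  have e1 : ∀ {u : Torus L → ℝ} (hu : MemLp u 2 volume) (k : Fin 2 → ℤ),
      inner ℂ (characterBasis L k) (memLp_complexOfReal hu).toLp =
        Real.sqrt (area L) * fourierCoefficient L u k := by
    intro u hu k
    rw [← HilbertBasis.repr_apply_apply, characterBasis_repr, fourierCoefficient_eq_coeffC,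
      coeffC_congr (memLp_complexOfReal hu).coeFn_toLp]
  have e2 : inner ℂ (memLp_complexOfReal hg).toLp (memLp_complexOfReal hf).toLp =
      ((∫ x, f x * g x : ℝ) : ℂ) := by
    rw [L2.inner_def, ← integral_complex_ofReal]
    refine integral_congr_ae ?_
    filter_upwards [(memLp_complexOfReal hg).coeFn_toLp,
      (memLp_complexOfReal hf).coeFn_toLp] with x hx hx'
    rw [hx, hx']
    simp [RCLike.inner_apply]
  rw [e2] at key
  have := key.mul_left (area L : ℂ)⁻¹
  push_cast
  refine this.congr_fun fun k => ?_
  rw [← inner_conj_symm _ (characterBasis L k), e1 hf, e1 hg, map_mul, Complex.conj_ofReal]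
  linear_combination (-(area L : ℂ)⁻¹ * fourierCoefficient L f k *
    conj (fourierCoefficient L g k)) * hs + (-fourierCoefficient L f k *
    conj (fourierCoefficient L g k)) * (inv_mul_cancel₀ hA0)

theorem hasSum_norm_fourierCoefficient_sq {f : Torus L → ℝ} (hf : MemLp f 2 volume) :
    HasSum (fun k => ‖fourierCoefficient L f k‖ ^ 2) ((area L)⁻¹ * ∫ x, f x ^ 2) := by
  have := Complex.hasSum_re (hasSum_fourierCoefficient_mul_conj hf hf)
  simp only [Complex.mul_conj, Complex.ofReal_re, Complex.normSq_eq_norm_sq] at this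
  simpa only [pow_two] using this

/-- **Riesz–Fischer**: a square summable family with the conjugation symmetry of the Fourier
coefficients of real functions is the family of Fourier coefficients of a real function. -/
theorem exists_fourierCoefficient_eq {b : (Fin 2 → ℤ) → ℂ} (hb : Summable fun k => ‖b k‖ ^ 2)
    (hconj : ∀ k, b (-k) = conj (b k)) : ∃ f : L2 L, ∀ k, fourierCoefficient L f k = b k := by
  have hA := area_pos L
  have hs0 : (Real.sqrt (area L) : ℂ) ≠ 0 := by
    simpa using (Real.sqrt_pos.2 hA).ne'
  have hmem : Memℓp (fun k => (Real.sqrt (area L) : ℂ) * b k) 2 := by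
    refine memℓp_gen ((hb.mul_left (‖(Real.sqrt (area L) : ℂ)‖ ^ 2)).congr fun k => ?_)
    rw [ENNReal.toReal_ofNat, Real.rpow_two, norm_mul, mul_pow]
  let F : Lp ℂ 2 (volume : Measure (Torus L)) := (characterBasis L).repr.symm ⟨_, hmem⟩
  have hF : ∀ k, coeffC L F k = b k := by
    intro k
    have h1 := characterBasis_repr L F k
    simp only [F, LinearIsometryEquiv.apply_symm_apply] at h1
    exact (mul_left_cancel₀ hs0 h1).symm
  have hFi : Integrable F volume := (Lp.memLp F).integrable (by norm_num)
  have hre : MemLp (fun x => (F x).re) 2 volume := (Lp.memLp F).re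
  refine ⟨hre.toLp, fun k => ?_⟩
  rw [fourierCoefficient_congr hre.coeFn_toLp, fourierCoefficient_eq]
  have h2 : ∀ x, ((F x).re : ℂ) * conj (character L k x) =
      (1 / 2 : ℂ) * (F x * conj (character L k x) + conj (F x * conj (character L (-k) x))) := by
    intro x
    rw [character_neg, Complex.re_eq_add_conj]
    simp
    ring
  have hint : Integrable (fun x => conj (F x * conj (character L (-k) x))) volume :=
    ContinuousLinearMap.integrable_comp (Complex.conjCLE : ℂ →L[ℝ] ℂ)
      (integrable_mul_conj_character hFi (-k))
  rw [integral_congr_ae (Filter.Eventually.of_forall h2), integral_const_mul,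
    integral_add (integrable_mul_conj_character hFi k) hint, integral_conj]
  have h3 : conj (coeffC L F (-k)) = b k := by rw [hF, hconj, Complex.conj_conj]
  have h4 := hF k
  rw [coeffC] at h3 h4
  rw [map_mul, map_inv₀, Complex.conj_ofReal] at h3
  linear_combination (1 / 2 : ℂ) * h3 + (1 / 2 : ℂ) * h4

theorem integral_mul_eq_zero_of_coeffC_eq_zero {f : Torus L → ℂ} (hf : Integrable f volume)
    (h : ∀ k, coeffC L f k = 0) (c : C(Torus L, ℂ)) : ∫ x, f x * c x = 0 := by
  have hA0 : (area L : ℂ)⁻¹ ≠ 0 := by simpa using (area_pos L).ne'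
  have hint : ∀ c : C(Torus L, ℂ), Integrable (fun x => f x * c x) volume := fun c =>
    hf.mul_bdd (c := ‖c‖) c.continuous.aestronglyMeasurable
      (Filter.Eventually.of_forall c.norm_coe_le_norm)
  let Λ : C(Torus L, ℂ) →ₗ[ℂ] ℂ :=
    { toFun := fun c => ∫ x, f x * c x
      map_add' := fun c d => by
        rw [← integral_add (hint c) (hint d)]; simp [mul_add]
      map_smul' := fun a c => by
        rw [RingHom.id_apply, smul_eq_mul, ← integral_const_mul]
        simp only [ContinuousMap.smul_apply, smul_eq_mul]
        congr 1; ext x; ring }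
  let Λc : C(Torus L, ℂ) →L[ℂ] ℂ := Λ.mkContinuous (∫ x, ‖f x‖) fun c => by
    refine (norm_integral_le_integral_norm _).trans ?_
    rw [← integral_mul_const]
    refine integral_mono (hint c).norm (hf.norm.mul_const _) fun x => ?_
    simp only [norm_mul]
    exact mul_le_mul_of_nonneg_left (c.norm_coe_le_norm x) (norm_nonneg _)
  have hle : Submodule.span ℂ (range (character L)) ≤
      LinearMap.ker (Λc : C(Torus L, ℂ) →ₗ[ℂ] ℂ) := by
    rw [Submodule.span_le]
    rintro _ ⟨k, rfl⟩
    have := h (-k)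
    rw [coeffC, mul_eq_zero, or_iff_right hA0] at this
    change ∫ x, f x * character L k x = 0
    simpa [character_neg] using this
  have hcl := Submodule.topologicalClosure_minimal _ hle Λc.isClosed_ker
  rw [span_character_closure_eq_top] at hcl
  exact hcl (Submodule.mem_top : c ∈ ⊤)

/-- An integrable function on the torus is determined by its Fourier coefficients. -/
theorem ae_eq_zero_of_coeffC_eq_zero {f : Torus L → ℂ} (hf : Integrable f volume)
    (h : ∀ k, coeffC L f k = 0) : f =ᵐ[volume] 0 := by
  refine ae_eq_zero_of_forall_setIntegral_isClosed_eq_zero hf fun s hs => ?_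
  -- The indicator of the closed set `s` is a limit of continuous functions.
  have h1 : Filter.Tendsto (fun n : ℕ => ∫ x, f x *
      ((thickenedIndicator (Nat.one_div_pos_of_nat : 0 < 1 / ((n : ℝ) + 1)) s x : NNReal) : ℝ))
      Filter.atTop (nhds (∫ x, s.indicator f x)) := by
    refine tendsto_integral_of_dominated_convergence (fun x => ‖f x‖) ?_ hf.norm ?_ ?_
    · intro n
      refine hf.aestronglyMeasurable.mul ?_
      exact (Complex.continuous_ofReal.comp (NNReal.continuous_coe.comp
        (thickenedIndicator _ s).continuous)).aestronglyMeasurable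
    · intro n
      refine Filter.Eventually.of_forall fun x => ?_
      rw [norm_mul, Complex.norm_real, Real.norm_of_nonneg (NNReal.coe_nonneg _)]
      refine mul_le_of_le_one_right (norm_nonneg _) ?_
      exact_mod_cast thickenedIndicator_le_one _ s x
    · refine Filter.Eventually.of_forall fun x => ?_
      have := thickenedIndicator_tendsto_indicator_closure
        (fun n : ℕ => (Nat.one_div_pos_of_nat : 0 < 1 / ((n : ℝ) + 1)))
        tendsto_one_div_add_atTop_nhds_zero_nat s
      rw [tendsto_pi_nhds] at this
      have h2 := (this x)
      rw [hs.closure_eq] at h2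
      have h3 : Filter.Tendsto (fun n : ℕ => f x *
        ((thickenedIndicator (Nat.one_div_pos_of_nat : 0 < 1 / ((n : ℝ) + 1)) s x : NNReal) : ℝ))
        Filter.atTop (nhds (f x * ((s.indicator (fun _ => (1 : NNReal)) x : NNReal) : ℝ))) :=
        ((Complex.continuous_ofReal.tendsto _).comp
          ((NNReal.continuous_coe.tendsto _).comp h2)).const_mul (f x)
      convert h3 using 2
      by_cases hx : x ∈ s <;> simp [hx]
  rw [← integral_indicator hs.measurableSet]
  refine tendsto_nhds_unique h1 ?_
  refine tendsto_const_nhds.congr fun n => ?_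
  exact (integral_mul_eq_zero_of_coeffC_eq_zero hf h
    ⟨_, Complex.continuous_ofReal.comp (NNReal.continuous_coe.comp
        (thickenedIndicator (Nat.one_div_pos_of_nat : 0 < 1 / ((n : ℝ) + 1)) s).continuous)⟩).symm

theorem ae_eq_of_coeffC_eq {f g : Torus L → ℂ} (hf : Integrable f volume)
    (hg : Integrable g volume) (h : ∀ k, coeffC L f k = coeffC L g k) : f =ᵐ[volume] g := by
  rw [← sub_ae_eq_zero]
  refine ae_eq_zero_of_coeffC_eq_zero (hf.sub hg) fun k => ?_
  have := h k
  rw [coeffC, coeffC] at this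
  rw [coeffC]
  simp only [Pi.sub_apply, sub_mul]
  rw [integral_sub (integrable_mul_conj_character hf k) (integrable_mul_conj_character hg k),
    mul_sub, this, sub_self]

theorem ae_eq_of_fourierCoefficient_eq {f g : Torus L → ℝ} (hf : Integrable f volume)
    (hg : Integrable g volume) (h : ∀ k, fourierCoefficient L f k = fourierCoefficient L g k) :
    f =ᵐ[volume] g := by
  have := ae_eq_of_coeffC_eq (integrable_complexOfReal hf) (integrable_complexOfReal hg)
    (fun k => by simpa only [fourierCoefficient_eq_coeffC] using h k)
  filter_upwards [this] with x hx
  exact Complex.ofReal_injective hx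

/-- The Fourier series of an integrable function with summable Fourier coefficients converges to
it. -/
theorem ae_hasSum_fourierCoefficient {f : Torus L → ℝ} (hf : Integrable f volume)
    (hs : Summable fun k => ‖fourierCoefficient L f k‖) :
    ∀ᵐ x, HasSum (fun k => fourierCoefficient L f k * character L k x) (f x : ℂ) := by
  have hA0 : (area L : ℂ) ≠ 0 := by simpa using (area_pos L).ne'
  have hsum : ∀ x, Summable fun k => fourierCoefficient L f k * character L k x := fun x =>
    Summable.of_norm (by simpa [norm_character] using hs)
  have hcont : Continuous fun x => ∑' k, fourierCoefficient L f k * character L k x :=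
    continuous_tsum (fun k => continuous_const.mul (character L k).continuous) hs
      (fun k x => by simp [norm_character])
  have hgi : Integrable (fun x => ∑' k, fourierCoefficient L f k * character L k x)
      (volume : Measure (Torus L)) :=
    (ContinuousMap.mk _ hcont).continuous.integrable_of_hasCompactSupport
      (HasCompactSupport.of_compactSpace _)
  have := ae_eq_of_coeffC_eq (integrable_complexOfReal hf) hgi fun l => by
    rw [← fourierCoefficient_eq_coeffC]
    have h1 := hasSum_integral_of_summable_integral_norm (μ := (volume : Measure (Torus L)))
      (F := fun k x => fourierCoefficient L f k * character L k x * conj (character L l x))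
      (fun k => integrable_mul_conj_character
        ((character L k).continuous.integrable_of_hasCompactSupport
          (HasCompactSupport.of_compactSpace _) |>.const_mul _) l)
      (by simpa [norm_character] using hs.mul_left _)
    have h2 : ∀ k, ∫ x, fourierCoefficient L f k * character L k x * conj (character L l x) =
        if k = l then fourierCoefficient L f l * area L else 0 := by
      intro k
      simp_rw [mul_assoc, ← character_neg, ← character_add, integral_const_mul,
        integral_character]
      by_cases hkl : k = l
      · simp [hkl]
      · have : ¬ k + -l = 0 := fun h => hkl (by simpa using add_eq_zero_iff_eq_neg.1 h)
        simp [hkl, this]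
    simp_rw [h2, tsum_mul_right] at h1
    have h3 := h1.unique (hasSum_ite_eq l _)
    rw [coeffC, h3, mul_comm _ (area L : ℂ), inv_mul_cancel_left₀ hA0]
  filter_upwards [this] with x hx
  exact hx ▸ (hsum x).hasSum

/-- Parseval's identity for an integrable function and a function with summable Fourier
coefficients. -/
theorem hasSum_fourierCoefficient_mul_conj_of_summable {h f : Torus L → ℝ}
    (hh : Integrable h volume) (hf : Integrable f volume)
    (hs : Summable fun k => ‖fourierCoefficient L f k‖) :
    HasSum (fun k => fourierCoefficient L h k * conj (fourierCoefficient L f k))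
      (((area L)⁻¹ * ∫ x, h x * f x : ℝ) : ℂ) := by
  have h1 := hasSum_integral_of_summable_integral_norm (μ := (volume : Measure (Torus L)))
    (F := fun k x => conj (fourierCoefficient L f k) * ((h x : ℂ) * conj (character L k x)))
    (fun k => (integrable_mul_conj_character (integrable_complexOfReal hh) k).const_mul _)
    (by simpa [norm_character, integral_const_mul] using hs.mul_right _)
  have h2 : ∫ x, ∑' k, conj (fourierCoefficient L f k) * ((h x : ℂ) * conj (character L k x)) =
      ((∫ x, h x * f x : ℝ) : ℂ) := by
    rw [← integral_complex_ofReal]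
    refine integral_congr_ae ?_
    filter_upwards [ae_hasSum_fourierCoefficient hf hs] with x hx
    have := (Complex.hasSum_conj'.2 hx).mul_left (h x : ℂ)
    rw [Complex.conj_ofReal] at this
    push_cast
    rw [← this.tsum_eq]
    refine tsum_congr fun k => ?_
    rw [map_mul]; ring
  rw [h2] at h1
  have := h1.mul_left (area L : ℂ)⁻¹
  push_cast
  refine this.congr_fun fun k => ?_
  rw [integral_const_mul, fourierCoefficient_eq L h]
  ring

end

/-! ### Frequencies -/

section
variable (L : Fin 2 → ℝ)

/-- The `j`-th component `2π kⱼ / Lⱼ` of the frequency `k̃`. -/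
noncomputable def freq (j : Fin 2) (k : Fin 2 → ℤ) : ℝ := 2 * Real.pi * k j / L j

variable {L}

theorem freqSq_eq (k : Fin 2 → ℤ) : freqSq L k = ∑ j, freq L j k ^ 2 := rfl

theorem freqSq_nonneg (k : Fin 2 → ℤ) : 0 ≤ freqSq L k :=
  Finset.sum_nonneg fun _ _ => sq_nonneg _

theorem freq_neg (j : Fin 2) (k : Fin 2 → ℤ) : freq L j (-k) = -freq L j k := by
  simp [freq, neg_div]

theorem freqSq_neg (k : Fin 2 → ℤ) : freqSq L (-k) = freqSq L k := by
  simp [freqSq_eq, freq_neg]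

theorem cover_add_single (y : Fin 2 → ℝ) (j : Fin 2) (h : ℝ) :
    cover L (y + Pi.single j h) = cover L y + Pi.single j (h : AddCircle (L j)) := by
  ext i
  by_cases hi : i = j
  · subst hi; simp [cover]
  · simp [cover, hi]

theorem isOpenQuotientMap_cover : IsOpenQuotientMap (cover L) :=
  IsOpenQuotientMap.piMap fun _ => QuotientAddGroup.isOpenQuotientMap_mk

theorem character_cover (k : Fin 2 → ℤ) (y : Fin 2 → ℝ) :
    character L k (cover L y) = Complex.exp (Complex.I * (∑ j, freq L j k * y j : ℝ)) := by
  rw [character_apply, Complex.ofReal_sum, Finset.mul_sum, Complex.exp_sum]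
  refine Finset.prod_congr rfl fun j _ => ?_
  rw [cover, fourier_coe_apply]
  congr 1
  simp only [freq]
  push_cast
  ring

theorem character_single_coe (k : Fin 2 → ℤ) (j : Fin 2) (h : ℝ) :
    character L k (Pi.single j (h : AddCircle (L j))) =
      Complex.exp (Complex.I * (freq L j k * h : ℝ)) := by
  have : (Pi.single j (h : AddCircle (L j)) : Torus L) = cover L (Pi.single j h) := by
    have := cover_add_single (L := L) 0 j h
    rw [zero_add] at this
    rw [this, eq_comm, add_eq_right]
    ext i
    simp [cover]
  rw [this, character_cover, Fintype.sum_eq_single j]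
  · simp
  · intro i hi
    simp [hi]

theorem character_apply_add (k : Fin 2 → ℤ) (x z : Torus L) :
    character L k (x + z) = character L k x * character L k z := by
  simp only [character_apply, ← Finset.prod_mul_distrib]
  refine Finset.prod_congr rfl fun j _ => ?_
  simp [fourier_apply, AddCircle.toCircle_add]

/-! ### Smooth functions on the torus -/

/-- A real trigonometric polynomial: the real part of `∑ₖ aₖ exp (i k̃ ⋅ x)` over the finite set
`F`. It equals the sum itself if `F` and `a` have the symmetry `k ↦ -k` of real functions. -/
noncomputable def trigPoly (L : Fin 2 → ℝ) (F : Finset (Fin 2 → ℤ)) (a : (Fin 2 → ℤ) → ℂ)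
    (x : Torus L) : ℝ := ∑ k ∈ F, (a k * character L k x).re

theorem continuous_uncurry_trigPoly {X : Type*} [TopologicalSpace X] (F : Finset (Fin 2 → ℤ))
    {c : (Fin 2 → ℤ) → X → ℂ} (hc : ∀ k, Continuous (c k)) :
    Continuous fun p : X × Torus L => trigPoly L F (fun k => c k p.1) p.2 := by
  unfold trigPoly
  refine continuous_finsetSum F fun k _ => Complex.continuous_re.comp ?_
  exact ((hc k).comp continuous_fst).mul ((character L k).continuous.comp continuous_snd)

theorem smoothOnTorus_trigPoly (F : Finset (Fin 2 → ℤ)) (a : (Fin 2 → ℤ) → ℂ) :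
    SmoothOnTorus L (trigPoly L F a) := by
  unfold SmoothOnTorus trigPoly
  simp only [character_cover]
  refine ContDiff.sum fun k _ => ?_
  have h : ContDiff ℝ ∞ (fun y : Fin 2 → ℝ => ∑ j, freq L j k * y j) :=
    ContDiff.sum fun j _ => contDiff_const.mul (contDiff_apply ℝ ℝ j)
  exact Complex.reCLM.contDiff.comp (contDiff_const.mul (Complex.contDiff_exp.comp
    (contDiff_const.mul (Complex.ofRealCLM.contDiff.comp h))))

theorem continuous_trigPoly (F : Finset (Fin 2 → ℤ)) (a : (Fin 2 → ℤ) → ℂ) :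
    Continuous (trigPoly L F a) := by
  unfold trigPoly
  fun_prop

theorem pd_trigPoly (j : Fin 2) (F : Finset (Fin 2 → ℤ)) (a : (Fin 2 → ℤ) → ℂ) :
    pd L j (trigPoly L F a) = trigPoly L F (fun k => Complex.I * freq L j k * a k) := by
  ext x
  unfold pd trigPoly
  refine HasDerivAt.deriv ?_
  refine HasDerivAt.fun_sum fun k _ => ?_
  simp only [character_apply_add, character_single_coe]
  have h1 : HasDerivAt (fun h : ℝ => Complex.exp (Complex.I * (freq L j k * h : ℝ)))
      (Complex.I * freq L j k) 0 := by
    have h2 : HasDerivAt (fun h : ℝ => Complex.I * ((freq L j k * h : ℝ) : ℂ))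
        (Complex.I * freq L j k) 0 := by
      have := ((hasDerivAt_id (0 : ℝ)).const_mul (freq L j k)).ofReal_comp.const_mul Complex.I
      simpa using this
    simpa using h2.cexp
  have h3 := Complex.reCLM.hasFDerivAt.comp_hasDerivAt 0
    (h1.const_mul (a k * character L k x))
  refine (h3.congr_deriv ?_).congr_of_eventuallyEq (Filter.Eventually.of_forall fun h => ?_)
  · simp only [Complex.reCLM_apply]; congr 1; ring
  · simp only [Function.comp, Complex.reCLM_apply]; congr 1; ring

theorem lap_trigPoly (F : Finset (Fin 2 → ℤ)) (a : (Fin 2 → ℤ) → ℂ) :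
    lap L (trigPoly L F a) = trigPoly L F (fun k => -freqSq L k * a k) := by
  ext x
  simp only [lap, pd_trigPoly, trigPoly]
  rw [Finset.sum_comm]
  refine Finset.sum_congr rfl fun k _ => ?_
  rw [← Complex.re_sum, freqSq_eq, ← Finset.sum_mul]
  congr 2
  push_cast
  rw [← Finset.sum_neg_distrib, Finset.sum_mul]
  refine Finset.sum_congr rfl fun j _ => ?_
  linear_combination (freq L j k ^ 2 * a k) * Complex.I_sq

/-- A family of functions on the torus which depends smoothly on a real parameter. Smoothness is
tested on the covering plane, jointly in the parameter and the point. -/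
def SmoothFamily (L : Fin 2 → ℝ) (ψ : ℝ → Torus L → ℝ) : Prop :=
  ContDiff ℝ ∞ (fun p : ℝ × (Fin 2 → ℝ) => ψ p.1 (cover L p.2))

theorem SmoothOnTorus.smoothFamily {ψ : Torus L → ℝ} (hψ : SmoothOnTorus L ψ) :
    SmoothFamily L (fun _ => ψ) := hψ.comp contDiff_snd

namespace SmoothFamily

variable {ψ : ℝ → Torus L → ℝ}

theorem hasDerivAt_line (hψ : SmoothFamily L ψ) (p d : ℝ × (Fin 2 → ℝ)) (s : ℝ) :
    HasDerivAt (fun s : ℝ => ψ (p + s • d).1 (cover L (p + s • d).2))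
      (fderiv ℝ (fun p : ℝ × (Fin 2 → ℝ) => ψ p.1 (cover L p.2)) (p + s • d) d) s := by
  have h1 : HasDerivAt (fun s : ℝ => p + s • d) d s := by
    simpa using ((hasDerivAt_id s).smul_const d).const_add p
  exact ((hψ.differentiable (by simp)) (p + s • d)).hasFDerivAt.comp_hasDerivAt s h1

theorem contDiff_fderiv_apply (hψ : SmoothFamily L ψ) (d : ℝ × (Fin 2 → ℝ)) :
    ContDiff ℝ ∞ (fun p => fderiv ℝ (fun p : ℝ × (Fin 2 → ℝ) => ψ p.1 (cover L p.2)) p d) :=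
  (hψ.fderiv_right (m := ∞) (by simp)).clm_apply contDiff_const

theorem pd_cover (hψ : SmoothFamily L ψ) (j : Fin 2) (t : ℝ) (y : Fin 2 → ℝ) :
    pd L j (ψ t) (cover L y) =
      fderiv ℝ (fun p : ℝ × (Fin 2 → ℝ) => ψ p.1 (cover L p.2)) (t, y) (0, Pi.single j 1) := by
  have := hψ.hasDerivAt_line (t, y) (0, Pi.single j 1) 0
  rw [zero_smul, add_zero] at this
  rw [← this.deriv]
  unfold pd
  congr 1
  ext h
  simp [← cover_add_single, ← Pi.single_smul]

theorem timeDeriv_cover (hψ : SmoothFamily L ψ) (t : ℝ) (y : Fin 2 → ℝ) :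
    deriv (fun s => ψ s (cover L y)) t =
      fderiv ℝ (fun p : ℝ × (Fin 2 → ℝ) => ψ p.1 (cover L p.2)) (t, y) (1, 0) := by
  have := hψ.hasDerivAt_line (0, y) (1, 0) t
  simpa using this.deriv

theorem pd_family (hψ : SmoothFamily L ψ) (j : Fin 2) :
    SmoothFamily L (fun t => pd L j (ψ t)) := by
  unfold SmoothFamily
  simp only [hψ.pd_cover j]
  exact hψ.contDiff_fderiv_apply _

theorem timeDeriv_family (hψ : SmoothFamily L ψ) :
    SmoothFamily L (fun t x => deriv (fun s => ψ s x) t) := by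
  unfold SmoothFamily
  simp only [hψ.timeDeriv_cover]
  exact hψ.contDiff_fderiv_apply _

theorem hasDerivAt_time (hψ : SmoothFamily L ψ) (t : ℝ) (x : Torus L) :
    HasDerivAt (fun s => ψ s x) (deriv (fun s => ψ s x) t) t := by
  obtain ⟨y, rfl⟩ := isOpenQuotientMap_cover.surjective x
  have := hψ.hasDerivAt_line (0, y) (1, 0) t
  rw [hψ.timeDeriv_cover]
  simpa using this

theorem hasDerivAt_single (hψ : SmoothFamily L ψ) (t : ℝ) (j : Fin 2) (x : Torus L) (h : ℝ) :
    HasDerivAt (fun h : ℝ => ψ t (x + Pi.single j (h : AddCircle (L j))))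
      (pd L j (ψ t) (x + Pi.single j (h : AddCircle (L j)))) h := by
  obtain ⟨y, rfl⟩ := isOpenQuotientMap_cover.surjective x
  have := hψ.hasDerivAt_line (t, y) (0, Pi.single j 1) h
  rw [← cover_add_single, hψ.pd_cover]
  simpa [← cover_add_single, ← Pi.single_smul] using this

theorem continuous_apply (hψ : SmoothFamily L ψ) (t : ℝ) : Continuous (ψ t) := by
  rw [isOpenQuotientMap_cover.isQuotientMap.continuous_iff]
  exact hψ.continuous.comp (Continuous.prodMk_right t)

theorem lap_family (hψ : SmoothFamily L ψ) :
    SmoothFamily L (fun t => lap L (ψ t)) := by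
  have : SmoothFamily L (fun t x => ∑ j, pd L j (pd L j (ψ t)) x) :=
    ContDiff.sum fun j _ => (hψ.pd_family j).pd_family j
  exact this

end SmoothFamily

end

/-! ### Fourier coefficients of smooth functions -/

section
variable {L : Fin 2 → ℝ} [∀ j, Fact (0 < L j)]

theorem SmoothFamily.exists_bound {ψ : ℝ → Torus L → ℝ} (hψ : SmoothFamily L ψ) (a b : ℝ) :
    ∃ C, 0 ≤ C ∧ ∀ t ∈ Icc a b, ∀ x, |ψ t x| ≤ C := by
  have hK : IsCompact (Icc a b ×ˢ Icc (0 : Fin 2 → ℝ) L) := isCompact_Icc.prod isCompact_Icc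
  obtain ⟨C, hC⟩ := hK.exists_bound_of_continuousOn hψ.continuous.continuousOn
  refine ⟨max C 0, le_max_right _ _, fun t ht x => le_max_of_le_left ?_⟩
  have : ∀ j, ∃ y ∈ Ico (0 : ℝ) (0 + L j), (y : AddCircle (L j)) = x j := fun j =>
    (AddCircle.coe_image_Ico_eq (L j) 0).ge (mem_univ (x j))
  choose y hy hyx using this
  have hx : x = cover L y := funext fun j => (hyx j).symm
  rw [hx]
  exact hC (t, y) ⟨ht, fun j => (hy j).1, fun j => by simpa using (hy j).2.le⟩

theorem integrable_of_continuous {E : Type*} [NormedAddCommGroup E] {f : Torus L → E}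
    (hf : Continuous f) : Integrable f volume :=
  hf.integrable_of_hasCompactSupport (HasCompactSupport.of_compactSpace _)

theorem memLp_of_continuous {E : Type*} [NormedAddCommGroup E] {f : Torus L → E}
    (hf : Continuous f) : MemLp f 2 volume :=
  hf.memLp_of_hasCompactSupport (HasCompactSupport.of_compactSpace _)

/-- Differentiation under the integral sign in a Fourier coefficient. -/
theorem hasDerivAt_fourierCoefficient_of_bound {χ χ' : ℝ → Torus L → ℝ} {t C : ℝ} {s : Set ℝ}
    (hs : s ∈ nhds t) (hχ : ∀ h, Continuous (χ h)) (hχ' : ∀ h, Continuous (χ' h))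
    (hd : ∀ h x, HasDerivAt (fun h => χ h x) (χ' h x) h) (hC : ∀ h ∈ s, ∀ x, |χ' h x| ≤ C)
    (k : Fin 2 → ℤ) :
    HasDerivAt (fun h => fourierCoefficient L (χ h) k) (fourierCoefficient L (χ' t) k) t := by
  have hcont : ∀ {u : Torus L → ℝ}, Continuous u →
      Continuous fun x => (u x : ℂ) * conj (character L k x) := fun hu => by fun_prop
  have h1 := hasDerivAt_integral_of_dominated_loc_of_deriv_le (μ := (volume : Measure (Torus L)))
    (F := fun (h : ℝ) x => (χ h x : ℂ) * conj (character L k x))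
    (F' := fun (h : ℝ) x => (χ' h x : ℂ) * conj (character L k x))
    (x₀ := t) (s := s) (bound := fun _ => C) hs
    (Filter.Eventually.of_forall fun h => (hcont (hχ h)).aestronglyMeasurable)
    (integrable_of_continuous (hcont (hχ t)))
    (hcont (hχ' t)).aestronglyMeasurable
    (Filter.Eventually.of_forall fun x h hh => by
      rw [norm_mul, RCLike.norm_conj, norm_character, mul_one, Complex.norm_real]
      exact hC h hh x)
    (integrable_const C)
    (Filter.Eventually.of_forall fun x h _ => (hd h x).ofReal_comp.mul_const _)
  simp only [fourierCoefficient_eq]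
  exact h1.2.const_mul _

theorem fourierCoefficient_translate {f : Torus L → ℝ} (z : Torus L) (k : Fin 2 → ℤ) :
    fourierCoefficient L (fun x => f (x + z)) k =
      character L k z * fourierCoefficient L f k := by
  have h0 : character L k z * conj (character L k z) = 1 := by
    rw [Complex.mul_conj, Complex.normSq_eq_norm_sq, norm_character]; simp
  rw [fourierCoefficient_eq, fourierCoefficient_eq,
    ← integral_add_right_eq_self (fun x => (f x : ℂ) * conj (character L k x)) z,
    mul_left_comm]
  congr 1
  rw [← integral_const_mul]
  refine integral_congr_ae (Filter.Eventually.of_forall fun x => ?_)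
  simp only [character_apply_add, map_mul]
  linear_combination (-(f (x + z) : ℂ) * conj (character L k x)) * h0

/-- Differentiation multiplies the Fourier coefficients by `i k̃ⱼ`. -/
theorem SmoothFamily.fourierCoefficient_pd {ψ : ℝ → Torus L → ℝ} (hψ : SmoothFamily L ψ)
    (j : Fin 2) (t : ℝ) (k : Fin 2 → ℤ) :
    fourierCoefficient L (pd L j (ψ t)) k =
      Complex.I * freq L j k * fourierCoefficient L (ψ t) k := by
  obtain ⟨C, -, hC⟩ := (hψ.pd_family j).exists_bound t t
  -- Both sides are the derivative at `h = 0` of the coefficient of the translate by `h`.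
  have h4 := hasDerivAt_fourierCoefficient_of_bound (t := 0) (s := univ)
    (χ := fun h x => ψ t (x + Pi.single j (h : AddCircle (L j))))
    (χ' := fun h x => pd L j (ψ t) (x + Pi.single j (h : AddCircle (L j)))) Filter.univ_mem
    (fun h => (hψ.continuous_apply t).comp (continuous_add_const _))
    (fun h => ((hψ.pd_family j).continuous_apply t).comp (continuous_add_const _))
    (fun h x => hψ.hasDerivAt_single t j x h) (fun h _ x => hC t ⟨le_rfl, le_rfl⟩ _) k
  have h3 : HasDerivAt (fun h : ℝ => Complex.exp (Complex.I * (freq L j k * h : ℝ)))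
      (Complex.I * freq L j k) 0 := by
    have h2 : HasDerivAt (fun h : ℝ => Complex.I * ((freq L j k * h : ℝ) : ℂ))
        (Complex.I * freq L j k) 0 := by
      have := ((hasDerivAt_id (0 : ℝ)).const_mul (freq L j k)).ofReal_comp.const_mul Complex.I
      simpa using this
    simpa using h2.cexp
  have h2 : ∀ h : ℝ, fourierCoefficient L
      (fun x => ψ t (x + Pi.single j (h : AddCircle (L j)))) k =
        Complex.exp (Complex.I * (freq L j k * h : ℝ)) * fourierCoefficient L (ψ t) k := fun h => by
    rw [fourierCoefficient_translate, character_single_coe]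
  simp only [h2] at h4
  have h5 := h4.unique (h3.mul_const _)
  simpa using h5

theorem SmoothFamily.fourierCoefficient_lap {ψ : ℝ → Torus L → ℝ} (hψ : SmoothFamily L ψ)
    (t : ℝ) (k : Fin 2 → ℤ) :
    fourierCoefficient L (lap L (ψ t)) k = -freqSq L k * fourierCoefficient L (ψ t) k := by
  have h : lap L (ψ t) = fun x => pd L 0 (pd L 0 (ψ t)) x + pd L 1 (pd L 1 (ψ t)) x := by
    ext x; simp [lap]
  have hint : ∀ j, Integrable (pd L j (pd L j (ψ t))) volume := fun j =>
    integrable_of_continuous (((hψ.pd_family j).pd_family j).continuous_apply t)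
  rw [h, fourierCoefficient_add (hint 0) (hint 1), (hψ.pd_family 0).fourierCoefficient_pd,
    (hψ.pd_family 1).fourierCoefficient_pd, hψ.fourierCoefficient_pd, hψ.fourierCoefficient_pd,
    freqSq_eq, Fin.sum_univ_two]
  push_cast
  linear_combination (freq L 0 k ^ 2 + freq L 1 k ^ 2 : ℂ) * fourierCoefficient L (ψ t) k *
    Complex.I_sq

theorem SmoothFamily.hasDerivAt_fourierCoefficient {ψ : ℝ → Torus L → ℝ} (hψ : SmoothFamily L ψ)
    (t : ℝ) (k : Fin 2 → ℤ) :
    HasDerivAt (fun t => fourierCoefficient L (ψ t) k)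
      (fourierCoefficient L (fun x => deriv (fun s => ψ s x) t) k) t := by
  obtain ⟨C, -, hC⟩ := hψ.timeDeriv_family.exists_bound (t - 1) (t + 1)
  exact hasDerivAt_fourierCoefficient_of_bound (Icc_mem_nhds (by linarith) (by linarith))
    hψ.continuous_apply hψ.timeDeriv_family.continuous_apply hψ.hasDerivAt_time hC k

theorem SmoothFamily.continuous_fourierCoefficient {ψ : ℝ → Torus L → ℝ}
    (hψ : SmoothFamily L ψ) (k : Fin 2 → ℤ) :
    Continuous (fun t => fourierCoefficient L (ψ t) k) :=
  continuous_iff_continuousAt.2 fun t => (hψ.hasDerivAt_fourierCoefficient t k).continuousAt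

/-! ### Weak derivatives and Fourier coefficients -/

theorem L2.memLp (f : L2 L) : MemLp f 2 volume := Lp.memLp f

theorem L2.integrable (f : L2 L) : Integrable f volume := (Lp.memLp f).integrable (by norm_num)

theorem integral_mul_trigPoly_singleton {g : Torus L → ℝ} (hg : Integrable g volume)
    (k : Fin 2 → ℤ) (a : (Fin 2 → ℤ) → ℂ) :
    ∫ x, g x * trigPoly L {-k} a x = (a (-k) * (area L * fourierCoefficient L g k)).re := by
  have hA0 : (area L : ℂ) ≠ 0 := by simpa using (area_pos L).ne'
  rw [fourierCoefficient_eq, mul_inv_cancel_left₀ hA0, ← integral_const_mul,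
    ← RCLike.re_eq_complex_re, ← integral_re
      ((integrable_mul_conj_character (integrable_complexOfReal hg) k).const_mul _)]
  refine integral_congr_ae (Filter.Eventually.of_forall fun x => ?_)
  simp [trigPoly, character_neg]
  ring

theorem eq_of_forall_re_mul_eq {z w : ℂ} (h : ∀ a : ℂ, (a * z).re = (a * w).re) : z = w := by
  have h1 := h 1
  have h2 := h Complex.I
  apply Complex.ext
  · simpa using h1
  · simpa using h2

theorem HasWeakGrad.fourierCoefficient {f : L2 L} {G : Torus L → Vec} (h : HasWeakGrad L f G)
    (j : Fin 2) (k : Fin 2 → ℤ) :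
    fourierCoefficient L (fun x => G x j) k =
      Complex.I * freq L j k * fourierCoefficient L f k := by
  have hA0 : (area L : ℂ) ≠ 0 := by simpa using (area_pos L).ne'
  have hGj : Integrable (fun x => G x j) volume :=
    (EuclideanSpace.proj (𝕜 := ℝ) j).integrable_comp h.1
  refine mul_left_cancel₀ hA0 (eq_of_forall_re_mul_eq fun a => ?_)
  have h1 := h.2 _ (smoothOnTorus_trigPoly {-k} (fun _ => a)) j
  rw [pd_trigPoly, integral_mul_trigPoly_singleton f.integrable,
    integral_mul_trigPoly_singleton hGj] at h1
  rw [eq_neg_iff_add_eq_zero, add_comm, ← eq_neg_iff_add_eq_zero] at h1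
  rw [h1, ← Complex.neg_re, freq_neg]
  congr 1
  push_cast
  ring

theorem HasWeakLap.fourierCoefficient {f : L2 L} {g : Torus L → ℝ} (h : HasWeakLap L f g)
    (k : Fin 2 → ℤ) :
    fourierCoefficient L g k = -freqSq L k * fourierCoefficient L f k := by
  have hA0 : (area L : ℂ) ≠ 0 := by simpa using (area_pos L).ne'
  refine mul_left_cancel₀ hA0 (eq_of_forall_re_mul_eq fun a => ?_)
  have h1 := h.2 _ (smoothOnTorus_trigPoly {-k} (fun _ => a))
  rw [lap_trigPoly, integral_mul_trigPoly_singleton f.integrable,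
    integral_mul_trigPoly_singleton h.1] at h1
  rw [← h1, freqSq_neg]
  congr 1
  ring

theorem hasWeakGrad_weakGrad {f : L2 L} (h : ∃ G, HasWeakGrad L f G) :
    HasWeakGrad L f (weakGrad L f) := by
  rw [weakGrad, dif_pos h]; exact h.choose_spec

theorem hasWeakLap_weakLap {f : L2 L} (h : ∃ g, HasWeakLap L f g) :
    HasWeakLap L f (weakLap L f) := by
  rw [weakLap, dif_pos h]; exact h.choose_spec

theorem hasWeakLap_of_fourierCoefficient {f g : L2 L}
    (h : ∀ k, fourierCoefficient L g k = -freqSq L k * fourierCoefficient L f k) :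
    HasWeakLap L f g := by
  refine ⟨g.integrable, fun ψ hψ => ?_⟩
  have hψ' := hψ.smoothFamily
  have h1 := hasSum_fourierCoefficient_mul_conj f.memLp
    (memLp_of_continuous (hψ'.lap_family.continuous_apply 0))
  have h2 := hasSum_fourierCoefficient_mul_conj g.memLp
    (memLp_of_continuous (hψ'.continuous_apply 0))
  have h3 := h1.unique (h2.congr_fun fun k => by
    rw [hψ'.fourierCoefficient_lap 0, h]
    simp
    ring)
  have h4 := mul_left_cancel₀ (inv_ne_zero (area_pos L).ne') (Complex.ofReal_injective h3)
  exact h4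

/-- If `∑ |k̃|⁴ |fₖ|²` converges, then the weak Laplacian is square integrable and has the Fourier
coefficients `-|k̃|² fₖ`. -/
theorem weakLap_spec {f : L2 L}
    (h : Summable fun k => freqSq L k ^ 2 * ‖fourierCoefficient L f k‖ ^ 2) :
    MemLp (weakLap L f) 2 volume ∧
      ∀ k, fourierCoefficient L (weakLap L f) k = -freqSq L k * fourierCoefficient L f k := by
  obtain ⟨g, hg⟩ := exists_fourierCoefficient_eq (L := L)
    (b := fun k => -freqSq L k * fourierCoefficient L f k)
    (h.congr fun k => by
      rw [norm_mul, mul_pow, norm_neg, Complex.norm_real, Real.norm_eq_abs, sq_abs])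
    (fun k => by simp [freqSq_neg, fourierCoefficient_neg])
  have h1 := hasWeakLap_weakLap ⟨_, hasWeakLap_of_fourierCoefficient hg⟩
  have h2 := h1.fourierCoefficient
  refine ⟨?_, h2⟩
  exact (memLp_congr_ae (ae_eq_of_fourierCoefficient_eq h1.1 g.integrable fun k => by
    rw [h2, hg])).2 g.memLp

end

/-! ### Products of primitives -/

theorem absolutelyContinuousOnInterval_primitive {f : ℝ → ℂ} {a b : ℝ}
    (hf : IntervalIntegrable f volume a b) (c : ℂ) :
    AbsolutelyContinuousOnInterval (fun t => c + ∫ s in a..t, f s) a b := by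
  have hconst : ∀ c : ℂ, AbsolutelyContinuousOnInterval (fun _ : ℝ => c) a b := fun c =>
    (LipschitzOnWith.of_dist_le_mul (K := 0) fun x _ y _ => by
      simp).absolutelyContinuousOnInterval
  have hre : IntervalIntegrable (fun s => (f s).re) volume a b := ⟨hf.1.re, hf.2.re⟩
  have him : IntervalIntegrable (fun s => (f s).im) volume a b := ⟨hf.1.im, hf.2.im⟩
  have h1 := (hconst c).fun_add
    (((hre.absolutelyContinuousOnInterval_intervalIntegral left_mem_uIcc).fun_smul
      (hconst 1)).fun_add
    ((him.absolutelyContinuousOnInterval_intervalIntegral left_mem_uIcc).fun_smul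
      (hconst Complex.I)))
  -- The two functions agree on the interval, which contains all end points that occur.
  unfold AbsolutelyContinuousOnInterval at h1 ⊢
  refine h1.congr' ?_
  rw [Filter.EventuallyEq, Filter.eventually_inf_principal]
  refine Filter.Eventually.of_forall fun ⟨n, I⟩ hI => ?_
  have key : ∀ t ∈ uIcc a b, c + ((∫ s in a..t, (f s).re) • (1 : ℂ) +
      (∫ s in a..t, (f s).im) • Complex.I) = c + ∫ s in a..t, f s := by
    intro t ht
    have hft : IntervalIntegrable f volume a t :=
      hf.mono_set (uIcc_subset_uIcc_left ht)
    congr 1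
    apply Complex.ext
    · have := Complex.reCLM.intervalIntegral_comp_comm hft
      simp only [Complex.reCLM_apply] at this
      simp [this]
    · have := Complex.imCLM.intervalIntegral_comp_comm hft
      simp only [Complex.imCLM_apply] at this
      simp [this]
  refine Finset.sum_congr rfl fun i hi => ?_
  have := hI.1 i hi
  beta_reduce
  rw [key _ this.1, key _ this.2]

/-- The product rule for two absolutely continuous functions, given as primitives of integrable
functions. -/
theorem mul_eq_integral_of_primitive {F G f g : ℝ → ℂ} {a b : ℝ} (hab : a ≤ b)
    (hf : IntervalIntegrable f volume a b) (hg : IntervalIntegrable g volume a b)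
    (hF : ∀ t ∈ Icc a b, F t = F a + ∫ s in a..t, f s)
    (hG : ∀ t ∈ Icc a b, G t = G a + ∫ s in a..t, g s) :
    IntervalIntegrable (fun s => f s * G s + F s * g s) volume a b ∧
      ∀ t ∈ Icc a b, F t * G t = F a * G a + ∫ s in a..t, (f s * G s + F s * g s) := by
  have hF1 := absolutelyContinuousOnInterval_primitive hf (F a)
  have hG1 := absolutelyContinuousOnInterval_primitive hg (G a)
  have hFc : ContinuousOn F (uIcc a b) := hF1.continuousOn.congr (by rwa [uIcc_of_le hab])
  have hGc : ContinuousOn G (uIcc a b) := hG1.continuousOn.congr (by rwa [uIcc_of_le hab])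
  have hint : IntervalIntegrable (fun s => f s * G s + F s * g s) volume a b :=
    (hf.mul_continuousOn hGc).add (hg.continuousOn_mul hFc)
  refine ⟨hint, ?_⟩
  have hI := absolutelyContinuousOnInterval_primitive hint 0
  have hH := (hF1.fun_smul hG1).fun_sub hI
  have hd : ∀ᵐ x, x ∈ uIcc a b → HasDerivAt (fun t => (F a + ∫ s in a..t, f s) •
      (G a + ∫ s in a..t, g s) - (0 + ∫ s in a..t, (f s * G s + F s * g s))) 0 x := by
    filter_upwards [hf.ae_hasDerivAt_integral, hg.ae_hasDerivAt_integral,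
      hint.ae_hasDerivAt_integral] with x h1 h2 h3 hx
    have h4 := (((h1 hx a left_mem_uIcc).const_add (F a)).mul
      ((h2 hx a left_mem_uIcc).const_add (G a))).sub ((h3 hx a left_mem_uIcc).const_add 0)
    rw [uIcc_of_le hab] at hx
    rw [← hF x hx, ← hG x hx, sub_self] at h4
    exact h4
  obtain ⟨C, hC⟩ := hH.const_of_ae_hasDerivAt_zero hd
  intro t ht
  have e1 := hC a left_mem_uIcc
  have e2 := hC t (by rwa [uIcc_of_le hab])
  simp only [intervalIntegral.integral_same, add_zero, sub_zero, smul_eq_mul] at e1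
  rw [← hF t ht, ← hG t ht, ← e1, smul_eq_mul] at e2
  linear_combination e2

/-! ### Exchanging sums and integrals -/

/-- Term by term integration of a series whose absolute partial sums have an integrable bound. -/
theorem hasSum_integral_of_sum_norm_le {ι α E : Type*} [Countable ι] [MeasurableSpace α]
    [NormedAddCommGroup E] [NormedSpace ℝ E]
    {μ : Measure α} {a : ι → α → E} {A : α → E} {B : α → ℝ}
    (ha : ∀ i, AEStronglyMeasurable (a i) μ) (hA : ∀ᵐ t ∂μ, HasSum (fun i => a i t) (A t))
    (hB : Integrable B μ) (hle : ∀ᵐ t ∂μ, ∀ F : Finset ι, ∑ i ∈ F, ‖a i t‖ ≤ B t) :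
    Integrable A μ ∧ (∀ i, Integrable (a i) μ) ∧
      HasSum (fun i => ∫ t, a i t ∂μ) (∫ t, A t ∂μ) := by
  have hi : ∀ i, Integrable (a i) μ := fun i => hB.mono' (ha i) (by
    filter_upwards [hle] with t ht
    simpa using ht {i})
  have hm : ∀ F : Finset ι, AEStronglyMeasurable (fun t => ∑ i ∈ F, a i t) μ := fun F =>
    Finset.aestronglyMeasurable_fun_sum F fun i _ => ha i
  have hlim : ∀ᵐ t ∂μ, Filter.Tendsto (fun F : Finset ι => ∑ i ∈ F, a i t) Filter.atTop
      (nhds (A t)) := hA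
  have hb : ∀ F : Finset ι, ∀ᵐ t ∂μ, ‖∑ i ∈ F, a i t‖ ≤ B t := fun F => by
    filter_upwards [hle] with t ht
    exact (norm_sum_le _ _).trans (ht F)
  refine ⟨?_, hi, ?_⟩
  · refine hB.mono' (aestronglyMeasurable_of_tendsto_ae Filter.atTop hm hlim) ?_
    filter_upwards [hlim, hle] with t h1 h2
    exact le_of_tendsto h1.norm (Filter.Eventually.of_forall fun F =>
      (norm_sum_le _ _).trans (h2 F))
  · have := tendsto_integral_filter_of_dominated_convergence (μ := μ) (l := Filter.atTop) B
      (Filter.Eventually.of_forall hm) (Filter.Eventually.of_forall hb) hB hlim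
    refine this.congr fun F => ?_
    exact integral_finsetSum F fun i _ => hi i

section
variable {L : Fin 2 → ℝ}

/-! ### Lattice sums and the semigroup -/

/-- The weight `1 + |k̃|⁴`, which is equivalent to the weight `(1 + |k̃|²)²` of `H²`. -/
noncomputable def weight (L : Fin 2 → ℝ) (k : Fin 2 → ℤ) : ℝ := 1 + freqSq L k ^ 2

theorem one_le_weight (k : Fin 2 → ℤ) : 1 ≤ weight L k := by
  unfold weight; nlinarith [sq_nonneg (freqSq L k)]

theorem weight_pos (k : Fin 2 → ℤ) : 0 < weight L k := one_pos.trans_le (one_le_weight k)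

theorem summable_inv_one_add_mul_sq {c : ℝ} (hc : 0 < c) :
    Summable fun n : ℤ => (1 + c * (n : ℝ) ^ 2)⁻¹ := by
  have h1 : Summable fun n : ℤ => c⁻¹ * (1 / (n : ℝ) ^ 2) :=
    (Real.summable_one_div_int_pow.2 (by norm_num)).mul_left _
  have h2 : Summable fun n : ℤ => if n = 0 then (1 : ℝ) else 0 :=
    (hasSum_ite_eq (0 : ℤ) (1 : ℝ)).summable
  refine Summable.of_nonneg_of_le (fun n => by positivity) (fun n => ?_) (h1.add h2)
  by_cases hn : n = 0
  · simp [hn]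
  · have : (0 : ℝ) < (n : ℝ) ^ 2 := by positivity
    rw [if_neg hn, add_zero, one_div, ← mul_inv]
    exact inv_anti₀ (by positivity) (by linarith)

variable [∀ j, Fact (0 < L j)]

theorem summable_inv_weight : Summable fun k => (weight L k)⁻¹ := by
  have hc : ∀ j, 0 < (2 * Real.pi / L j) ^ 2 := fun j => by
    have := Fact.out (p := 0 < L j)
    positivity
  have h1 := (summable_inv_one_add_mul_sq (hc 0)).mul_of_nonneg
    (summable_inv_one_add_mul_sq (hc 1)) (fun n => by positivity) (fun n => by positivity)
  have h2 := (finTwoArrowEquiv ℤ).summable_iff.2 (h1.mul_left 2)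
  refine Summable.of_nonneg_of_le (fun k => (inv_pos.2 (weight_pos k)).le) (fun k => ?_) h2
  change (weight L k)⁻¹ ≤ 2 * ((1 + (2 * Real.pi / L 0) ^ 2 * (k 0 : ℝ) ^ 2)⁻¹ *
    (1 + (2 * Real.pi / L 1) ^ 2 * (k 1 : ℝ) ^ 2)⁻¹)
  have e : freqSq L k = (2 * Real.pi / L 0) ^ 2 * (k 0 : ℝ) ^ 2 +
      (2 * Real.pi / L 1) ^ 2 * (k 1 : ℝ) ^ 2 := by
    simp [freqSq]; ring
  set x := (2 * Real.pi / L 0) ^ 2 * (k 0 : ℝ) ^ 2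
  set y := (2 * Real.pi / L 1) ^ 2 * (k 1 : ℝ) ^ 2
  have hx : 0 ≤ x := by positivity
  have hy : 0 ≤ y := by positivity
  rw [← mul_inv, ← div_eq_mul_inv, le_div_iff₀ (by positivity), weight, e,
    inv_mul_le_iff₀ (by positivity)]
  nlinarith [mul_nonneg hx hy, sq_nonneg (x + y - 1), sq_nonneg (x - y)]

/-- At positive times the semigroup is defined on all integrable functions: their Fourier
coefficients are bounded, and `exp (-t (|k̃|⁴ - |k̃|²))²` is at most a constant times the summable
`1 / (1 + |k̃|⁴)`. -/
theorem semigroup_spec_of_pos {t : ℝ} (ht : 0 < t) (f : Torus L → ℝ) (k : Fin 2 → ℤ) :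
    fourierCoefficient L (semigroup L t f) k =
      (Real.exp (-t * symbol L k) : ℂ) * fourierCoefficient L f k := by
  have hex : ∃ g : L2 L, ∀ k, fourierCoefficient L g k =
      (Real.exp (-t * symbol L k) : ℂ) * fourierCoefficient L f k := by
    refine exists_fourierCoefficient_eq ?_ fun k => ?_
    · set B := (area L)⁻¹ * ∫ x, |f x|
      refine Summable.of_nonneg_of_le (fun k => by positivity) (fun k => ?_)
        ((summable_inv_weight (L := L)).mul_left (Real.exp t * (1 + t⁻¹) * B ^ 2))
      have h1 : ‖fourierCoefficient L f k‖ ^ 2 ≤ B ^ 2 :=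
        pow_le_pow_left₀ (norm_nonneg _) (norm_fourierCoefficient_le f k) 2
      have h2 : Real.exp (-t * symbol L k) ^ 2 ≤ Real.exp t * (1 + t⁻¹) * (weight L k)⁻¹ := by
        set x := freqSq L k
        have h3 : Real.exp (-t * symbol L k) ^ 2 ≤ Real.exp t * Real.exp (-(t * x ^ 2)) := by
          rw [← Real.exp_nat_mul, ← Real.exp_add, Real.exp_le_exp, symbol]
          push_cast
          nlinarith [mul_nonneg ht.le (sq_nonneg (x - 1))]
        refine h3.trans ?_
        rw [mul_assoc]
        refine mul_le_mul_of_nonneg_left ?_ (Real.exp_pos _).le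
        rw [Real.exp_neg, ← div_eq_mul_inv, le_div_iff₀ (weight_pos k),
          inv_mul_le_iff₀ (Real.exp_pos _), weight]
        have h4 := Real.add_one_le_exp (t * x ^ 2)
        have h5 : (0 : ℝ) < 1 + t⁻¹ := by positivity
        refine le_trans ?_ (mul_le_mul_of_nonneg_right h4 h5.le)
        have h6 : (t * x ^ 2 + 1) * (1 + t⁻¹) = t * x ^ 2 + x ^ 2 * (t * t⁻¹) + 1 + t⁻¹ := by ring
        rw [h6, mul_inv_cancel₀ ht.ne']
        have : 0 ≤ t * x ^ 2 := by positivity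
        have : 0 < t⁻¹ := by positivity
        linarith
      rw [norm_mul, mul_pow, Complex.norm_real, Real.norm_eq_abs, sq_abs]
      calc _ ≤ Real.exp t * (1 + t⁻¹) * (weight L k)⁻¹ * B ^ 2 :=
            mul_le_mul h2 h1 (by positivity) (le_trans (by positivity) h2)
        _ = _ := by ring
    · rw [map_mul, Complex.conj_ofReal, fourierCoefficient_neg, symbol, symbol, freqSq_neg]
  rw [semigroup, dif_pos hex]
  exact hex.choose_spec k

theorem semigroup_spec_zero (f : L2 L) (k : Fin 2 → ℤ) :
    fourierCoefficient L (semigroup L 0 f) k = fourierCoefficient L f k := by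
  have hex : ∃ g : L2 L, ∀ k, fourierCoefficient L g k =
      (Real.exp (-0 * symbol L k) : ℂ) * fourierCoefficient L f k := ⟨f, fun k => by simp⟩
  rw [semigroup, dif_pos hex]
  simpa using hex.choose_spec k

theorem semigroup_spec {t : ℝ} (ht : 0 ≤ t) (f : L2 L) (k : Fin 2 → ℤ) :
    fourierCoefficient L (semigroup L t f) k =
      (Real.exp (-t * symbol L k) : ℂ) * fourierCoefficient L f k := by
  rcases ht.eq_or_lt with rfl | ht
  · simpa using semigroup_spec_zero f k
  · exact semigroup_spec_of_pos ht f k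

theorem integral_sq_eq_norm_sq (f : L2 L) : ∫ x, f x ^ 2 = ‖f‖ ^ 2 := by
  rw [← real_inner_self_eq_norm_sq, L2.inner_def]
  simp [pow_two]

/-- The `k`-th Fourier coefficient as a continuous real-linear functional on `L²`. -/
noncomputable def coeffCLM (L : Fin 2 → ℝ) [∀ j, Fact (0 < L j)] (k : Fin 2 → ℤ) :
    L2 L →L[ℝ] ℂ :=
  LinearMap.mkContinuous
    { toFun := fun f => fourierCoefficient L f k
      map_add' := fun f g => by
        rw [fourierCoefficient_congr (Lp.coeFn_add f g), ← fourierCoefficient_add f.integrable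
          g.integrable]
        rfl
      map_smul' := fun c f => by
        rw [fourierCoefficient_congr (Lp.coeFn_smul c f), RingHom.id_apply, Complex.real_smul,
          ← fourierCoefficient_const_mul]
        rfl }
    (Real.sqrt (area L)⁻¹) fun f => by
      have h1 := hasSum_norm_fourierCoefficient_sq f.memLp
      rw [integral_sq_eq_norm_sq] at h1
      have h3 := le_hasSum h1 k fun _ _ => by positivity
      refine abs_le_of_sq_le_sq' ?_ (by positivity) |>.2
      rw [mul_pow, Real.sq_sqrt (inv_nonneg.2 (area_pos L).le)]
      exact h3

@[simp]
theorem coeffCLM_apply (k : Fin 2 → ℤ) (f : L2 L) :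
    coeffCLM L k f = fourierCoefficient L f k := rfl

end

section
variable {L : Fin 2 → ℝ} [∀ j, Fact (0 < L j)]

/-! ### The gradient and the nonlinearity of a mild solution -/

theorem integral_norm_sq_eq {E : Type*} [NormedAddCommGroup E] [InnerProductSpace ℝ E]
    (f : Lp E 2 (volume : Measure (Torus L))) : ∫ x, ‖f x‖ ^ 2 = ‖f‖ ^ 2 := by
  rw [← real_inner_self_eq_norm_sq, L2.inner_def]
  simp only [real_inner_self_eq_norm_sq]

theorem integral_norm_sq_eq_of_memLp {E : Type*} [NormedAddCommGroup E] [InnerProductSpace ℝ E]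
    {f : Torus L → E} (hf : MemLp f 2 volume) :
    ∫ x, ‖f x‖ ^ 2 = (eLpNorm f 2 volume).toReal ^ 2 := by
  rw [← Lp.norm_toLp f hf, ← integral_norm_sq_eq]
  refine integral_congr_ae ?_
  filter_upwards [hf.coeFn_toLp] with x hx
  rw [hx]

theorem memLp_component {G : Torus L → Vec} (hG : MemLp G 2 volume) (j : Fin 2) :
    MemLp (fun x => G x j) 2 volume :=
  (EuclideanSpace.proj (𝕜 := ℝ) j).comp_memLp' hG

theorem vec_norm_sq (w : Vec) : ‖w‖ ^ 2 = w 0 ^ 2 + w 1 ^ 2 := by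
  rw [EuclideanSpace.norm_sq_eq]; simp

theorem vec_inner (w z : Vec) : inner ℝ w z = w 0 * z 0 + w 1 * z 1 := by
  simp [PiLp.inner_apply]; ring

theorem hasSum_freqSq_mul_of_hasWeakGrad {f : L2 L} {G : Torus L → Vec} (h : HasWeakGrad L f G)
    (hG : MemLp G 2 volume) :
    HasSum (fun k => freqSq L k * ‖fourierCoefficient L f k‖ ^ 2)
      ((area L)⁻¹ * ∫ x, ‖G x‖ ^ 2) := by
  have h0 := hasSum_norm_fourierCoefficient_sq (memLp_component hG 0)
  have h1 := hasSum_norm_fourierCoefficient_sq (memLp_component hG 1)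
  have h2 := h0.add h1
  rw [← mul_add, ← integral_add (memLp_component hG 0).integrable_sq
    (memLp_component hG 1).integrable_sq] at h2
  simp only [← vec_norm_sq] at h2
  refine h2.congr_fun fun k => ?_
  rw [h.fourierCoefficient, h.fourierCoefficient, freqSq_eq, Fin.sum_univ_two]
  simp only [norm_mul, Complex.norm_I, Complex.norm_real, Real.norm_eq_abs, one_mul, mul_pow,
    sq_abs]
  ring

/-- The nonlinearity `|∇φ|² / 2 + v ⋅ ∇φ`. -/
noncomputable def nonlinearity (L : Fin 2 → ℝ) [∀ j, Fact (0 < L j)] (w : L2Vec L) (f : L2 L)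
    (x : Torus L) : ℝ := (1 / 2) * ‖weakGrad L f x‖ ^ 2 + inner ℝ (w x) (weakGrad L f x)

theorem integrable_inner_weakGrad (w : L2Vec L) {f : L2 L} (hG : MemLp (weakGrad L f) 2 volume) :
    Integrable (fun x => inner ℝ (w x) (weakGrad L f x)) volume := by
  have h := L2.integrable_inner (𝕜 := ℝ) w hG.toLp
  refine h.congr ?_
  filter_upwards [hG.coeFn_toLp] with x hx
  rw [hx]

theorem integrable_nonlinearity (w : L2Vec L) {f : L2 L} (hG : MemLp (weakGrad L f) 2 volume) :
    Integrable (nonlinearity L w f) volume :=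
  (hG.norm.integrable_sq.const_mul _).add (integrable_inner_weakGrad w hG)

theorem fourierCoefficient_nonlinearity (w : L2Vec L) {f : L2 L}
    (hG : MemLp (weakGrad L f) 2 volume) (k : Fin 2 → ℤ) :
    fourierCoefficient L (nonlinearity L w f) k =
      (1 / 2 : ℝ) * fourierCoefficient L (fun x => ‖weakGrad L f x‖ ^ 2) k +
        fourierCoefficient L (fun x => inner ℝ (w x) (weakGrad L f x)) k := by
  rw [← fourierCoefficient_const_mul, ← fourierCoefficient_add
    (hG.norm.integrable_sq.const_mul _) (integrable_inner_weakGrad w hG)]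
  rfl

/-- The nonlinearity is bounded in `L¹` by Young's inequality `|v ⋅ ∇φ| ≤ (|v|² + |∇φ|²) / 2`, and
this bounds all its Fourier coefficients at once. -/
theorem norm_fourierCoefficient_nonlinearity_le (w : L2Vec L) {f : L2 L}
    (hG : MemLp (weakGrad L f) 2 volume) (k : Fin 2 → ℤ) :
    ‖fourierCoefficient L (nonlinearity L w f) k‖ ≤
      (area L)⁻¹ * (∫ x, ‖weakGrad L f x‖ ^ 2) + (area L)⁻¹ * (‖w‖ ^ 2 / 2) := by
  have hA := inv_pos.2 (area_pos L)
  have hw : Integrable (fun x => ‖w x‖ ^ 2) volume := (Lp.memLp w).norm.integrable_sq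
  refine (norm_fourierCoefficient_le _ k).trans ?_
  rw [← mul_add]
  refine mul_le_mul_of_nonneg_left ?_ hA.le
  rw [← integral_norm_sq_eq, ← integral_div, ← integral_add hG.norm.integrable_sq
    (hw.div_const 2)]
  refine integral_mono (integrable_nonlinearity w hG).abs
    (hG.norm.integrable_sq.add (hw.div_const 2)) fun x => ?_
  have h1 := abs_real_inner_le_norm (w x) (weakGrad L f x)
  have h2 := abs_add_le ((1 / 2) * ‖weakGrad L f x‖ ^ 2) (inner ℝ (w x) (weakGrad L f x))
  have h3 : |(1 / 2) * ‖weakGrad L f x‖ ^ 2| = (1 / 2) * ‖weakGrad L f x‖ ^ 2 :=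
    abs_of_nonneg (by positivity)
  simp only [nonlinearity]
  nlinarith [sq_nonneg (‖w x‖ - ‖weakGrad L f x‖)]

/-- The bound `‖∇φ(t)‖² ≤ C t^{-1/2}` in terms of Bochner integrals. -/
theorem HasGradBound.spec {T : ℝ} {φ : ℝ → L2 L} (hX : HasGradBound L T φ) :
    ∃ C : ℝ, 0 ≤ C ∧ ∀ t ∈ Ioc 0 T, HasWeakGrad L (φ t) (weakGrad L (φ t)) ∧
      MemLp (weakGrad L (φ t)) 2 volume ∧
      (area L)⁻¹ * ∫ x, ‖weakGrad L (φ t) x‖ ^ 2 ≤ C * t ^ (-(1 / 2) : ℝ) := by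
  obtain ⟨C, hC⟩ := hX
  have hA := inv_pos.2 (area_pos L)
  refine ⟨(area L)⁻¹ * (C : ℝ) ^ 2, by positivity, fun t ht => ?_⟩
  obtain ⟨h1, h2⟩ := hC t ht
  have hg := hasWeakGrad_weakGrad h1
  have hpos : 0 < t ^ (1 / 4 : ℝ) := Real.rpow_pos_of_pos ht.1 _
  have hfin : eLpNorm (weakGrad L (φ t)) 2 volume < ⊤ := by
    refine lt_top_iff_ne_top.2 fun htop => ?_
    rw [htop, ENNReal.mul_top (by simpa using hpos)] at h2
    simp at h2
  have hmem : MemLp (weakGrad L (φ t)) 2 volume := ⟨hg.1.aestronglyMeasurable, hfin⟩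
  refine ⟨hg, hmem, ?_⟩
  rw [integral_norm_sq_eq_of_memLp hmem, mul_assoc]
  refine mul_le_mul_of_nonneg_left ?_ hA.le
  have h3 := ENNReal.toReal_mono ENNReal.coe_ne_top h2
  rw [ENNReal.toReal_mul, ENNReal.toReal_ofReal hpos.le, ENNReal.coe_toReal] at h3
  have h4 := pow_le_pow_left₀ (by positivity) h3 2
  have h5 : t ^ (-(1 / 2) : ℝ) = ((t ^ (1 / 4 : ℝ)) ^ 2)⁻¹ := by
    rw [← Real.rpow_natCast, ← Real.rpow_mul ht.1.le, ← Real.rpow_neg ht.1.le]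
    norm_num
  rw [h5, ← div_eq_mul_inv, le_div_iff₀ (by positivity)]
  linarith [mul_pow (t ^ (1 / 4 : ℝ)) (eLpNorm (weakGrad L (φ t)) 2 volume).toReal 2]

theorem exists_norm_le_of_memLp_top {v : ℝ → L2Vec L}
    (hv : MemLp v ⊤ (volume.restrict (Ioi (0 : ℝ)))) (T : ℝ) :
    ∃ V : ℝ, ∀ᵐ t ∂(volume.restrict (Ioc 0 T)), ‖v t‖ ≤ V := by
  refine ⟨(eLpNorm v ⊤ (volume.restrict (Ioi (0 : ℝ)))).toReal, ?_⟩
  have h := ae_le_eLpNormEssSup (f := v) (μ := volume.restrict (Ioi (0 : ℝ)))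
  filter_upwards [ae_restrict_of_ae_restrict_of_subset Ioc_subset_Ioi_self h] with t ht
  rw [← eLpNorm_exponent_top] at ht
  simpa using ENNReal.toReal_mono hv.eLpNorm_ne_top ht

/-! ### The equation for the Fourier coefficients -/

namespace IsMildSolution

variable {v : ℝ → L2Vec L} {T : ℝ} {φ₀ : L2 L} {φ : ℝ → L2 L}

theorem continuousOn_fourierCoefficient (hφ : IsMildSolution L v T φ₀ φ) (k : Fin 2 → ℤ) :
    ContinuousOn (fun t => fourierCoefficient L (φ t) k) (Icc 0 T) :=
  (coeffCLM L k).continuous.comp_continuousOn hφ.continuousOn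

theorem exists_sum_le (hφ : IsMildSolution L v T φ₀ φ) :
    ∃ m : ℝ, 0 ≤ m ∧ ∀ t ∈ Icc 0 T, ‖φ t‖ ^ 2 ≤ area L * m ∧
      ∀ F : Finset (Fin 2 → ℤ), ∑ k ∈ F, ‖fourierCoefficient L (φ t) k‖ ^ 2 ≤ m := by
  obtain ⟨M, hM⟩ := isCompact_Icc.exists_bound_of_continuousOn hφ.continuousOn
  have hA := inv_pos.2 (area_pos L)
  refine ⟨(area L)⁻¹ * M ^ 2, by positivity, fun t ht => ?_⟩
  have h2 : ‖φ t‖ ^ 2 ≤ M ^ 2 := pow_le_pow_left₀ (norm_nonneg _) (hM t ht) 2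
  refine ⟨by rwa [mul_inv_cancel_left₀ (area_pos L).ne'], fun F => ?_⟩
  have h1 := hasSum_norm_fourierCoefficient_sq (φ t).memLp
  rw [integral_sq_eq_norm_sq] at h1
  refine (sum_le_hasSum F (fun _ _ => by positivity) h1).trans ?_
  exact mul_le_mul_of_nonneg_left h2 hA.le

theorem fourierCoefficient_duhamel (hφ : IsMildSolution L v T φ₀ φ) (hX : HasGradBound L T φ)
    (k : Fin 2 → ℤ) {t : ℝ} (ht : t ∈ Icc 0 T) :
    IntervalIntegrable (fun τ => (Real.exp (-(t - τ) * symbol L k) : ℂ) *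
        fourierCoefficient L (nonlinearity L (v τ) (φ τ)) k) volume 0 t ∧
      fourierCoefficient L (φ t) k = (Real.exp (-t * symbol L k) : ℂ) * fourierCoefficient L φ₀ k -
        ∫ τ in (0 : ℝ)..t, (Real.exp (-(t - τ) * symbol L k) : ℂ) *
          fourierCoefficient L (nonlinearity L (v τ) (φ τ)) k := by
  obtain ⟨C, -, hC⟩ := hX.spec
  have h1 := hφ.integrable_nonlinear t ht
  have h2 := hφ.integrable_advection t ht
  have i1 : IntervalIntegrable (fun τ => coeffCLM L k
      (semigroup L (t - τ) (fun x => ‖weakGrad L (φ τ) x‖ ^ 2))) volume 0 t :=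
    ⟨(coeffCLM L k).integrable_comp h1.1, (coeffCLM L k).integrable_comp h1.2⟩
  have i2 : IntervalIntegrable (fun τ => coeffCLM L k
      (semigroup L (t - τ) (fun x => inner ℝ (v τ x) (weakGrad L (φ τ) x)))) volume 0 t :=
    ⟨(coeffCLM L k).integrable_comp h2.1, (coeffCLM L k).integrable_comp h2.2⟩
  have i3 := (i1.const_mul ((1 / 2 : ℝ) : ℂ)).add i2
  have hae : ∀ᵐ τ ∂(volume.restrict (uIoc 0 t)),
      ((1 / 2 : ℝ) : ℂ) * coeffCLM L k (semigroup L (t - τ) (fun x => ‖weakGrad L (φ τ) x‖ ^ 2)) +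
        coeffCLM L k (semigroup L (t - τ) (fun x => inner ℝ (v τ x) (weakGrad L (φ τ) x))) =
      (Real.exp (-(t - τ) * symbol L k) : ℂ) *
        fourierCoefficient L (nonlinearity L (v τ) (φ τ)) k := by
    rw [ae_restrict_iff' measurableSet_uIoc]
    have hne : ∀ᵐ τ : ℝ, τ ≠ t := by simp [ae_iff, measure_singleton]
    filter_upwards [hne] with τ hτ hmem
    rw [uIoc_of_le ht.1] at hmem
    have hlt : 0 < t - τ := sub_pos.2 (lt_of_le_of_ne hmem.2 hτ)
    rw [coeffCLM_apply, coeffCLM_apply, semigroup_spec_of_pos hlt, semigroup_spec_of_pos hlt,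
      fourierCoefficient_nonlinearity _ (hC τ ⟨hmem.1, hmem.2.trans ht.2⟩).2.1]
    ring
  refine ⟨i3.congr_ae hae, ?_⟩
  have h3 := congrArg (coeffCLM L k) (hφ.duhamel t ht)
  rw [map_sub, map_sub, map_smul, ← (coeffCLM L k).intervalIntegral_comp_comm h1,
    ← (coeffCLM L k).intervalIntegral_comp_comm h2, coeffCLM_apply, coeffCLM_apply,
    semigroup_spec ht.1, Complex.real_smul, sub_sub, ← intervalIntegral.integral_const_mul,
    ← intervalIntegral.integral_add (i1.const_mul _) i2] at h3
  rw [h3]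
  congr 1
  exact intervalIntegral.integral_congr_ae ((ae_restrict_iff' measurableSet_uIoc).1 hae)

theorem intervalIntegrable_fourierCoefficient_nonlinearity (hφ : IsMildSolution L v T φ₀ φ)
    (hX : HasGradBound L T φ) (hT : 0 ≤ T) (k : Fin 2 → ℤ) :
    IntervalIntegrable (fun τ => fourierCoefficient L (nonlinearity L (v τ) (φ τ)) k)
      volume 0 T := by
  have h := (hφ.fourierCoefficient_duhamel hX k ⟨hT, le_rfl⟩).1
  have h2 := h.continuousOn_mul (g := fun τ => (Real.exp ((T - τ) * symbol L k) : ℂ))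
    (Continuous.continuousOn (by fun_prop))
  refine h2.congr fun τ _ => ?_
  rw [← mul_assoc, ← Complex.ofReal_mul, ← Real.exp_add, neg_mul, add_neg_cancel]
  simp

/-- The Fourier coefficients of a mild solution are absolutely continuous, with
`φₖ' = -(|k̃|⁴ - |k̃|²) φₖ - Nₖ` for the nonlinearity `N`. -/
theorem fourierCoefficient_eq_integral (hφ : IsMildSolution L v T φ₀ φ) (hX : HasGradBound L T φ)
    (hT : 0 ≤ T) (k : Fin 2 → ℤ) :
    fourierCoefficient L (φ 0) k = fourierCoefficient L φ₀ k ∧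
    ∀ t ∈ Icc 0 T, fourierCoefficient L (φ t) k = fourierCoefficient L (φ 0) k +
      ∫ s in (0 : ℝ)..t, (-(symbol L k : ℂ) * fourierCoefficient L (φ s) k -
        fourierCoefficient L (nonlinearity L (v s) (φ s)) k) := by
  -- By Duhamel's formula, `φₖ = E P` for the exponential `E` and an absolutely continuous `P`.
  set N : ℝ → ℂ := fun s => fourierCoefficient L (nonlinearity L (v s) (φ s)) k with hN
  have hNi : IntervalIntegrable N volume 0 T :=
    hφ.intervalIntegrable_fourierCoefficient_nonlinearity hX hT k
  have h0 : fourierCoefficient L (φ 0) k = fourierCoefficient L φ₀ k := by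
    rw [(hφ.fourierCoefficient_duhamel hX k ⟨le_rfl, hT⟩).2]
    simp
  refine ⟨h0, ?_⟩
  set lam : ℝ := symbol L k with hlam
  let E : ℝ → ℂ := fun t => Complex.exp (-(t * lam))
  let P : ℝ → ℂ := fun t =>
    fourierCoefficient L φ₀ k + ∫ s in (0 : ℝ)..t, -(Complex.exp (s * lam) * N s)
  have hu : ∀ t ∈ Icc 0 T, fourierCoefficient L (φ t) k = E t * P t := by
    intro t ht
    rw [(hφ.fourierCoefficient_duhamel hX k ht).2]
    simp only [P, E, intervalIntegral.integral_neg]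
    rw [mul_add, mul_neg, ← sub_eq_add_neg, ← intervalIntegral.integral_const_mul]
    congr 1
    · rw [← hlam]; push_cast; rw [neg_mul]
    · refine intervalIntegral.integral_congr fun s _ => ?_
      rw [← mul_assoc, ← Complex.exp_add]
      rw [← hlam]
      push_cast
      ring_nf
      rfl
  have hEd : ∀ t : ℝ, HasDerivAt E (-lam * E t) t := by
    intro t
    have h1 : HasDerivAt (fun t : ℝ => -((t : ℂ) * lam)) (-lam : ℂ) t := by
      simpa using ((hasDerivAt_id t).ofReal_comp.mul_const (lam : ℂ)).fun_neg
    have := h1.cexp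
    rwa [mul_comm] at this
  have hEc : Continuous E := continuous_iff_continuousAt.2 fun t => (hEd t).continuousAt
  have hEi : ∀ a b, IntervalIntegrable (fun t => -lam * E t) volume a b := fun a b =>
    (continuous_const.mul hEc).intervalIntegrable a b
  have hg : IntervalIntegrable (fun s => -(Complex.exp (s * lam) * N s)) volume 0 T :=
    (hNi.continuousOn_mul (Continuous.continuousOn (by fun_prop))).neg
  have key := (mul_eq_integral_of_primitive (F := E) (G := P) hT (hEi 0 T) hg
    (fun t _ => by
      rw [intervalIntegral.integral_eq_sub_of_hasDerivAt (fun x _ => hEd x) (hEi 0 t)]; ring)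
    (fun t _ => by simp [P])).2
  intro t ht
  rw [hu t ht, key t ht, hu 0 ⟨le_rfl, hT⟩]
  congr 1
  refine intervalIntegral.integral_congr fun s hs => ?_
  rw [uIcc_of_le ht.1] at hs
  rw [hu s ⟨hs.1, hs.2.trans ht.2⟩]
  have hE1 : E s * Complex.exp (s * lam) = 1 := by
    simp only [E]
    rw [← Complex.exp_add]
    simp
  linear_combination (-N s) * hE1

end IsMildSolution

end

/-! ### Regularity of the solutions of the mode equations -/

/-- A series of nonnegative functions whose partial sums have bounded integrals converges almost
everywhere, to an integrable function. -/
theorem ae_summable_of_sum_integral_le {ι α : Type*} [Countable ι] [MeasurableSpace α]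
    {μ : Measure α} {a : ι → α → ℝ} {B : ℝ} (ha : ∀ i, Integrable (a i) μ)
    (h0 : ∀ i t, 0 ≤ a i t) (hB : ∀ F : Finset ι, ∑ i ∈ F, ∫ t, a i t ∂μ ≤ B) :
    (∀ᵐ t ∂μ, Summable fun i => a i t) ∧ Integrable (fun t => ∑' i, a i t) μ ∧
      ∫ t, ∑' i, a i t ∂μ ≤ B := by
  have h1 : ∫⁻ t, ∑' i, ENNReal.ofReal (a i t) ∂μ ≠ ⊤ := by
    rw [lintegral_tsum fun i => (ha i).aemeasurable.ennreal_ofReal]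
    refine ne_top_of_le_ne_top (ENNReal.ofReal_ne_top (r := B)) ?_
    rw [ENNReal.tsum_eq_iSup_sum]
    refine iSup_le fun F => ?_
    rw [Finset.sum_congr rfl fun i _ => (ofReal_integral_eq_lintegral_ofReal (ha i)
      (Filter.Eventually.of_forall (h0 i))).symm,
      ← ENNReal.ofReal_sum_of_nonneg fun i _ => integral_nonneg (h0 i)]
    exact ENNReal.ofReal_le_ofReal (hB F)
  have hm : AEMeasurable (fun t => ∑' i, ENNReal.ofReal (a i t)) μ :=
    AEMeasurable.tsum fun i => (ha i).aemeasurable.ennreal_ofReal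
  have he : ∀ t, (∑' i, ENNReal.ofReal (a i t)).toReal = ∑' i, a i t := fun t => by
    rw [ENNReal.tsum_toReal_eq fun _ => ENNReal.ofReal_ne_top]
    exact tsum_congr fun i => ENNReal.toReal_ofReal (h0 i t)
  refine ⟨?_, ?_, ?_⟩
  · filter_upwards [ae_lt_top' hm h1] with t ht
    have := ENNReal.summable_toReal ht.ne
    exact this.congr fun i => ENNReal.toReal_ofReal (h0 i t)
  · simpa only [he] using integrable_toReal_of_lintegral_ne_top hm h1
  · have hs : Summable fun i => ∫ t, ‖a i t‖ ∂μ := by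
      simp only [Real.norm_of_nonneg (h0 _ _)]
      exact summable_of_sum_le (fun i => integral_nonneg (h0 i)) hB
    exact hasSum_le_of_sum_le (hasSum_integral_of_summable_integral_norm ha hs) hB

theorem integral_conj_eq {f : ℝ → ℂ} {a b : ℝ} (hf : IntervalIntegrable f volume a b) :
    ∫ s in a..b, conj (f s) = conj (∫ s in a..b, f s) :=
  (Complex.conjCLE : ℂ →L[ℝ] ℂ).intervalIntegral_comp_comm hf

section

variable {T : ℝ} {lam : ℝ} {u N : ℝ → ℂ}

/-- The energy identity for one Fourier mode. -/
theorem mode_energy (hT : 0 ≤ T) (hu : ContinuousOn u (Icc 0 T))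
    (hN : IntervalIntegrable N volume 0 T)
    (hode : ∀ t ∈ Icc 0 T, u t = u 0 + ∫ s in (0 : ℝ)..t, (-(lam : ℂ) * u s - N s)) :
    IntervalIntegrable (fun s => -2 * lam * ‖u s‖ ^ 2 - 2 * (N s * conj (u s)).re) volume 0 T ∧
    ∀ t ∈ Icc 0 T, ‖u t‖ ^ 2 = ‖u 0‖ ^ 2 +
      ∫ s in (0 : ℝ)..t, (-2 * lam * ‖u s‖ ^ 2 - 2 * (N s * conj (u s)).re) := by
  have hui : IntervalIntegrable u volume 0 T :=
    ContinuousOn.intervalIntegrable (by rwa [uIcc_of_le hT])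
  have hf : IntervalIntegrable (fun s => -(lam : ℂ) * u s - N s) volume 0 T :=
    (hui.const_mul _).sub hN
  have hg : IntervalIntegrable (fun s => conj (-(lam : ℂ) * u s - N s)) volume 0 T :=
    ⟨(Complex.conjCLE : ℂ →L[ℝ] ℂ).integrable_comp hf.1,
      (Complex.conjCLE : ℂ →L[ℝ] ℂ).integrable_comp hf.2⟩
  have hsub : ∀ t ∈ Icc 0 T, uIcc 0 t ⊆ uIcc 0 T := fun t ht => by
    rw [uIcc_of_le ht.1, uIcc_of_le hT]; exact Icc_subset_Icc_right ht.2
  obtain ⟨h1, h2⟩ := mul_eq_integral_of_primitive (G := fun t => conj (u t)) hT hf hg hode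
    (fun t ht => by
      rw [integral_conj_eq (hf.mono_set (hsub t ht)), hode t ht, map_add])
  have e : ∀ s, ((-(lam : ℂ) * u s - N s) * conj (u s) + u s * conj (-(lam : ℂ) * u s - N s)).re =
      -2 * lam * ‖u s‖ ^ 2 - 2 * (N s * conj (u s)).re := by
    intro s
    rw [← Complex.normSq_eq_norm_sq, Complex.normSq_apply]
    simp
    ring
  have e2 : ∀ s, (u s * conj (u s)).re = ‖u s‖ ^ 2 := fun s => by
    rw [Complex.mul_conj, Complex.ofReal_re, Complex.normSq_eq_norm_sq]
  refine ⟨?_, fun t ht => ?_⟩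
  · have : IntervalIntegrable (fun s => ((-(lam : ℂ) * u s - N s) * conj (u s) +
        u s * conj (-(lam : ℂ) * u s - N s)).re) volume 0 T := ⟨h1.1.re, h1.2.re⟩
    simpa only [e] using this
  · have h3 := congrArg Complex.re (h2 t ht)
    have h4 := Complex.reCLM.intervalIntegral_comp_comm (h1.mono_set (hsub t ht))
    simp only [Complex.reCLM_apply, e] at h4
    rw [Complex.add_re, e2, e2, ← h4] at h3
    exact h3

end

section
variable {L : Fin 2 → ℝ}

/-- A quantitative form of the embedding of `H²` into the functions with absolutely summable
Fourier series. Off the finite set `F₀` Young's inequality is used for each frequency; on `F₀` the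
trivial bound `‖b k‖ ≤ 1 + m`, which costs no derivative. -/
theorem sum_mul_norm_le {F₀ : Finset (Fin 2 → ℤ)} {δ : ℝ}
    (hδ : ∀ F : Finset (Fin 2 → ℤ), Disjoint F F₀ → ∑ k ∈ F, (weight L k)⁻¹ ≤ δ)
    {b : (Fin 2 → ℤ) → ℂ} {m : ℝ} (hm : ∀ F : Finset (Fin 2 → ℤ), ∑ k ∈ F, ‖b k‖ ^ 2 ≤ m)
    {x η : ℝ} (hx : 0 ≤ x) (hη : 0 < η) (F : Finset (Fin 2 → ℤ)) :
    ∑ k ∈ F, x * ‖b k‖ ≤ η * (m + ∑ k ∈ F, freqSq L k ^ 2 * ‖b k‖ ^ 2) + x ^ 2 * δ / (4 * η) +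
      x * (F₀.card * (1 + m)) := by
  classical
  rw [← Finset.sum_filter_add_sum_filter_not F (· ∈ F₀) (fun k => x * ‖b k‖), add_comm]
  refine add_le_add ?_ ?_
  · have h1 : ∀ k, x * ‖b k‖ ≤
        η * (weight L k * ‖b k‖ ^ 2) + x ^ 2 * (weight L k)⁻¹ / (4 * η) := by
      intro k
      have hw := weight_pos (L := L) k
      have : 0 ≤ (2 * η * weight L k * ‖b k‖ - x) ^ 2 / (4 * η * weight L k) := by positivity
      have e : (2 * η * weight L k * ‖b k‖ - x) ^ 2 / (4 * η * weight L k) =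
        η * (weight L k * ‖b k‖ ^ 2) + x ^ 2 * (weight L k)⁻¹ / (4 * η) - x * ‖b k‖ := by
        field_simp; ring
      linarith
    refine (Finset.sum_le_sum fun k _ => h1 k).trans ?_
    rw [Finset.sum_add_distrib, ← Finset.mul_sum, ← Finset.sum_div, ← Finset.mul_sum]
    refine add_le_add (mul_le_mul_of_nonneg_left ?_ hη.le) ?_
    · refine (Finset.sum_le_sum_of_subset_of_nonneg (Finset.filter_subset _ F) fun k _ _ =>
        mul_nonneg (weight_pos k).le (by positivity)).trans ?_
      simp only [weight, add_mul, one_mul, Finset.sum_add_distrib]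
      exact add_le_add (hm F) le_rfl
    · refine div_le_div_of_nonneg_right (mul_le_mul_of_nonneg_left (hδ _ ?_) (sq_nonneg x))
        (by positivity)
      exact Finset.disjoint_left.2 fun k hk => (Finset.mem_filter.1 hk).2
  · rw [← Finset.mul_sum]
    refine mul_le_mul_of_nonneg_left ?_ hx
    have h2 : ∀ k, ‖b k‖ ≤ 1 + m := fun k => by
      have := hm {k}
      rw [Finset.sum_singleton] at this
      nlinarith [sq_nonneg (‖b k‖ - 1), norm_nonneg (b k)]
    have hm0 : 0 ≤ 1 + m := (norm_nonneg _).trans (h2 0)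
    refine (Finset.sum_le_card_nsmul _ _ (1 + m) fun k _ => h2 k).trans ?_
    rw [nsmul_eq_mul]
    refine mul_le_mul_of_nonneg_right ?_ hm0
    exact_mod_cast Finset.card_le_card fun k hk => (Finset.mem_filter.1 hk).2

/-- The interpolation inequality `‖∇f‖⁴ ≤ ‖f‖² ‖Δf‖²`. -/
theorem sq_le_mul_of_hasSum {b : (Fin 2 → ℤ) → ℂ} {m g : ℝ}
    (hm : ∀ F : Finset (Fin 2 → ℤ), ∑ k ∈ F, ‖b k‖ ^ 2 ≤ m)
    (hg : HasSum (fun k => freqSq L k * ‖b k‖ ^ 2) g)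
    (hD : Summable fun k => freqSq L k ^ 2 * ‖b k‖ ^ 2) :
    g ^ 2 ≤ m * ∑' k, freqSq L k ^ 2 * ‖b k‖ ^ 2 := by
  have h1 : ∀ F : Finset (Fin 2 → ℤ), (∑ k ∈ F, freqSq L k * ‖b k‖ ^ 2) ^ 2 ≤
      m * ∑' k, freqSq L k ^ 2 * ‖b k‖ ^ 2 := by
    intro F
    have h2 := Finset.sum_mul_sq_le_sq_mul_sq F (fun k => ‖b k‖) (fun k => freqSq L k * ‖b k‖)
    have h3 : ∑ k ∈ F, ‖b k‖ * (freqSq L k * ‖b k‖) = ∑ k ∈ F, freqSq L k * ‖b k‖ ^ 2 :=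
      Finset.sum_congr rfl fun k _ => by ring
    rw [h3] at h2
    refine h2.trans ?_
    simp only [mul_pow]
    refine mul_le_mul (hm F) (hD.sum_le_tsum F fun _ _ => by positivity) (by positivity) ?_
    exact le_trans (by positivity) (hm F)
  exact le_of_tendsto (hg.pow 2) (Filter.Eventually.of_forall h1)

variable [∀ j, Fact (0 < L j)]

/-- Solutions of the mode equations `uₖ' = -(|k̃|⁴ - |k̃|²) uₖ - Nₖ` which are bounded in `L²`, with
`|Nₖ| ≤ ‖∇u‖² + K` and `‖∇u(t)‖² ≤ C t^{-1/2}`, belong to `L²(0, T; H²)`.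

In the energy identity the nonlinearity contributes at most `(‖∇u‖² + K) ∑ₖ |uₖ|`. Away from the
initial time `‖∇u‖` is bounded, and the dissipation absorbs this term. The resulting bound is only
used to know that `∫ ‖Δu‖²` over `[ε, T]` is finite. Then `‖∇u‖⁴ ≤ m ‖Δu‖²` allows this term to be
absorbed with a small factor `δ`, up to finitely many frequencies; these contribute a multiple of
`‖∇u‖²`, which is integrable up to the time `0`. So the bound does not depend on `ε`. -/
theorem mode_regularity {T m K C : ℝ} (hT : 0 < T) (hK : 0 ≤ K) (hC : 0 ≤ C)
    {u N : (Fin 2 → ℤ) → ℝ → ℂ} {g : ℝ → ℝ}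
    (hu : ∀ k, ContinuousOn (u k) (Icc 0 T))
    (hN : ∀ k, IntervalIntegrable (N k) volume 0 T)
    (hode : ∀ k, ∀ t ∈ Icc 0 T, u k t = u k 0 +
      ∫ s in (0 : ℝ)..t, (-(symbol L k : ℂ) * u k s - N k s))
    (hm : ∀ t ∈ Icc 0 T, ∀ F : Finset (Fin 2 → ℤ), ∑ k ∈ F, ‖u k t‖ ^ 2 ≤ m)
    (hg : ∀ t ∈ Ioc 0 T, HasSum (fun k => freqSq L k * ‖u k t‖ ^ 2) (g t))
    (hgC : ∀ t ∈ Ioc 0 T, g t ≤ C * t ^ (-(1 / 2) : ℝ))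
    (hNg : ∀ᵐ t ∂(volume.restrict (Ioc 0 T)), ∀ k, ‖N k t‖ ≤ g t + K) :
    (∀ᵐ t ∂(volume.restrict (Ioc 0 T)), Summable fun k => freqSq L k ^ 2 * ‖u k t‖ ^ 2) ∧
      IntegrableOn (fun t => ∑' k, freqSq L k ^ 2 * ‖u k t‖ ^ 2) (Ioc 0 T) := by
  have hm0 : 0 ≤ m := by simpa using hm 0 ⟨le_rfl, hT.le⟩ ∅
  have hg0 : ∀ t ∈ Ioc 0 T, 0 ≤ g t := fun t ht =>
    (hg t ht).nonneg fun k => mul_nonneg (freqSq_nonneg k) (by positivity)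
  let R : (Fin 2 → ℤ) → ℝ → ℝ := fun k s =>
    -2 * symbol L k * ‖u k s‖ ^ 2 - 2 * (N k s * conj (u k s)).re
  have hR := fun k => mode_energy hT.le (hu k) (hN k) (hode k)
  have hRi : ∀ k ε, 0 < ε → IntegrableOn (R k) (Ioc ε T) := fun k ε hε =>
    ((intervalIntegrable_iff_integrableOn_Ioc_of_le hT.le).1 (hR k).1).mono_set
      (Ioc_subset_Ioc_left hε.le)
  have hai : ∀ k, IntegrableOn (fun t => freqSq L k ^ 2 * ‖u k t‖ ^ 2) (Ioc 0 T) := fun k =>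
    ((continuousOn_const.mul ((hu k).norm.pow 2)).integrableOn_Icc).mono_set Ioc_subset_Icc_self
  have hai' : ∀ k ε, 0 < ε → IntegrableOn (fun t => freqSq L k ^ 2 * ‖u k t‖ ^ 2) (Ioc ε T) :=
    fun k ε hε => (hai k).mono_set (Ioc_subset_Ioc_left hε.le)
  -- The energy identity on `[ε, T]`, summed over finitely many modes.
  have henergy : ∀ ε ∈ Ioc 0 T, ∀ F : Finset (Fin 2 → ℤ),
      -m ≤ ∫ t in Ioc ε T, ∑ k ∈ F, R k t := by
    intro ε hε F
    have h1 : ∀ k, ‖u k T‖ ^ 2 = ‖u k ε‖ ^ 2 + ∫ t in Ioc ε T, R k t := by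
      intro k
      have i1 : IntervalIntegrable (R k) volume 0 ε := (hR k).1.mono_set (by
        rw [uIcc_of_le hε.1.le, uIcc_of_le hT.le]; exact Icc_subset_Icc_right hε.2)
      have i2 : IntervalIntegrable (R k) volume ε T := (hR k).1.mono_set (by
        rw [uIcc_of_le hε.2, uIcc_of_le hT.le]; exact Icc_subset_Icc_left hε.1.le)
      rw [← intervalIntegral.integral_of_le hε.2, (hR k).2 T ⟨hT.le, le_rfl⟩,
        (hR k).2 ε ⟨hε.1.le, hε.2⟩, add_assoc,
        intervalIntegral.integral_add_adjacent_intervals i1 i2]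
    rw [integral_finsetSum F fun k _ => hRi k ε hε.1]
    have h2 : ∑ k ∈ F, ∫ t in Ioc ε T, R k t = ∑ k ∈ F, ‖u k T‖ ^ 2 - ∑ k ∈ F, ‖u k ε‖ ^ 2 := by
      rw [← Finset.sum_sub_distrib]
      exact Finset.sum_congr rfl fun k _ => by linarith [h1 k]
    have h3 : 0 ≤ ∑ k ∈ F, ‖u k T‖ ^ 2 := Finset.sum_nonneg fun _ _ => by positivity
    linarith [hm ε ⟨hε.1.le, hε.2⟩ F]
  -- Young's inequality for the energy production; `F₀` and `δ` are chosen in two ways below.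
  have hpoint : ∀ᵐ t ∂(volume.restrict (Ioc 0 T)), ∀ (F₀ : Finset (Fin 2 → ℤ)) (δ : ℝ),
      (∀ F : Finset (Fin 2 → ℤ), Disjoint F F₀ → ∑ k ∈ F, (weight L k)⁻¹ ≤ δ) →
      ∀ F : Finset (Fin 2 → ℤ), ∑ k ∈ F, R k t ≤
        -(3 / 2) * ∑ k ∈ F, freqSq L k ^ 2 * ‖u k t‖ ^ 2 + 2 * g t + m / 2 +
          2 * δ * (g t + K) ^ 2 + 2 * (F₀.card * (1 + m)) * (g t + K) := by
    filter_upwards [hNg, ae_restrict_mem measurableSet_Ioc] with t hNt ht F₀ δ hδ F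
    have hx : 0 ≤ g t + K := add_nonneg (hg0 t ht) hK
    have h1 := sum_mul_norm_le hδ (hm t ⟨ht.1.le, ht.2⟩) hx (by norm_num : (0 : ℝ) < 1 / 4) F
    have h2 : ∑ k ∈ F, R k t ≤ ∑ k ∈ F, (-2 * (freqSq L k ^ 2 * ‖u k t‖ ^ 2) +
        2 * (freqSq L k * ‖u k t‖ ^ 2) + 2 * ((g t + K) * ‖u k t‖)) := by
      refine Finset.sum_le_sum fun k _ => ?_
      have h3 : -(N k t * conj (u k t)).re ≤ (g t + K) * ‖u k t‖ := by
        refine (neg_le_abs _).trans ((Complex.abs_re_le_norm _).trans ?_)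
        rw [norm_mul, RCLike.norm_conj]
        exact mul_le_mul_of_nonneg_right (hNt k) (norm_nonneg _)
      simp only [R, symbol]
      linarith
    have h4 := sum_le_hasSum F (fun k _ => mul_nonneg (freqSq_nonneg k) (by positivity)) (hg t ht)
    rw [Finset.sum_add_distrib, Finset.sum_add_distrib, ← Finset.mul_sum, ← Finset.mul_sum,
      ← Finset.mul_sum] at h2
    linarith
  -- Qualitative bound away from the initial time, where `g` is bounded.
  have hqual : ∀ ε ∈ Ioc 0 T, ∃ B, ∀ F : Finset (Fin 2 → ℤ),
      ∑ k ∈ F, ∫ t in Ioc ε T, freqSq L k ^ 2 * ‖u k t‖ ^ 2 ≤ B := by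
    intro ε hε
    set S := ∑' k, (weight L k)⁻¹
    have hS : ∀ F : Finset (Fin 2 → ℤ), Disjoint F ∅ → ∑ k ∈ F, (weight L k)⁻¹ ≤ S := fun F _ =>
      summable_inv_weight.sum_le_tsum F fun k _ => (inv_pos.2 (weight_pos k)).le
    have hS0 : 0 ≤ S := tsum_nonneg fun k => (inv_pos.2 (weight_pos k)).le
    set G := C * ε ^ (-(1 / 2) : ℝ)
    set Q := 2 * G + m / 2 + 2 * S * (G + K) ^ 2 with hQdef
    refine ⟨(m + ∫ _ in Ioc ε T, Q) / (3 / 2), fun F => ?_⟩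
    rw [← integral_finsetSum F fun k _ => hai' k ε hε.1, le_div_iff₀ (by norm_num)]
    have hi : IntegrableOn (fun t => ∑ k ∈ F, freqSq L k ^ 2 * ‖u k t‖ ^ 2) (Ioc ε T) :=
      integrable_finsetSum F fun k _ => hai' k ε hε.1
    have hQ : IntegrableOn (fun _ : ℝ => Q) (Ioc ε T) := integrableOn_const (by simp)
    have h1 : ∫ t in Ioc ε T, ∑ k ∈ F, R k t ≤ ∫ t in Ioc ε T,
        (-(3 / 2) * ∑ k ∈ F, freqSq L k ^ 2 * ‖u k t‖ ^ 2 + Q) := by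
      refine integral_mono_ae (integrable_finsetSum F fun k _ => hRi k ε hε.1)
        ((hi.const_mul _).add hQ) ?_
      filter_upwards [ae_restrict_of_ae_restrict_of_subset (Ioc_subset_Ioc_left hε.1.le) hpoint,
        ae_restrict_mem measurableSet_Ioc] with t h2 ht
      have ht' : t ∈ Ioc 0 T := ⟨hε.1.trans ht.1, ht.2⟩
      have h3 := h2 ∅ S hS F
      have h4 : g t ≤ G := (hgC t ht').trans (mul_le_mul_of_nonneg_left
        (Real.rpow_le_rpow_of_nonpos hε.1 ht.1.le (by norm_num)) hC)
      have h5 := hg0 t ht'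
      have h6 : 2 * S * (g t + K) ^ 2 ≤ 2 * S * (G + K) ^ 2 :=
        mul_le_mul_of_nonneg_left (pow_le_pow_left₀ (by linarith) (by linarith) 2) (by linarith)
      simp only [Finset.card_empty, Nat.cast_zero, zero_mul, mul_zero, add_zero] at h3
      linarith [hQdef]
    rw [integral_add (hi.const_mul _) hQ, integral_const_mul] at h1
    linarith [henergy ε hε F]
  have h01 : ∀ k t, 0 ≤ freqSq L k ^ 2 * ‖u k t‖ ^ 2 := fun k t => by positivity
  -- Outside of a finite set of frequencies the sum of the inverse weights is at most `δ`. The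
  -- choice `δ = 1 / (8 (m + 1))` makes the coefficient `4 δ m` of `‖Δu‖²` at most `1 / 2`.
  obtain ⟨F₀, hF₀⟩ : ∃ F₀ : Finset (Fin 2 → ℤ), ∀ F : Finset (Fin 2 → ℤ), Disjoint F F₀ →
      ∑ k ∈ F, (weight L k)⁻¹ ≤ 1 / (8 * (m + 1)) := by
    have hs := summable_inv_weight (L := L)
    rw [summable_iff_vanishing_norm] at hs
    obtain ⟨F₀, h⟩ := hs (1 / (8 * (m + 1))) (by positivity)
    exact ⟨F₀, fun F hF => (Real.le_norm_self _).trans (h F hF).le⟩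
  set δ : ℝ := 1 / (8 * (m + 1)) with hδ
  set n₀ : ℝ := 2 * (F₀.card * (1 + m)) with hn₀
  have hn₀0 : 0 ≤ n₀ := by positivity
  have hδm : 4 * δ * m ≤ 1 / 2 := by
    rw [hδ]
    have : 4 * (1 / (8 * (m + 1))) * m = (1 / 2) * (m / (m + 1)) := by field_simp; ring
    rw [this]
    have : m / (m + 1) ≤ 1 := div_le_one_of_le₀ (by linarith) (by linarith)
    linarith
  have hδ0 : 0 ≤ δ := by positivity
  let P : ℝ → ℝ := fun t => (2 + n₀) * (C * t ^ (-(1 / 2) : ℝ)) + (m / 2 + 4 * δ * K ^ 2 + n₀ * K)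
  have hP : IntegrableOn P (Ioc 0 T) := by
    have : IntegrableOn (fun t : ℝ => t ^ (-(1 / 2) : ℝ)) (Ioc 0 T) := by
      rw [← intervalIntegrable_iff_integrableOn_Ioc_of_le hT.le]
      exact intervalIntegral.intervalIntegrable_rpow' (by norm_num)
    exact ((this.const_mul C).const_mul _).add (integrableOn_const (by simp))
  have hP0 : ∀ t ∈ Ioc 0 T, 0 ≤ P t := fun t ht => by
    have : 0 ≤ t ^ (-(1 / 2) : ℝ) := Real.rpow_nonneg ht.1.le _
    simp only [P]; positivity
  -- The uniform bound; it can be derived because `I` is finite, so that `I / 2` is absorbed.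
  have hquant : ∀ ε ∈ Ioc 0 T, ∀ F : Finset (Fin 2 → ℤ),
      ∑ k ∈ F, ∫ t in Ioc ε T, freqSq L k ^ 2 * ‖u k t‖ ^ 2 ≤ m + ∫ t in Ioc 0 T, P t := by
    intro ε hε
    obtain ⟨B, hB⟩ := hqual ε hε
    obtain ⟨hsum, hDi, -⟩ := ae_summable_of_sum_integral_le (fun k => hai' k ε hε.1) h01 hB
    set I := ∫ t in Ioc ε T, ∑' k, freqSq L k ^ 2 * ‖u k t‖ ^ 2
    have hmain : ∀ F : Finset (Fin 2 → ℤ), ∑ k ∈ F, ∫ t in Ioc ε T, freqSq L k ^ 2 * ‖u k t‖ ^ 2 ≤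
        (m + (∫ t in Ioc 0 T, P t) + (1 / 2) * I) / (3 / 2) := by
      intro F
      rw [← integral_finsetSum F fun k _ => hai' k ε hε.1, le_div_iff₀ (by norm_num)]
      have hi : IntegrableOn (fun t => ∑ k ∈ F, freqSq L k ^ 2 * ‖u k t‖ ^ 2) (Ioc ε T) :=
        integrable_finsetSum F fun k _ => hai' k ε hε.1
      have hPε : IntegrableOn P (Ioc ε T) := hP.mono_set (Ioc_subset_Ioc_left hε.1.le)
      have hA : IntegrableOn (fun t => -(3 / 2) * ∑ k ∈ F, freqSq L k ^ 2 * ‖u k t‖ ^ 2 + P t)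
          (Ioc ε T) := (hi.const_mul _).add hPε
      have h1 : ∫ t in Ioc ε T, ∑ k ∈ F, R k t ≤ ∫ t in Ioc ε T,
          ((-(3 / 2) * ∑ k ∈ F, freqSq L k ^ 2 * ‖u k t‖ ^ 2 + P t) +
            (1 / 2) * ∑' k, freqSq L k ^ 2 * ‖u k t‖ ^ 2) := by
        refine integral_mono_ae (integrable_finsetSum F fun k _ => hRi k ε hε.1)
          (hA.add (hDi.const_mul _)) ?_
        filter_upwards [ae_restrict_of_ae_restrict_of_subset (Ioc_subset_Ioc_left hε.1.le) hpoint,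
          ae_restrict_mem measurableSet_Ioc, hsum] with t h2 ht hst
        have ht' : t ∈ Ioc 0 T := ⟨hε.1.trans ht.1, ht.2⟩
        have h3 := h2 F₀ δ hF₀ F
        have h4 := hgC t ht'
        have h5 := hg0 t ht'
        have h6 := sq_le_mul_of_hasSum (hm t ⟨ht'.1.le, ht'.2⟩) (hg t ht') hst
        set D := ∑' k, freqSq L k ^ 2 * ‖u k t‖ ^ 2
        have hD0 : 0 ≤ D := tsum_nonneg fun k => h01 k t
        have h7 : 2 * δ * (g t + K) ^ 2 ≤ (1 / 2) * D + 4 * δ * K ^ 2 := by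
          have h8 : (g t + K) ^ 2 ≤ 2 * (m * D) + 2 * K ^ 2 := by
            nlinarith [sq_nonneg (g t - K)]
          have h9 := mul_le_mul_of_nonneg_left h8 (by linarith : 0 ≤ 2 * δ)
          have h10 := mul_le_mul_of_nonneg_right hδm hD0
          linarith
        have h11 : n₀ * (g t + K) ≤ n₀ * (C * t ^ (-(1 / 2) : ℝ) + K) :=
          mul_le_mul_of_nonneg_left (by linarith) hn₀0
        simp only [P]
        linarith
      rw [integral_add hA (hDi.const_mul _),
        integral_add (hi.const_mul _) hPε, integral_const_mul, integral_const_mul] at h1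
      have h12 : ∫ t in Ioc ε T, P t ≤ ∫ t in Ioc 0 T, P t :=
        setIntegral_mono_set hP (by
          filter_upwards [ae_restrict_mem measurableSet_Ioc] with t ht using hP0 t ht)
          (Ioc_subset_Ioc_left hε.1.le).eventuallyLE
      linarith [henergy ε hε F]
    have hI : I ≤ (m + (∫ t in Ioc 0 T, P t) + (1 / 2) * I) / (3 / 2) :=
      (ae_summable_of_sum_integral_le (fun k => hai' k ε hε.1) h01 hmain).2.2
    intro F
    have hIle : I ≤ m + ∫ t in Ioc 0 T, P t := by
      rw [le_div_iff₀ (by norm_num)] at hI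
      linarith
    have := hmain F
    rw [le_div_iff₀ (by norm_num)] at this
    linarith
  -- Passage to the limit `ε → 0` for each finite set of frequencies.
  have hfull : ∀ F : Finset (Fin 2 → ℤ),
      ∑ k ∈ F, ∫ t in Ioc 0 T, freqSq L k ^ 2 * ‖u k t‖ ^ 2 ≤ m + ∫ t in Ioc 0 T, P t := by
    intro F
    have hlim : Filter.Tendsto (fun n : ℕ => ∑ k ∈ F, ∫ t in Ioc (T / ((n : ℝ) + 1)) T,
        freqSq L k ^ 2 * ‖u k t‖ ^ 2) Filter.atTop
        (nhds (∑ k ∈ F, ∫ t in Ioc 0 T, freqSq L k ^ 2 * ‖u k t‖ ^ 2)) := by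
      refine tendsto_finsetSum F fun k _ => ?_
      have h1 : ContinuousOn (fun x => ∫ t in x..T, freqSq L k ^ 2 * ‖u k t‖ ^ 2) (uIcc 0 T) :=
        intervalIntegral.continuousOn_primitive_interval_left (by
          rw [uIcc_of_le hT.le]
          exact (continuousOn_const.mul ((hu k).norm.pow 2)).integrableOn_Icc)
      have h2 : Filter.Tendsto (fun n : ℕ => T / ((n : ℝ) + 1)) Filter.atTop
          (nhdsWithin 0 (uIcc 0 T)) := by
        rw [tendsto_nhdsWithin_iff]
        refine ⟨?_, Filter.Eventually.of_forall fun n => ?_⟩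
        · have := tendsto_one_div_add_atTop_nhds_zero_nat (𝕜 := ℝ) |>.const_mul T
          simpa [div_eq_mul_inv] using this
        · rw [uIcc_of_le hT.le]
          exact ⟨by positivity, div_le_self hT.le (by linarith [n.cast_nonneg (α := ℝ)])⟩
      have h3 := (h1 0 left_mem_uIcc).tendsto.comp h2
      rw [intervalIntegral.integral_of_le hT.le] at h3
      refine h3.congr fun n => ?_
      exact intervalIntegral.integral_of_le
        (div_le_self hT.le (by linarith [n.cast_nonneg (α := ℝ)]))
    refine le_of_tendsto hlim (Filter.Eventually.of_forall fun n => ?_)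
    exact hquant _ ⟨by positivity, div_le_self hT.le (by linarith [n.cast_nonneg (α := ℝ)])⟩ F
  obtain ⟨h1, h2, -⟩ := ae_summable_of_sum_integral_le hai h01 hfull
  exact ⟨h1, h2⟩

end

section
variable {L : Fin 2 → ℝ}

/-! ### Approximation by trigonometric polynomials -/

theorem ofReal_trigPoly {F : Finset (Fin 2 → ℤ)} (hF : ∀ k, -k ∈ F ↔ k ∈ F)
    {a : (Fin 2 → ℤ) → ℂ} (ha : ∀ k, a (-k) = conj (a k)) (x : Torus L) :
    (trigPoly L F a x : ℂ) = ∑ k ∈ F, a k * character L k x := by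
  have h1 : conj (∑ k ∈ F, a k * character L k x) = ∑ k ∈ F, a k * character L k x := by
    rw [map_sum]
    refine Finset.sum_equiv (Equiv.neg _) (fun k => (hF k).symm) fun k _ => ?_
    rw [Equiv.neg_apply, ha, character_neg, map_mul]
  rw [trigPoly, ← Complex.re_sum]
  exact (Complex.conj_eq_iff_re.1 h1)

variable [∀ j, Fact (0 < L j)]

theorem fourierCoefficient_trigPoly {F : Finset (Fin 2 → ℤ)} (hF : ∀ k, -k ∈ F ↔ k ∈ F)
    {a : (Fin 2 → ℤ) → ℂ} (ha : ∀ k, a (-k) = conj (a k)) (k : Fin 2 → ℤ) :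
    fourierCoefficient L (trigPoly L F a) k = if k ∈ F then a k else 0 := by
  have hA0 : (area L : ℂ) ≠ 0 := by simpa using (area_pos L).ne'
  have h2 : ∀ l, ∫ x : Torus L, a l * character L l x * conj (character L k x) =
      if l = k then a k * area L else 0 := by
    intro l
    simp_rw [mul_assoc, ← character_neg, ← character_add, integral_const_mul, integral_character]
    by_cases hkl : l = k
    · simp [hkl]
    · have : ¬ l + -k = 0 := fun h => hkl (by simpa using add_eq_zero_iff_eq_neg.1 h)
      simp [hkl, this]
  rw [fourierCoefficient_eq]
  simp only [ofReal_trigPoly hF ha, Finset.sum_mul]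
  rw [integral_finsetSum F fun l _ => integrable_mul_conj_character
    (integrable_of_continuous (by fun_prop)) k]
  simp only [h2, Finset.sum_ite_eq']
  split_ifs
  · field_simp
  · simp

/-- The square `{-n, …, n}²` of frequencies; it is symmetric, so that truncated Fourier series of
real functions are real. -/
noncomputable def freqBox (n : ℕ) : Finset (Fin 2 → ℤ) :=
  Finset.Icc (fun _ => -(n : ℤ)) (fun _ => (n : ℤ))

theorem neg_mem_freqBox (n : ℕ) (k : Fin 2 → ℤ) : -k ∈ freqBox n ↔ k ∈ freqBox n := by
  simp only [freqBox, Finset.mem_Icc, Pi.le_def, Pi.neg_apply]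
  constructor <;> rintro ⟨h1, h2⟩ <;>
    exact ⟨fun j => by linarith [h1 j, h2 j], fun j => by linarith [h1 j, h2 j]⟩

theorem tendsto_freqBox : Filter.Tendsto freqBox Filter.atTop Filter.atTop := by
  refine Filter.tendsto_atTop_finset_of_monotone (fun m n hmn => ?_) fun k => ?_
  · refine Finset.Icc_subset_Icc (fun j => ?_) (fun j => ?_)
    · simpa using hmn
    · simpa using hmn
  · refine ⟨(|k 0| + |k 1|).toNat, ?_⟩
    have h : ((|k 0| + |k 1|).toNat : ℤ) = |k 0| + |k 1| := Int.toNat_of_nonneg (by positivity)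
    simp only [freqBox, Finset.mem_Icc, Pi.le_def, h]
    refine ⟨fun j => ?_, fun j => ?_⟩ <;> fin_cases j <;>
      simp only [Fin.zero_eta, Fin.mk_one] <;>
      linarith [abs_nonneg (k 0), abs_nonneg (k 1), neg_abs_le (k 0), neg_abs_le (k 1),
        le_abs_self (k 0), le_abs_self (k 1)]

/-- The truncated Fourier series of `f`. -/
noncomputable def partialSum (L : Fin 2 → ℝ) [∀ j, Fact (0 < L j)] (n : ℕ) (f : Torus L → ℝ) :
    Torus L → ℝ := trigPoly L (freqBox n) (fourierCoefficient L f)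

theorem continuous_partialSum (n : ℕ) (f : Torus L → ℝ) : Continuous (partialSum L n f) :=
  continuous_trigPoly _ _

theorem tendsto_integral_partialSum_sub_sq {f : Torus L → ℝ} (hf : MemLp f 2 volume) :
    Filter.Tendsto (fun n => ∫ x, (partialSum L n f x - f x) ^ 2) Filter.atTop (nhds 0) := by
  have hA := area_pos L
  have h1 := hasSum_norm_fourierCoefficient_sq hf
  have h2 : ∀ n, ∫ x, (partialSum L n f x - f x) ^ 2 = area L *
      ((area L)⁻¹ * (∫ x, f x ^ 2) - ∑ k ∈ freqBox n, ‖fourierCoefficient L f k‖ ^ 2) := by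
    intro n
    have hp := memLp_of_continuous (continuous_partialSum n f)
    have h3 := hasSum_norm_fourierCoefficient_sq (hp.sub hf)
    have h4 : HasSum (fun k => if k ∈ freqBox n then ‖fourierCoefficient L f k‖ ^ 2 else 0)
        (∑ k ∈ freqBox n, ‖fourierCoefficient L f k‖ ^ 2) := by
      have : HasSum (fun k => if k ∈ freqBox n then ‖fourierCoefficient L f k‖ ^ 2 else 0)
          (∑ k ∈ freqBox n, if k ∈ freqBox n then ‖fourierCoefficient L f k‖ ^ 2 else 0) :=
        hasSum_sum_of_ne_finset_zero fun k hk => by simp [hk]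
      rwa [Finset.sum_congr rfl fun k hk => if_pos hk] at this
    have h5 := h3.unique ((h1.sub h4).congr_fun fun k => ?_)
    · rw [← h5, mul_inv_cancel_left₀ hA.ne']
      rfl
    · have e : fourierCoefficient L (partialSum L n f - f) k =
          (if k ∈ freqBox n then fourierCoefficient L f k else 0) - fourierCoefficient L f k := by
        rw [← fourierCoefficient_trigPoly (L := L) (neg_mem_freqBox n)
          (fourierCoefficient_neg f) k]
        have h6 := fourierCoefficient_add (hp.integrable (by norm_num))
          ((hf.integrable (by norm_num)).const_mul (-1)) k
        rw [fourierCoefficient_const_mul] at h6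
        have h7 : (partialSum L n f - f) = fun x => partialSum L n f x + -1 * f x := by
          ext x; simp [sub_eq_add_neg]
        rw [h7, h6, partialSum]
        push_cast
        ring
      rw [e]
      split_ifs <;> simp
  simp_rw [h2]
  have h3 := (h1.comp tendsto_freqBox)
  have h4 := (h3.const_sub ((area L)⁻¹ * (∫ x, f x ^ 2))).const_mul (area L)
  simpa using h4

/-- The truncated Fourier series converges uniformly if the Fourier coefficients are summable. -/
theorem partialSum_sub_le {f : Torus L → ℝ} (hf : Integrable f volume)
    (hs : Summable fun k => ‖fourierCoefficient L f k‖) :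
    ∃ e : ℕ → ℝ, Filter.Tendsto e Filter.atTop (nhds 0) ∧
      ∀ n, ∀ᵐ x, |partialSum L n f x - f x| ≤ e n := by
  refine ⟨fun n => ∑' k, ‖fourierCoefficient L f k‖ - ∑ k ∈ freqBox n, ‖fourierCoefficient L f k‖,
    ?_, fun n => ?_⟩
  · simpa using (hs.hasSum.comp tendsto_freqBox).const_sub (∑' k, ‖fourierCoefficient L f k‖)
  · filter_upwards [ae_hasSum_fourierCoefficient hf hs] with x hx
    have h1 : ((f x : ℂ) - (partialSum L n f x : ℂ)) =
        ∑' k : {k // k ∉ freqBox n}, fourierCoefficient L f k * character L k x := by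
      rw [partialSum, ofReal_trigPoly (neg_mem_freqBox n) (fourierCoefficient_neg f), ← hx.tsum_eq,
        ← hx.summable.sum_add_tsum_subtype_compl (freqBox n)]
      ring
    have h2 := hs.sum_add_tsum_subtype_compl (freqBox n)
    have h3 : Summable fun k : {k // k ∉ freqBox n} =>
        ‖fourierCoefficient L f k * character L k x‖ := by
      simp only [norm_mul, norm_character, mul_one]
      exact hs.subtype _
    have h4 := norm_tsum_le_tsum_norm h3
    rw [← h1, ← Complex.ofReal_sub, Complex.norm_real, Real.norm_eq_abs] at h4
    simp only [norm_mul, norm_character, mul_one] at h4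
    rw [abs_sub_comm]
    linarith

theorem abs_le_tsum_of_summable {f : Torus L → ℝ} (hf : Integrable f volume)
    (hs : Summable fun k => ‖fourierCoefficient L f k‖) :
    ∀ᵐ x, |f x| ≤ ∑' k, ‖fourierCoefficient L f k‖ := by
  filter_upwards [ae_hasSum_fourierCoefficient hf hs] with x hx
  have h := norm_tsum_le_tsum_norm (f := fun k => fourierCoefficient L f k * character L k x)
    (by simpa [norm_character] using hs)
  rw [hx.tsum_eq, Complex.norm_real] at h
  simpa [norm_character] using h

/-- Products of a uniformly convergent and an `L¹` convergent sequence converge in the mean. -/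
theorem tendsto_integral_mul {α : Type*} [MeasurableSpace α] {μ : Measure α} {U : ℕ → α → ℝ}
    {f : α → ℝ} {h : ℕ → α → ℝ} {g : α → ℝ} {e : ℕ → ℝ} {B : ℝ}
    (hU : ∀ n, AEStronglyMeasurable (U n) μ) (hf : AEStronglyMeasurable f μ)
    (hB : ∀ᵐ x ∂μ, |f x| ≤ B) (he : Filter.Tendsto e Filter.atTop (nhds 0))
    (hUe : ∀ n, ∀ᵐ x ∂μ, |U n x - f x| ≤ e n) (hh : ∀ n, Integrable (h n) μ)
    (hg : Integrable g μ)
    (hlim : Filter.Tendsto (fun n => ∫ x, |h n x - g x| ∂μ) Filter.atTop (nhds 0)) :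
    Filter.Tendsto (fun n => ∫ x, U n x * h n x ∂μ) Filter.atTop (nhds (∫ x, f x * g x ∂μ)) := by
  have hUb : ∀ n, ∀ᵐ x ∂μ, ‖U n x‖ ≤ B + e n := fun n => by
    filter_upwards [hB, hUe n] with x h1 h2
    have := abs_add_le (f x) (U n x - f x)
    rw [add_sub_cancel] at this
    rw [Real.norm_eq_abs]; linarith
  rw [tendsto_iff_norm_sub_tendsto_zero]
  have h0 : Filter.Tendsto (fun n => (B + e n) * (∫ x, |h n x - g x| ∂μ) +
      e n * ∫ x, |g x| ∂μ) Filter.atTop (nhds 0) := by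
    simpa using ((he.const_add B).mul hlim).add (he.mul_const (∫ x, |g x| ∂μ))
  refine squeeze_zero (fun n => norm_nonneg _) (fun n => ?_) h0
  have i1 : Integrable (fun x => U n x * h n x) μ := (hh n).bdd_mul (hU n) (hUb n)
  have i2 : Integrable (fun x => f x * g x) μ := hg.bdd_mul hf (by simpa using hB)
  have i3 : Integrable (fun x => (B + e n) * |h n x - g x|) μ := ((hh n).sub hg).abs.const_mul _
  have i4 : Integrable (fun x => e n * |g x|) μ := hg.abs.const_mul _
  rw [← integral_sub i1 i2, ← integral_const_mul, ← integral_const_mul, ← integral_add i3 i4]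
  refine norm_integral_le_of_norm_le (i3.add i4) ?_
  filter_upwards [hUb n, hUe n] with x h1 h2
  have e1 : U n x * h n x - f x * g x = U n x * (h n x - g x) + (U n x - f x) * g x := by ring
  rw [e1]
  refine (norm_add_le _ _).trans ?_
  rw [norm_mul, norm_mul]
  exact add_le_add (mul_le_mul_of_nonneg_right h1 (norm_nonneg _))
    (mul_le_mul_of_nonneg_right h2 (norm_nonneg _))

theorem integral_mul_le_sqrt_mul_sqrt {f g : Torus L → ℝ} (hf : MemLp f 2 volume)
    (hg : MemLp g 2 volume) :
    ∫ x, f x * g x ≤ Real.sqrt (∫ x, f x ^ 2) * Real.sqrt (∫ x, g x ^ 2) := by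
  have h := real_inner_le_norm hf.toLp hg.toLp
  have e1 : ∀ {f : Torus L → ℝ} (hf : MemLp f 2 volume),
      ‖hf.toLp‖ = Real.sqrt (∫ x, f x ^ 2) := fun {f} hf => by
    rw [eq_comm, Real.sqrt_eq_iff_mul_self_eq (integral_nonneg fun x => sq_nonneg _)
      (norm_nonneg _), ← pow_two, ← integral_sq_eq_norm_sq]
    refine integral_congr_ae ?_
    filter_upwards [hf.coeFn_toLp] with x hx
    rw [hx]
  rw [e1 hf, e1 hg, L2.inner_def] at h
  refine le_trans (le_of_eq (integral_congr_ae ?_)) h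
  filter_upwards [hf.coeFn_toLp, hg.coeFn_toLp] with x h1 h2
  rw [h1, h2]
  simp [mul_comm]

theorem grad_partialSum (n : ℕ) (f : L2 L) {G : Torus L → Vec} (h : HasWeakGrad L f G)
    (x : Torus L) (j : Fin 2) :
    grad L (partialSum L n f) x j = partialSum L n (fun x => G x j) x := by
  simp only [grad, partialSum, pd_trigPoly]
  congr 1
  ext k
  rw [h.fourierCoefficient]

theorem continuous_grad_partialSum (n : ℕ) (f : L2 L) :
    Continuous (grad L (partialSum L n f)) := by
  unfold grad partialSum
  simp only [pd_trigPoly]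
  exact (PiLp.continuous_toLp 2 _).comp (continuous_pi fun j => continuous_trigPoly _ _)

/-- The gradients of the truncated Fourier series converge in `L²`. -/
theorem tendsto_integral_grad_partialSum {f : L2 L} {G : Torus L → Vec} (h : HasWeakGrad L f G)
    (hG : MemLp G 2 volume) :
    Filter.Tendsto (fun n => ∫ x, ‖grad L (partialSum L n f) x - G x‖ ^ 2) Filter.atTop
      (nhds 0) := by
  have h0 := tendsto_integral_partialSum_sub_sq (memLp_component hG 0)
  have h1 := tendsto_integral_partialSum_sub_sq (memLp_component hG 1)
  have h2 := h0.add h1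
  rw [add_zero] at h2
  refine h2.congr fun n => ?_
  have hi : ∀ j, Integrable (fun x => (partialSum L n (fun x => G x j) x - G x j) ^ 2) volume :=
    fun j => ((memLp_of_continuous (continuous_partialSum n _)).sub
      (memLp_component hG j)).integrable_sq
  rw [← integral_add (hi 0) (hi 1)]
  refine integral_congr_ae (Filter.Eventually.of_forall fun x => ?_)
  simp only [vec_norm_sq, PiLp.sub_apply, grad_partialSum n f h]

/-- The energy flux of a divergence free velocity field vanishes: `∫ f w ⋅ ∇f = 0`. Summability of
the Fourier coefficients is used because `w` is only square integrable: the truncations of `f` have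
to converge uniformly. -/
theorem integral_mul_inner_grad_eq_zero {f : L2 L} {G : Torus L → Vec} (h : HasWeakGrad L f G)
    (hG : MemLp G 2 volume) (hs : Summable fun k => ‖fourierCoefficient L f k‖) {w : L2Vec L}
    (hw : ∀ ψ : Torus L → ℝ, SmoothOnTorus L ψ → ∫ x, inner ℝ (w x) (grad L ψ x) = 0) :
    ∫ x, f x * inner ℝ (w x) (G x) = 0 := by
  obtain ⟨e, he, hUe⟩ := partialSum_sub_le f.integrable hs
  have hcg := continuous_grad_partialSum (L := L)
  have hd : ∀ n, MemLp (fun x => grad L (partialSum L n f) x - G x) 2 volume := fun n =>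
    (memLp_of_continuous (hcg n f)).sub hG
  have hinner : ∀ {H : Torus L → Vec}, MemLp H 2 volume →
      Integrable (fun x => inner ℝ (w x) (H x)) volume := fun {H} hH => by
    refine (L2.integrable_inner (𝕜 := ℝ) w hH.toLp).congr ?_
    filter_upwards [hH.coeFn_toLp] with x hx
    rw [hx]
  have hlim : Filter.Tendsto (fun n => ∫ x, |inner ℝ (w x) (grad L (partialSum L n f) x) -
      inner ℝ (w x) (G x)|) Filter.atTop (nhds 0) := by
    have h1 := (Real.continuous_sqrt.tendsto 0).comp (tendsto_integral_grad_partialSum h hG)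
    rw [Real.sqrt_zero] at h1
    have h2 := h1.const_mul (Real.sqrt (∫ x, ‖w x‖ ^ 2))
    rw [mul_zero] at h2
    refine squeeze_zero (fun n => integral_nonneg fun x => abs_nonneg _) (fun n => ?_) h2
    refine le_trans ?_ (integral_mul_le_sqrt_mul_sqrt (Lp.memLp w).norm (hd n).norm)
    refine integral_mono ((hinner (memLp_of_continuous (hcg n f))).sub (hinner hG)).abs
      ((Lp.memLp w).norm.integrable_mul (hd n).norm) fun x => ?_
    simp only [← inner_sub_right]
    exact abs_real_inner_le_norm _ _
  have key := tendsto_integral_mul (fun n => (continuous_partialSum n f).aestronglyMeasurable)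
    f.integrable.aestronglyMeasurable (abs_le_tsum_of_summable f.integrable hs) he hUe
    (fun n => hinner (memLp_of_continuous (hcg n f))) (hinner hG) hlim
  refine tendsto_nhds_unique key (tendsto_const_nhds.congr fun n => ?_)
  -- The gradient of the smooth function `(partialSum L n f)²` is orthogonal to `w`.
  have hsm : SmoothOnTorus L (partialSum L n f) := smoothOnTorus_trigPoly _ _
  have h3 := hw (fun x => partialSum L n f x ^ 2) (ContDiff.pow hsm 2)
  have h4 : ∀ x, grad L (fun x => partialSum L n f x ^ 2) x =
      (2 * partialSum L n f x) • grad L (partialSum L n f) x := by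
    intro x
    ext j
    simp only [grad, PiLp.smul_apply, smul_eq_mul]
    have h5 := hsm.smoothFamily.hasDerivAt_single 0 j x 0
    have h6 := (h5.pow 2).deriv
    simp only [QuotientAddGroup.mk_zero, Pi.single_zero, add_zero] at h6
    rw [pd]
    refine (Eq.trans ?_ h6).trans ?_
    · rfl
    · norm_num
  simp only [h4, inner_smul_right, mul_assoc, integral_const_mul] at h3
  linarith

theorem tendsto_integral_abs_mul_norm_grad_sq {f : L2 L} {G : Torus L → Vec}
    (h : HasWeakGrad L f G) (hG : MemLp G 2 volume)
    (hs : Summable fun k => ‖fourierCoefficient L f k‖) :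
    Filter.Tendsto (fun n => ∫ x, |partialSum L n f x| * ‖grad L (partialSum L n f) x‖ ^ 2)
      Filter.atTop (nhds (∫ x, |f x| * ‖G x‖ ^ 2)) := by
  obtain ⟨e, he, hUe⟩ := partialSum_sub_le f.integrable hs
  have hcg := continuous_grad_partialSum (L := L)
  have hd : ∀ n, MemLp (fun x => grad L (partialSum L n f) x - G x) 2 volume := fun n =>
    (memLp_of_continuous (hcg n f)).sub hG
  have hlim : Filter.Tendsto (fun n => ∫ x, |‖grad L (partialSum L n f) x‖ ^ 2 - ‖G x‖ ^ 2|)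
      Filter.atTop (nhds 0) := by
    have h0 := tendsto_integral_grad_partialSum h hG
    have h1 := (Real.continuous_sqrt.tendsto 0).comp h0
    rw [Real.sqrt_zero] at h1
    have h2 := h0.add ((h1.const_mul (Real.sqrt (∫ x, ‖G x‖ ^ 2))).const_mul 2)
    simp only [mul_zero, add_zero] at h2
    refine squeeze_zero (fun n => integral_nonneg fun x => abs_nonneg _) (fun n => ?_) h2
    have i1 : Integrable (fun x => ‖G x‖ * ‖grad L (partialSum L n f) x - G x‖) volume :=
      hG.norm.integrable_mul (hd n).norm
    refine le_trans ?_ (add_le_add le_rfl (mul_le_mul_of_nonneg_left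
      (integral_mul_le_sqrt_mul_sqrt hG.norm (hd n).norm) zero_le_two))
    rw [← integral_const_mul, ← integral_add (hd n).norm.integrable_sq (i1.const_mul 2)]
    refine integral_mono ((memLp_of_continuous (hcg n f)).norm.integrable_sq.sub
      hG.norm.integrable_sq).abs ((hd n).norm.integrable_sq.add (i1.const_mul 2)) fun x => ?_
    simp only
    have h3 := abs_norm_sub_norm_le (grad L (partialSum L n f) x) (G x)
    set p := ‖grad L (partialSum L n f) x‖
    set q := ‖G x‖
    set r := ‖grad L (partialSum L n f) x - G x‖
    have hp : 0 ≤ p := norm_nonneg _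
    have hq : 0 ≤ q := norm_nonneg _
    have hr : 0 ≤ r := norm_nonneg _
    rw [abs_le] at h3 ⊢
    constructor <;> nlinarith
  refine tendsto_integral_mul (fun n => (continuous_partialSum n f).abs.aestronglyMeasurable)
    f.integrable.aestronglyMeasurable.norm
    (by simpa using abs_le_tsum_of_summable f.integrable hs) he
    (fun n => ?_) (fun n => (memLp_of_continuous (hcg n f)).norm.integrable_sq)
    hG.norm.integrable_sq hlim
  filter_upwards [hUe n] with x hx
  exact (abs_abs_sub_abs_le _ _).trans hx

end

section
variable {L : Fin 2 → ℝ} [∀ j, Fact (0 < L j)]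

/-! ### Consequences of `H²` regularity at a fixed time -/

/-- The mean of `|∇f|²` over the torus. -/
noncomputable def gradEnergy (L : Fin 2 → ℝ) [∀ j, Fact (0 < L j)] (f : L2 L) : ℝ :=
  (area L)⁻¹ * ∫ x, ‖weakGrad L f x‖ ^ 2

/-- The sum `∑ |k̃|⁴ |fₖ|²`, which is the mean of `|Δf|²` over the torus if it converges. -/
noncomputable def lapEnergy (L : Fin 2 → ℝ) [∀ j, Fact (0 < L j)] (f : L2 L) : ℝ :=
  ∑' k, freqSq L k ^ 2 * ‖fourierCoefficient L f k‖ ^ 2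

/-- The sum over all frequencies of `1 / (1 + |k̃|⁴)`. -/
noncomputable def weightSum (L : Fin 2 → ℝ) : ℝ := ∑' k, (weight L k)⁻¹

theorem gradEnergy_nonneg (f : L2 L) : 0 ≤ gradEnergy L f :=
  mul_nonneg (inv_nonneg.2 (area_pos L).le) (integral_nonneg fun _ => by positivity)

theorem weightSum_nonneg (L : Fin 2 → ℝ) : 0 ≤ weightSum L :=
  tsum_nonneg fun k => (inv_pos.2 (weight_pos k)).le

/-- The embedding of `H²` into the functions with absolutely summable Fourier series. -/
theorem sum_mul_norm_le_weightSum {b : (Fin 2 → ℤ) → ℂ} {m d : ℝ}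
    (hm : ∀ F : Finset (Fin 2 → ℤ), ∑ k ∈ F, ‖b k‖ ^ 2 ≤ m)
    (hd : ∀ F : Finset (Fin 2 → ℤ), ∑ k ∈ F, freqSq L k ^ 2 * ‖b k‖ ^ 2 ≤ d)
    {x : ℝ} (hx : 0 ≤ x) (F : Finset (Fin 2 → ℤ)) :
    ∑ k ∈ F, x * ‖b k‖ ≤ m + d + x ^ 2 * weightSum L / 4 := by
  have h := sum_mul_norm_le (F₀ := ∅) (fun F _ => (summable_inv_weight (L := L)).sum_le_tsum F
    fun k _ => (inv_pos.2 (weight_pos k)).le) hm hx one_pos F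
  simp only [Finset.card_empty, Nat.cast_zero, zero_mul, mul_zero, add_zero, one_mul,
    mul_one] at h
  have := hd F
  rw [weightSum]
  linarith

theorem summable_norm_of_sum_le {b : (Fin 2 → ℤ) → ℂ} {m d : ℝ}
    (hm : ∀ F : Finset (Fin 2 → ℤ), ∑ k ∈ F, ‖b k‖ ^ 2 ≤ m)
    (hd : ∀ F : Finset (Fin 2 → ℤ), ∑ k ∈ F, freqSq L k ^ 2 * ‖b k‖ ^ 2 ≤ d) :
    Summable fun k => ‖b k‖ :=
  summable_of_sum_le (fun k => norm_nonneg _) fun F => by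
    simpa using sum_mul_norm_le_weightSum hm hd zero_le_one F

theorem sum_norm_mul_conj_le {ι : Type*} {a b : ι → ℂ} {A B : ℝ} {F : Finset ι}
    (hA : ∑ k ∈ F, ‖a k‖ ^ 2 ≤ A) (hB : ∑ k ∈ F, ‖b k‖ ^ 2 ≤ B) :
    ∑ k ∈ F, ‖a k * conj (b k)‖ ≤ (A + B) / 2 := by
  have h : ∑ k ∈ F, ‖a k * conj (b k)‖ ≤ ∑ k ∈ F, (‖a k‖ ^ 2 + ‖b k‖ ^ 2) / 2 := by
    refine Finset.sum_le_sum fun k _ => ?_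
    rw [norm_mul, RCLike.norm_conj]
    linarith [two_mul_le_add_sq ‖a k‖ ‖b k‖]
  rw [← Finset.sum_div, Finset.sum_add_distrib] at h
  linarith

/-- The regularity of the values `w` of the velocity and `f` of a mild solution at almost every
time: `f` is bounded by `m` in `L²` and belongs to `H²`, the velocity is divergence free and
bounded, with `K` a bound for its contribution to the nonlinearity. -/
structure IsRegularAt (L : Fin 2 → ℝ) [∀ j, Fact (0 < L j)] (w : L2Vec L) (f : L2 L)
    (m K : ℝ) : Prop where
  hasWeakGrad : HasWeakGrad L f (weakGrad L f)
  memLp_grad : MemLp (weakGrad L f) 2 volume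
  summable_lap : Summable fun k => freqSq L k ^ 2 * ‖fourierCoefficient L f k‖ ^ 2
  sum_le : ∀ F : Finset (Fin 2 → ℤ), ∑ k ∈ F, ‖fourierCoefficient L f k‖ ^ 2 ≤ m
  velocity_le : (area L)⁻¹ * (‖w‖ ^ 2 / 2) ≤ K
  divFree : ∀ ψ : Torus L → ℝ, SmoothOnTorus L ψ → ∫ x, inner ℝ (w x) (grad L ψ x) = 0

namespace IsRegularAt

variable {w : L2Vec L} {f : L2 L} {m K : ℝ}

theorem hasSum_grad (h : IsRegularAt L w f m K) :
    HasSum (fun k => freqSq L k * ‖fourierCoefficient L f k‖ ^ 2) (gradEnergy L f) :=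
  hasSum_freqSq_mul_of_hasWeakGrad h.hasWeakGrad h.memLp_grad

theorem sum_lap_le (h : IsRegularAt L w f m K) (F : Finset (Fin 2 → ℤ)) :
    ∑ k ∈ F, freqSq L k ^ 2 * ‖fourierCoefficient L f k‖ ^ 2 ≤ lapEnergy L f :=
  h.summable_lap.sum_le_tsum F fun _ _ => by positivity

theorem K_nonneg (h : IsRegularAt L w f m K) : 0 ≤ K :=
  (mul_nonneg (inv_nonneg.2 (area_pos L).le) (by positivity)).trans h.velocity_le

theorem norm_nonlinearity_le (h : IsRegularAt L w f m K) (k : Fin 2 → ℤ) :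
    ‖fourierCoefficient L (nonlinearity L w f) k‖ ≤ gradEnergy L f + K :=
  (norm_fourierCoefficient_nonlinearity_le w h.memLp_grad k).trans
    (add_le_add le_rfl h.velocity_le)

theorem norm_gradSq_le (h : IsRegularAt L w f m K) (k : Fin 2 → ℤ) :
    ‖fourierCoefficient L (fun x => ‖weakGrad L f x‖ ^ 2) k‖ ≤ gradEnergy L f + K := by
  refine (norm_fourierCoefficient_le _ k).trans ?_
  simp only [abs_of_nonneg (sq_nonneg ‖weakGrad L f _‖)]
  exact le_add_of_nonneg_right h.K_nonneg

theorem sq_le (h : IsRegularAt L w f m K) :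
    (gradEnergy L f + K) ^ 2 ≤ 2 * (m * lapEnergy L f) + 2 * K ^ 2 := by
  have h1 := sq_le_mul_of_hasSum h.sum_le h.hasSum_grad h.summable_lap
  rw [← lapEnergy] at h1
  nlinarith [sq_nonneg (gradEnergy L f - K)]

/-- The pairing of a function which is only known to have the Fourier coefficients of size
`‖∇f‖² + K` of the nonlinearity with an element of `H²` converges absolutely. The bound is
integrable in time, since it is affine in `‖Δf‖²`. -/
theorem sum_norm_mul_le (h : IsRegularAt L w f m K) {c b : (Fin 2 → ℤ) → ℂ} {m' d : ℝ}
    (hc : ∀ k, ‖c k‖ ≤ gradEnergy L f + K)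
    (hm : ∀ F : Finset (Fin 2 → ℤ), ∑ k ∈ F, ‖b k‖ ^ 2 ≤ m')
    (hd : ∀ F : Finset (Fin 2 → ℤ), ∑ k ∈ F, freqSq L k ^ 2 * ‖b k‖ ^ 2 ≤ d)
    (F : Finset (Fin 2 → ℤ)) :
    ∑ k ∈ F, ‖c k * conj (b k)‖ ≤
      m' + d + (2 * (m * lapEnergy L f) + 2 * K ^ 2) * weightSum L / 4 := by
  have h1 := sum_mul_norm_le_weightSum hm hd (add_nonneg (gradEnergy_nonneg f) h.K_nonneg) F
  have h2 : ∑ k ∈ F, ‖c k * conj (b k)‖ ≤ ∑ k ∈ F, (gradEnergy L f + K) * ‖b k‖ := by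
    refine Finset.sum_le_sum fun k _ => ?_
    rw [norm_mul, RCLike.norm_conj]
    exact mul_le_mul_of_nonneg_right (hc k) (norm_nonneg _)
  have h3 := mul_le_mul_of_nonneg_right h.sq_le (weightSum_nonneg L)
  linarith

theorem summable_norm (h : IsRegularAt L w f m K) :
    Summable fun k => ‖fourierCoefficient L f k‖ :=
  summable_norm_of_sum_le h.sum_le h.sum_lap_le

theorem lapEnergy_eq (h : IsRegularAt L w f m K) :
    lapEnergy L f = (area L)⁻¹ * ∫ x, weakLap L f x ^ 2 := by
  obtain ⟨h1, h2⟩ := weakLap_spec h.summable_lap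
  rw [← (hasSum_norm_fourierCoefficient_sq h1).tsum_eq, lapEnergy]
  refine tsum_congr fun k => ?_
  rw [h2, norm_mul, mul_pow, norm_neg, Complex.norm_real, Real.norm_eq_abs, sq_abs]

theorem integral_mul_advection_eq_zero (h : IsRegularAt L w f m K) :
    ∫ x, f x * inner ℝ (w x) (weakGrad L f x) = 0 :=
  integral_mul_inner_grad_eq_zero h.hasWeakGrad h.memLp_grad h.summable_norm h.divFree

theorem integrable_mul_gradSq (h : IsRegularAt L w f m K) :
    Integrable (fun x => f x * ‖weakGrad L f x‖ ^ 2) volume :=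
  h.memLp_grad.norm.integrable_sq.bdd_mul f.integrable.aestronglyMeasurable
    (by simpa using abs_le_tsum_of_summable f.integrable h.summable_norm)

theorem integral_mul_nonlinearity (h : IsRegularAt L w f m K) :
    ∫ x, nonlinearity L w f x * f x = (1 / 2) * ∫ x, f x * ‖weakGrad L f x‖ ^ 2 := by
  have h1 : Integrable (fun x => f x * inner ℝ (w x) (weakGrad L f x)) volume :=
    (integrable_inner_weakGrad w h.memLp_grad).bdd_mul f.integrable.aestronglyMeasurable
      (by simpa using abs_le_tsum_of_summable f.integrable h.summable_norm)
  have h2 : ∀ x, nonlinearity L w f x * f x = (1 / 2) * (f x * ‖weakGrad L f x‖ ^ 2) +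
      f x * inner ℝ (w x) (weakGrad L f x) := fun x => by rw [nonlinearity]; ring
  simp only [h2]
  rw [integral_add (h.integrable_mul_gradSq.const_mul _) h1, integral_const_mul,
    h.integral_mul_advection_eq_zero, add_zero]

theorem integral_abs_mul_gradSq_le (h : IsRegularAt L w f m K) :
    ∫ x, |f x| * ‖weakGrad L f x‖ ^ 2 ≤ area L * (m + lapEnergy L f +
      (2 * (m * lapEnergy L f) + 2 * K ^ 2) * weightSum L / 4) := by
  have hA := area_pos L
  set W := ∑' k, ‖fourierCoefficient L f k‖
  have hab : Integrable (fun x => |f x| * ‖weakGrad L f x‖ ^ 2) volume :=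
    h.integrable_mul_gradSq.abs.congr (Filter.Eventually.of_forall fun x => by
      simp [abs_mul])
  have h1 : ∫ x, |f x| * ‖weakGrad L f x‖ ^ 2 ≤ W * ∫ x, ‖weakGrad L f x‖ ^ 2 := by
    rw [← integral_const_mul]
    refine integral_mono_ae hab (h.memLp_grad.norm.integrable_sq.const_mul W) ?_
    filter_upwards [abs_le_tsum_of_summable f.integrable h.summable_norm] with x hx
    exact mul_le_mul_of_nonneg_right hx (by positivity)
  have h2 : ∫ x, ‖weakGrad L f x‖ ^ 2 = area L * gradEnergy L f := by
    rw [gradEnergy, mul_inv_cancel_left₀ hA.ne']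
  have hW : 0 ≤ W := tsum_nonneg fun _ => norm_nonneg _
  have h3 : (gradEnergy L f + K) * W ≤ m + lapEnergy L f +
      (2 * (m * lapEnergy L f) + 2 * K ^ 2) * weightSum L / 4 := by
    refine le_of_tendsto (h.summable_norm.hasSum.mul_left (gradEnergy L f + K))
      (Filter.Eventually.of_forall fun F => ?_)
    have h4 := sum_mul_norm_le_weightSum h.sum_le h.sum_lap_le
      (add_nonneg (gradEnergy_nonneg f) h.K_nonneg) F
    have h5 := mul_le_mul_of_nonneg_right h.sq_le (weightSum_nonneg L)
    linarith
  rw [h2] at h1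
  nlinarith [mul_nonneg (mul_nonneg hA.le h.K_nonneg) hW, mul_le_mul_of_nonneg_left h3 hA.le]

theorem hasSum_grad_mul (h : IsRegularAt L w f m K) {ψ : ℝ → Torus L → ℝ}
    (hψ : SmoothFamily L ψ) (t : ℝ) :
    HasSum (fun k => freqSq L k * fourierCoefficient L f k * conj (fourierCoefficient L (ψ t) k))
      (((area L)⁻¹ * ∫ x, inner ℝ (weakGrad L f x) (grad L (ψ t) x) : ℝ) : ℂ) := by
  have hc : ∀ j, MemLp (pd L j (ψ t)) 2 volume := fun j =>
    memLp_of_continuous ((hψ.pd_family j).continuous_apply t)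
  have h1 := fun j => hasSum_fourierCoefficient_mul_conj (memLp_component h.memLp_grad j) (hc j)
  have hi : ∀ j, Integrable (fun x => weakGrad L f x j * pd L j (ψ t) x) volume := fun j =>
    (memLp_component h.memLp_grad j).integrable_mul (hc j)
  have h2 := (h1 0).add (h1 1)
  rw [← Complex.ofReal_add, ← mul_add, ← integral_add (hi 0) (hi 1)] at h2
  simp only [vec_inner, grad]
  refine h2.congr_fun fun k => ?_
  rw [h.hasWeakGrad.fourierCoefficient, h.hasWeakGrad.fourierCoefficient,
    hψ.fourierCoefficient_pd, hψ.fourierCoefficient_pd, freqSq_eq, Fin.sum_univ_two]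
  simp only [map_mul, Complex.conj_I, Complex.conj_ofReal]
  push_cast
  linear_combination ((freq L 0 k : ℂ) ^ 2 + (freq L 1 k : ℂ) ^ 2) * fourierCoefficient L f k *
    conj (fourierCoefficient L (ψ t) k) * Complex.I_sq

end IsRegularAt

theorem SmoothFamily.exists_sum_le {ψ : ℝ → Torus L → ℝ} (hψ : SmoothFamily L ψ) (a b : ℝ) :
    ∃ M, ∀ t ∈ Icc a b, ∀ F : Finset (Fin 2 → ℤ),
      ∑ k ∈ F, ‖fourierCoefficient L (ψ t) k‖ ^ 2 ≤ M := by
  obtain ⟨C, hC0, hC⟩ := hψ.exists_bound a b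
  refine ⟨C ^ 2, fun t ht F => ?_⟩
  have hp := memLp_of_continuous (hψ.continuous_apply t)
  refine (sum_le_hasSum F (fun _ _ => by positivity)
    (hasSum_norm_fourierCoefficient_sq hp)).trans ?_
  rw [inv_mul_le_iff₀ (area_pos L)]
  have : ∫ _ : Torus L, C ^ 2 = area L * C ^ 2 := by simp [measureReal_univ]
  rw [← this]
  refine integral_mono hp.integrable_sq (integrable_const _) fun x => ?_
  exact sq_le_sq' (by linarith [neg_abs_le (ψ t x), hC t ht x])
    (by linarith [le_abs_self (ψ t x), hC t ht x])

theorem SmoothFamily.exists_sum_lap_le {ψ : ℝ → Torus L → ℝ} (hψ : SmoothFamily L ψ) (a b : ℝ) :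
    ∃ M, ∀ t ∈ Icc a b, ∀ F : Finset (Fin 2 → ℤ),
      ∑ k ∈ F, freqSq L k ^ 2 * ‖fourierCoefficient L (ψ t) k‖ ^ 2 ≤ M := by
  obtain ⟨M, hM⟩ := hψ.lap_family.exists_sum_le a b
  refine ⟨M, fun t ht F => ?_⟩
  have := hM t ht F
  simpa only [hψ.fourierCoefficient_lap, norm_mul, mul_pow, norm_neg, Complex.norm_real,
    Real.norm_eq_abs, sq_abs] using this

/-! ### Regularity of mild solutions -/

namespace IsMildSolution

variable {v : ℝ → L2Vec L} {T : ℝ} {φ₀ : L2 L} {φ : ℝ → L2 L}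

/-- Mild solutions in the class `sup t^{1/4} ‖∇φ(t)‖ < ∞` belong to `L²(0, T; H²)`. -/
theorem exists_isRegularAt (hφ : IsMildSolution L v T φ₀ φ) (hX : HasGradBound L T φ)
    (hv : MemLp v ⊤ (volume.restrict (Ioi (0 : ℝ)))) (hdiv : IsDivFree L v) (hT : 0 < T) :
    (∃ m K, ∀ᵐ t ∂(volume.restrict (Ioc 0 T)), IsRegularAt L (v t) (φ t) m K) ∧
      IntegrableOn (fun t => lapEnergy L (φ t)) (Ioc 0 T) ∧
      IntegrableOn (fun t => gradEnergy L (φ t)) (Ioc 0 T) := by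
  obtain ⟨C, hC0, hC⟩ := hX.spec
  obtain ⟨m, hm0, hm⟩ := hφ.exists_sum_le
  obtain ⟨V, hV⟩ := exists_norm_le_of_memLp_top hv T
  have hA := inv_pos.2 (area_pos L)
  set K := (area L)⁻¹ * (V ^ 2 / 2) with hK
  have hK0 : 0 ≤ K := by positivity
  have hVK : ∀ᵐ t ∂(volume.restrict (Ioc 0 T)), (area L)⁻¹ * (‖v t‖ ^ 2 / 2) ≤ K := by
    filter_upwards [hV] with t ht
    have := pow_le_pow_left₀ (norm_nonneg _) ht 2
    exact mul_le_mul_of_nonneg_left (by linarith) hA.le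
  have hg : ∀ t ∈ Ioc 0 T, HasSum (fun k => freqSq L k * ‖fourierCoefficient L (φ t) k‖ ^ 2)
      (gradEnergy L (φ t)) := fun t ht =>
    hasSum_freqSq_mul_of_hasWeakGrad (hC t ht).1 (hC t ht).2.1
  have hcont := hφ.continuousOn_fourierCoefficient
  obtain ⟨h1, h2⟩ := mode_regularity hT hK0 hC0
    (u := fun k t => fourierCoefficient L (φ t) k)
    (N := fun k t => fourierCoefficient L (nonlinearity L (v t) (φ t)) k)
    (g := fun t => gradEnergy L (φ t)) hcont
    (hφ.intervalIntegrable_fourierCoefficient_nonlinearity hX hT.le)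
    (fun k => (hφ.fourierCoefficient_eq_integral hX hT.le k).2)
    (fun t ht => (hm t ht).2) hg (fun t ht => (hC t ht).2.2) (by
      filter_upwards [hVK, ae_restrict_mem measurableSet_Ioc] with t h1 ht k
      exact (norm_fourierCoefficient_nonlinearity_le _ (hC t ht).2.1 k).trans
        (add_le_add le_rfl h1))
  refine ⟨⟨m, K, ?_⟩, h2, ?_⟩
  · filter_upwards [h1, hVK, ae_restrict_mem measurableSet_Ioc,
      ae_restrict_of_ae_restrict_of_subset Ioc_subset_Ioi_self hdiv] with t a1 a2 ht a3
    exact ⟨(hC t ht).1, (hC t ht).2.1, a1, (hm t ⟨ht.1.le, ht.2⟩).2, a2, a3⟩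
  · have hi : IntegrableOn (fun t : ℝ => C * t ^ (-(1 / 2) : ℝ)) (Ioc 0 T) := by
      rw [← intervalIntegrable_iff_integrableOn_Ioc_of_le hT.le]
      exact (intervalIntegral.intervalIntegrable_rpow' (by norm_num)).const_mul C
    refine hi.mono' ?_ ?_
    · refine aestronglyMeasurable_of_tendsto_ae (Filter.atTop : Filter (Finset (Fin 2 → ℤ)))
        (f := fun F t => ∑ k ∈ F, freqSq L k * ‖fourierCoefficient L (φ t) k‖ ^ 2)
        (fun F => ?_) ?_
      · refine ContinuousOn.aestronglyMeasurable ?_ measurableSet_Ioc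
        exact continuousOn_finsetSum F fun k _ => continuousOn_const.mul
          (((hcont k).mono Ioc_subset_Icc_self).norm.pow 2)
      · filter_upwards [ae_restrict_mem measurableSet_Ioc] with t ht
        exact hg t ht
    · filter_upwards [ae_restrict_mem measurableSet_Ioc] with t ht
      rw [Real.norm_of_nonneg (gradEnergy_nonneg _)]
      exact (hC t ht).2.2

theorem aestronglyMeasurable_fourierCoefficient (hφ : IsMildSolution L v T φ₀ φ)
    (k : Fin 2 → ℤ) :
    AEStronglyMeasurable (fun t => fourierCoefficient L (φ t) k) (volume.restrict (Ioc 0 T)) :=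
  ((hφ.continuousOn_fourierCoefficient k).mono Ioc_subset_Icc_self).aestronglyMeasurable
    measurableSet_Ioc

theorem aestronglyMeasurable_nonlinearity (hφ : IsMildSolution L v T φ₀ φ)
    (hX : HasGradBound L T φ) (hT : 0 ≤ T) (k : Fin 2 → ℤ) :
    AEStronglyMeasurable (fun t => fourierCoefficient L (nonlinearity L (v t) (φ t)) k)
      (volume.restrict (Ioc 0 T)) :=
  ((intervalIntegrable_iff_integrableOn_Ioc_of_le hT).1
    (hφ.intervalIntegrable_fourierCoefficient_nonlinearity hX hT k)).aestronglyMeasurable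

/-- The Fourier coefficients of `|∇φ|²` are measurable in time: they are multiples of those of the
integrand of the Duhamel formula for the time `T`. -/
theorem aestronglyMeasurable_gradSq (hφ : IsMildSolution L v T φ₀ φ) (hT : 0 ≤ T)
    (k : Fin 2 → ℤ) :
    AEStronglyMeasurable (fun t => fourierCoefficient L (fun x => ‖weakGrad L (φ t) x‖ ^ 2) k)
      (volume.restrict (Ioc 0 T)) := by
  have h1 := ((intervalIntegrable_iff_integrableOn_Ioc_of_le hT).1
    (hφ.integrable_nonlinear T ⟨hT, le_rfl⟩)).aestronglyMeasurable
  have h2 := (coeffCLM L k).continuous.comp_aestronglyMeasurable h1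
  have h3 : AEStronglyMeasurable (fun t : ℝ => (Real.exp ((T - t) * symbol L k) : ℂ))
      (volume.restrict (Ioc 0 T)) := Continuous.aestronglyMeasurable (by fun_prop)
  refine (h3.mul h2).congr ?_
  have hne : ∀ᵐ t ∂(volume.restrict (Ioc 0 T)), t ≠ T :=
    ae_restrict_of_ae (by simp [ae_iff, measure_singleton])
  filter_upwards [hne, ae_restrict_mem measurableSet_Ioc] with t htT ht
  rw [Pi.mul_apply, coeffCLM_apply, semigroup_spec_of_pos (sub_pos.2 (lt_of_le_of_ne ht.2 htT)),
    ← mul_assoc, ← Complex.ofReal_mul, ← Real.exp_add, neg_mul, add_neg_cancel]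
  simp

/-- Measurability in time follows by approximation of the solution by its truncated Fourier
series, which are continuous in time and space. -/
theorem aestronglyMeasurable_integral_abs_mul (hφ : IsMildSolution L v T φ₀ φ)
    {m K : ℝ} (hreg : ∀ᵐ t ∂(volume.restrict (Ioc 0 T)), IsRegularAt L (v t) (φ t) m K) :
    AEStronglyMeasurable (fun t => ∫ x, |φ t x| * ‖weakGrad L (φ t) x‖ ^ 2)
      (volume.restrict (Ioc 0 T)) := by
  refine aestronglyMeasurable_of_tendsto_ae Filter.atTop
    (f := fun n t => ∫ x, |partialSum L n (φ t) x| * ‖grad L (partialSum L n (φ t)) x‖ ^ 2)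
    (fun n => ?_) ?_
  · refine ContinuousOn.aestronglyMeasurable ?_ measurableSet_Ioc
    refine ContinuousOn.mono ?_ Ioc_subset_Icc_self
    rw [continuousOn_iff_continuous_domRestrict]
    have hc : ∀ k, Continuous fun t : Icc 0 T => fourierCoefficient L (φ t) k := fun k =>
      continuousOn_iff_continuous_domRestrict.1 (hφ.continuousOn_fourierCoefficient k)
    have h1 : Continuous (Function.uncurry fun (t : Icc 0 T) (x : Torus L) =>
        |partialSum L n (φ t) x| * ‖grad L (partialSum L n (φ t)) x‖ ^ 2) := by
      simp only [vec_norm_sq, grad, partialSum, pd_trigPoly, Function.uncurry_def]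
      have hd : ∀ j, Continuous fun p : Icc 0 T × Torus L => trigPoly L (freqBox n)
          (fun k => Complex.I * freq L j k * fourierCoefficient L (φ p.1) k) p.2 := fun j =>
        continuous_uncurry_trigPoly _ fun k => continuous_const.mul (hc k)
      exact (continuous_uncurry_trigPoly _ hc).abs.mul (((hd 0).pow 2).add ((hd 1).pow 2))
    have h2 := continuous_parametric_integral_of_continuous (μ := (volume : Measure (Torus L)))
      h1 isCompact_univ
    simp only [setIntegral_univ] at h2
    exact h2
  · filter_upwards [hreg] with t ht
    exact tendsto_integral_abs_mul_norm_grad_sq ht.hasWeakGrad ht.memLp_grad ht.summable_norm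

end IsMildSolution

end

/-! ### Integration in time -/

/-- Integration by parts in time of an absolutely continuous function `u` against a continuously
differentiable function `θ`. -/
theorem integral_mul_add_mul_deriv {u f θ θ' : ℝ → ℂ} {T : ℝ} (hT : 0 ≤ T)
    (hf : IntervalIntegrable f volume 0 T)
    (hu : ∀ t ∈ Icc 0 T, u t = u 0 + ∫ s in (0 : ℝ)..t, f s)
    (hθ : ∀ t, HasDerivAt θ (θ' t) t) (hθ' : Continuous θ') :
    ∫ s in Ioc 0 T, (f s * θ s + u s * θ' s) = u T * θ T - u 0 * θ 0 := by
  have h := (mul_eq_integral_of_primitive hT hf (hθ'.intervalIntegrable 0 T) hu (fun t _ => by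
    rw [intervalIntegral.integral_eq_sub_of_hasDerivAt (fun x _ => hθ x)
      (hθ'.intervalIntegrable 0 t)]
    ring)).2 T ⟨hT, le_rfl⟩
  rw [← intervalIntegral.integral_of_le hT, h]
  ring

theorem integral_sub_sub {α E : Type*} [MeasurableSpace α] [NormedAddCommGroup E]
    [NormedSpace ℝ E] {μ : Measure α} {f g h : α → E} (hf : Integrable f μ) (hg : Integrable g μ)
    (hh : Integrable h μ) :
    ∫ t, (f t - g t - h t) ∂μ = ∫ t, f t ∂μ - ∫ t, g t ∂μ - ∫ t, h t ∂μ := by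
  have hfg : Integrable (fun t => f t - g t) μ := hf.sub hg
  rw [integral_sub hfg hh, integral_sub hf hg]

section
variable {L : Fin 2 → ℝ}

theorem lintegral_sobolevNormSq_lt_top {α : Type*} [MeasurableSpace α] {μ : Measure α}
    {a : α → (Fin 2 → ℤ) → ℂ} {s : ℝ} {B : α → ℝ} (hB : Integrable B μ)
    (hle : ∀ᵐ t ∂μ, ∀ F : Finset (Fin 2 → ℤ),
      ∑ k ∈ F, (1 + freqSq L k) ^ s * ‖a t k‖ ^ 2 ≤ B t) :
    ∫⁻ t, sobolevNormSq L s (a t) ∂μ < ⊤ := by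
  refine (lintegral_mono_ae ?_).trans_lt hB.lintegral_lt_top
  filter_upwards [hle] with t ht
  refine ENNReal.summable.tsum_le_of_sum_le fun F => ?_
  rw [← ENNReal.ofReal_sum_of_nonneg fun k _ => mul_nonneg
    (Real.rpow_nonneg (by linarith [freqSq_nonneg (L := L) k]) _) (sq_nonneg _)]
  exact ENNReal.ofReal_le_ofReal (ht F)

theorem one_add_freqSq_rpow_two_le (k : Fin 2 → ℤ) :
    (1 + freqSq L k) ^ (2 : ℝ) ≤ 2 + 2 * freqSq L k ^ 2 := by
  rw [Real.rpow_two]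
  nlinarith [sq_nonneg (freqSq L k - 1)]

theorem one_add_freqSq_rpow_neg_two (k : Fin 2 → ℤ) :
    (1 + freqSq L k) ^ (-2 : ℝ) = ((1 + freqSq L k) ^ 2)⁻¹ := by
  rw [Real.rpow_neg (by linarith [freqSq_nonneg (L := L) k]), Real.rpow_two]

variable [∀ j, Fact (0 < L j)]

/-- Integration in time of Parseval's identity. -/
theorem hasSum_integral_mul_conj {α : Type*} [MeasurableSpace α] {μ : Measure α}
    {p q : (Fin 2 → ℤ) → α → ℂ} {R B : α → ℝ} (hp : ∀ k, AEStronglyMeasurable (p k) μ)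
    (hq : ∀ k, AEStronglyMeasurable (q k) μ)
    (hR : ∀ᵐ t ∂μ, HasSum (fun k => p k t * conj (q k t)) (((area L)⁻¹ * R t : ℝ) : ℂ))
    (hB : Integrable B μ)
    (hle : ∀ᵐ t ∂μ, ∀ F : Finset (Fin 2 → ℤ), ∑ k ∈ F, ‖p k t * conj (q k t)‖ ≤ B t) :
    Integrable R μ ∧ (∀ k, Integrable (fun t => p k t * conj (q k t)) μ) ∧
      HasSum (fun k => ∫ t, p k t * conj (q k t) ∂μ) (((area L)⁻¹ * ∫ t, R t ∂μ : ℝ) : ℂ) := by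
  obtain ⟨h1, h2, h3⟩ := hasSum_integral_of_sum_norm_le (fun k => (hp k).mul
    (Complex.continuous_conj.comp_aestronglyMeasurable (hq k))) hR hB hle
  refine ⟨?_, h2, ?_⟩
  · have h4 := (h1.re.const_mul (area L))
    refine h4.congr (Filter.Eventually.of_forall fun t => ?_)
    simp [mul_inv_cancel_left₀ (area_pos L).ne']
  · rwa [integral_complex_ofReal, integral_const_mul] at h3

namespace IsRegularAt

variable {w : L2Vec L} {f : L2 L} {m K : ℝ}

theorem sum_sobolev_two_le (h : IsRegularAt L w f m K) (F : Finset (Fin 2 → ℤ)) :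
    ∑ k ∈ F, (1 + freqSq L k) ^ (2 : ℝ) * ‖fourierCoefficient L f k‖ ^ 2 ≤
      2 * m + 2 * lapEnergy L f := by
  have h1 : ∑ k ∈ F, (1 + freqSq L k) ^ (2 : ℝ) * ‖fourierCoefficient L f k‖ ^ 2 ≤
      ∑ k ∈ F, (2 * ‖fourierCoefficient L f k‖ ^ 2 +
        2 * (freqSq L k ^ 2 * ‖fourierCoefficient L f k‖ ^ 2)) := by
    refine Finset.sum_le_sum fun k _ => ?_
    have := mul_le_mul_of_nonneg_right (one_add_freqSq_rpow_two_le (L := L) k)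
      (sq_nonneg ‖fourierCoefficient L f k‖)
    linarith
  rw [Finset.sum_add_distrib, ← Finset.mul_sum, ← Finset.mul_sum] at h1
  linarith [h.sum_le F, h.sum_lap_le F]

/-- The bound in `H⁻²` for the right-hand side of the equation. -/
theorem sum_sobolev_neg_two_le (h : IsRegularAt L w f m K) (F : Finset (Fin 2 → ℤ)) :
    ∑ k ∈ F, (1 + freqSq L k) ^ (-2 : ℝ) * ‖-(symbol L k : ℂ) * fourierCoefficient L f k -
      fourierCoefficient L (nonlinearity L w f) k‖ ^ 2 ≤
      2 * lapEnergy L f + 2 * ((2 * (m * lapEnergy L f) + 2 * K ^ 2) * weightSum L) := by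
  have h0 : ∑ k ∈ F, (1 + freqSq L k) ^ (-2 : ℝ) * ‖-(symbol L k : ℂ) * fourierCoefficient L f k -
      fourierCoefficient L (nonlinearity L w f) k‖ ^ 2 ≤
      ∑ k ∈ F, (2 * (freqSq L k ^ 2 * ‖fourierCoefficient L f k‖ ^ 2) +
        2 * ((gradEnergy L f + K) ^ 2 * (weight L k)⁻¹)) := by
    refine Finset.sum_le_sum fun k _ => ?_
    have hx := freqSq_nonneg (L := L) k
    set x := freqSq L k with hxdef
    have hpos : 0 < (1 + x) ^ 2 := by positivity
    rw [one_add_freqSq_rpow_neg_two, ← hxdef]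
    set a := ‖fourierCoefficient L f k‖ with ha
    have h1 : ‖-(symbol L k : ℂ) * fourierCoefficient L f k -
        fourierCoefficient L (nonlinearity L w f) k‖ ≤
        |symbol L k| * a + (gradEnergy L f + K) := by
      refine (norm_sub_le _ _).trans (add_le_add (le_of_eq ?_) (h.norm_nonlinearity_le k))
      rw [norm_mul, norm_neg, Complex.norm_real, Real.norm_eq_abs]
    have h2 := pow_le_pow_left₀ (norm_nonneg _) h1 2
    have h3 : (|symbol L k| * a + (gradEnergy L f + K)) ^ 2 ≤
        2 * (symbol L k ^ 2 * a ^ 2) + 2 * (gradEnergy L f + K) ^ 2 := by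
      rw [← sq_abs (symbol L k)]
      nlinarith [sq_nonneg (|symbol L k| * a - (gradEnergy L f + K))]
    have h4 : symbol L k ^ 2 ≤ (1 + x) ^ 2 * x ^ 2 := by
      have : symbol L k ^ 2 = (x - 1) ^ 2 * x ^ 2 := by rw [symbol]; ring
      rw [this]
      exact mul_le_mul_of_nonneg_right (by nlinarith) (sq_nonneg x)
    have h5 : 1 ≤ (1 + x) ^ 2 * (weight L k)⁻¹ := by
      rw [le_mul_inv_iff₀ (weight_pos k), weight]
      nlinarith
    rw [inv_mul_le_iff₀ hpos]
    have h6 := mul_le_mul_of_nonneg_right h4 (sq_nonneg a)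
    have h7 := mul_le_mul_of_nonneg_left h5 (sq_nonneg (gradEnergy L f + K))
    linarith
  rw [Finset.sum_add_distrib, ← Finset.mul_sum, ← Finset.mul_sum, ← Finset.mul_sum] at h0
  have h1 : ∑ k ∈ F, (weight L k)⁻¹ ≤ weightSum L :=
    summable_inv_weight.sum_le_tsum F fun k _ => (inv_pos.2 (weight_pos k)).le
  have h2 := mul_le_mul_of_nonneg_left h1 (sq_nonneg (gradEnergy L f + K))
  have h3 := mul_le_mul_of_nonneg_right h.sq_le (weightSum_nonneg L)
  linarith [h.sum_lap_le F]

end IsRegularAt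

namespace IsMildSolution

variable {v : ℝ → L2Vec L} {T : ℝ} {φ₀ : L2 L} {φ : ℝ → L2 L}

theorem intervalIntegrable_timeDeriv (hφ : IsMildSolution L v T φ₀ φ) (hX : HasGradBound L T φ)
    (hT : 0 ≤ T) (k : Fin 2 → ℤ) :
    IntervalIntegrable (fun s => -(symbol L k : ℂ) * fourierCoefficient L (φ s) k -
      fourierCoefficient L (nonlinearity L (v s) (φ s)) k) volume 0 T := by
  have hu : IntervalIntegrable (fun s => fourierCoefficient L (φ s) k) volume 0 T :=
    ContinuousOn.intervalIntegrable (by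
      rw [uIcc_of_le hT]
      exact hφ.continuousOn_fourierCoefficient k)
  exact (hu.const_mul _).sub (hφ.intervalIntegrable_fourierCoefficient_nonlinearity hX hT k)

theorem timeDerivMemL2Sobolev (hφ : IsMildSolution L v T φ₀ φ) (hX : HasGradBound L T φ)
    (hT : 0 < T) {m K : ℝ}
    (hreg : ∀ᵐ t ∂(volume.restrict (Ioc 0 T)), IsRegularAt L (v t) (φ t) m K)
    (hD : IntegrableOn (fun t => lapEnergy L (φ t)) (Ioc 0 T)) :
    TimeDerivMemL2Sobolev L (-2) T φ := by
  have hmono : volume.restrict (Ioo (0 : ℝ) T) ≤ volume.restrict (Ioc 0 T) :=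
    Measure.restrict_mono Ioo_subset_Ioc_self le_rfl
  have hg := fun k => hφ.intervalIntegrable_timeDeriv hX hT.le k
  have hg' := fun k => (intervalIntegrable_iff_integrableOn_Ioc_of_le hT.le).1 (hg k)
  refine ⟨fun s k => -(symbol L k : ℂ) * fourierCoefficient L (φ s) k -
      fourierCoefficient L (nonlinearity L (v s) (φ s)) k,
    fun k => (hg' k).aestronglyMeasurable.mono_measure hmono, ?_, ?_⟩
  · refine (lintegral_mono' hmono le_rfl).trans_lt (lintegral_sobolevNormSq_lt_top
      (B := fun t => 2 * lapEnergy L (φ t) +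
        2 * ((2 * (m * lapEnergy L (φ t)) + 2 * K ^ 2) * weightSum L)) ?_ ?_)
    · exact (hD.const_mul 2).add
        (((((hD.const_mul m).const_mul 2).add (integrable_const _)).mul_const _).const_mul 2)
    · filter_upwards [hreg] with t ht
      exact ht.sum_sobolev_neg_two_le
  · intro η hη hηc hηs k
    have hη0 : ∀ t, t ∉ Ioo 0 T → η t = 0 := fun t ht =>
      image_eq_zero_of_notMem_tsupport fun h => ht (hηs h)
    have hd : ∀ t, HasDerivAt (fun t => (η t : ℂ)) ((deriv η t : ℝ) : ℂ) t := fun t =>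
      ((hη.differentiable (by simp)) t).hasDerivAt.ofReal_comp
    have hc : Continuous fun t => ((deriv η t : ℝ) : ℂ) :=
      Complex.continuous_ofReal.comp (hη.continuous_deriv (by simp))
    have h := integral_mul_add_mul_deriv hT.le (hg k)
      (hφ.fourierCoefficient_eq_integral hX hT.le k).2 hd hc
    have i1 := ((hg k).mul_continuousOn (g := fun t => (η t : ℂ))
      (Complex.continuous_ofReal.comp hη.continuous).continuousOn)
    have i2 : IntervalIntegrable (fun t => fourierCoefficient L (φ t) k * ((deriv η t : ℝ) : ℂ))
        volume 0 T := ContinuousOn.intervalIntegrable (by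
      rw [uIcc_of_le hT.le]
      exact (hφ.continuousOn_fourierCoefficient k).mul hc.continuousOn)
    rw [integral_add i1.1 i2.1, hη0 0 (by simp), hη0 T (by simp)] at h
    simp only [Complex.ofReal_zero, mul_zero, sub_zero] at h
    rw [← integral_Ioc_eq_integral_Ioo, ← integral_Ioc_eq_integral_Ioo]
    simp only [mul_comm ((_ : ℝ) : ℂ)]
    rw [eq_neg_iff_add_eq_zero, add_comm]
    exact h

end IsMildSolution

end

section
variable {L : Fin 2 → ℝ} [∀ j, Fact (0 < L j)]

namespace IsMildSolution

variable {v : ℝ → L2Vec L} {T : ℝ} {φ₀ : L2 L} {φ : ℝ → L2 L}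

/-! ### The weak formulation -/

/-- The weak formulation for one Fourier mode of the test function. -/
theorem mode_weak_form (hφ : IsMildSolution L v T φ₀ φ) (hX : HasGradBound L T φ) (hT : 0 < T)
    {ψ : ℝ → Torus L → ℝ} (hψ : SmoothFamily L ψ) (hψT : ∀ x, ψ T x = 0) (k : Fin 2 → ℤ) :
    ∫ s in Ioc 0 T, ((-(symbol L k : ℂ) * fourierCoefficient L (φ s) k -
        fourierCoefficient L (nonlinearity L (v s) (φ s)) k) * conj (fourierCoefficient L (ψ s) k) +
      fourierCoefficient L (φ s) k *
        conj (fourierCoefficient L (fun x => deriv (fun r => ψ r x) s) k)) =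
      -(fourierCoefficient L φ₀ k * conj (fourierCoefficient L (ψ 0) k)) := by
  obtain ⟨h0, h1⟩ := hφ.fourierCoefficient_eq_integral hX hT.le k
  have h := integral_mul_add_mul_deriv hT.le (hφ.intervalIntegrable_timeDeriv hX hT.le k) h1
    (θ := fun t => conj (fourierCoefficient L (ψ t) k))
    (θ' := fun t => conj (fourierCoefficient L (fun x => deriv (fun s => ψ s x) t) k))
    (fun t => (hψ.hasDerivAt_fourierCoefficient t k).star)
    (Complex.continuous_conj.comp (hψ.timeDeriv_family.continuous_fourierCoefficient k))
  have hz : fourierCoefficient L (ψ T) k = 0 := by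
    simp [fourierCoefficient, hψT]
  rw [hz, map_zero, mul_zero, zero_sub, h0] at h
  exact h

/-- The weak formulation, by summation over the Fourier modes of the test function. -/
theorem weak_form (hφ : IsMildSolution L v T φ₀ φ) (hX : HasGradBound L T φ)
    (hT : 0 < T) {m K : ℝ}
    (hreg : ∀ᵐ t ∂(volume.restrict (Ioc 0 T)), IsRegularAt L (v t) (φ t) m K)
    (hD : IntegrableOn (fun t => lapEnergy L (φ t)) (Ioc 0 T))
    {ψ : ℝ → Torus L → ℝ} (hψ : SmoothFamily L ψ) (hψT : ∀ x, ψ T x = 0) :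
    (∫ x, φ₀ x * ψ 0 x) + (∫ t in (0 : ℝ)..T, ∫ x, φ t x * deriv (fun s => ψ s x) t)
      = (∫ t in (0 : ℝ)..T, ∫ x, weakLap L (φ t) x * lap L (ψ t) x)
        - (∫ t in (0 : ℝ)..T, ∫ x, inner ℝ (weakGrad L (φ t) x) (grad L (ψ t) x))
        + (1 / 2) * (∫ t in (0 : ℝ)..T, ∫ x, ‖weakGrad L (φ t) x‖ ^ 2 * ψ t x)
        + (∫ t in (0 : ℝ)..T, ∫ x, ψ t x * inner ℝ (v t x) (weakGrad L (φ t) x)) := by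
  obtain ⟨M, hM⟩ := hψ.exists_sum_le 0 T
  obtain ⟨M₁, hM₁⟩ := hψ.timeDeriv_family.exists_sum_le 0 T
  obtain ⟨M₂, hM₂⟩ := hψ.lap_family.exists_sum_le 0 T
  obtain ⟨M₃, hM₃⟩ := hψ.exists_sum_lap_le 0 T
  have hmem : ∀ᵐ t ∂(volume.restrict (Ioc 0 T)), t ∈ Icc 0 T := by
    filter_upwards [ae_restrict_mem measurableSet_Ioc] with t ht using ⟨ht.1.le, ht.2⟩
  have hu := hφ.aestronglyMeasurable_fourierCoefficient
  have hN := hφ.aestronglyMeasurable_nonlinearity hX hT.le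
  have hG := hφ.aestronglyMeasurable_gradSq hT.le
  have hc : ∀ k, AEStronglyMeasurable (fun t => fourierCoefficient L (ψ t) k)
      (volume.restrict (Ioc 0 T)) := fun k =>
    (hψ.continuous_fourierCoefficient k).aestronglyMeasurable
  have hsum : ∀ t ∈ Icc 0 T, Summable fun k => ‖fourierCoefficient L (ψ t) k‖ := fun t ht =>
    summable_norm_of_sum_le (hM t ht) (hM₃ t ht)
  have hψi : ∀ t, Integrable (ψ t) volume := fun t =>
    integrable_of_continuous (hψ.continuous_apply t)
  have hBint : ∀ c : ℝ, Integrable (fun t => c + M₃ +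
      (2 * (m * lapEnergy L (φ t)) + 2 * K ^ 2) * weightSum L / 4) (volume.restrict (Ioc 0 T)) :=
    fun c => (integrable_const _).add
      (((((hD.const_mul m).const_mul 2).add (integrable_const _)).mul_const _).div_const 4)
  -- Each term of the weak formulation is the sum over the Fourier modes of its coefficients.
  obtain ⟨-, i1, s1⟩ := hasSum_integral_mul_conj (μ := volume.restrict (Ioc 0 T))
    (p := fun k t => fourierCoefficient L (φ t) k)
    (q := fun k t => fourierCoefficient L (fun x => deriv (fun s => ψ s x) t) k)
    (R := fun t => ∫ x, φ t x * deriv (fun s => ψ s x) t) (B := fun _ => (m + M₁) / 2) hu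
    (fun k => (hψ.timeDeriv_family.continuous_fourierCoefficient k).aestronglyMeasurable)
    (Filter.Eventually.of_forall fun t => hasSum_fourierCoefficient_mul_conj (φ t).memLp
      (memLp_of_continuous (hψ.timeDeriv_family.continuous_apply t)))
    (integrable_const _) (by
      filter_upwards [hreg, hmem] with t h1 h2 F
      exact sum_norm_mul_conj_le (h1.sum_le F) (hM₁ t h2 F))
  obtain ⟨-, i2, s2⟩ := hasSum_integral_mul_conj (μ := volume.restrict (Ioc 0 T))
    (p := fun k t => -freqSq L k * fourierCoefficient L (φ t) k)
    (q := fun k t => fourierCoefficient L (lap L (ψ t)) k)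
    (R := fun t => ∫ x, weakLap L (φ t) x * lap L (ψ t) x)
    (B := fun t => (lapEnergy L (φ t) + M₂) / 2) (fun k => (hu k).const_mul _)
    (fun k => (hψ.lap_family.continuous_fourierCoefficient k).aestronglyMeasurable) (by
      filter_upwards [hreg] with t ht
      obtain ⟨h1, h2⟩ := weakLap_spec ht.summable_lap
      have := hasSum_fourierCoefficient_mul_conj h1
        (memLp_of_continuous (hψ.lap_family.continuous_apply t))
      simpa only [h2] using this)
    ((hD.add (integrable_const _)).div_const 2) (by
      filter_upwards [hreg, hmem] with t h1 h2 F
      refine sum_norm_mul_conj_le ?_ (hM₂ t h2 F)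
      simpa only [norm_mul, mul_pow, norm_neg, Complex.norm_real, Real.norm_eq_abs, sq_abs]
        using h1.sum_lap_le F)
  obtain ⟨-, i3, s3⟩ := hasSum_integral_mul_conj (μ := volume.restrict (Ioc 0 T))
    (p := fun k t => freqSq L k * fourierCoefficient L (φ t) k)
    (q := fun k t => fourierCoefficient L (ψ t) k)
    (R := fun t => ∫ x, inner ℝ (weakGrad L (φ t) x) (grad L (ψ t) x))
    (B := fun t => (lapEnergy L (φ t) + M) / 2) (fun k => (hu k).const_mul _) hc (by
      filter_upwards [hreg] with t ht using ht.hasSum_grad_mul hψ t)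
    ((hD.add (integrable_const _)).div_const 2) (by
      filter_upwards [hreg, hmem] with t h1 h2 F
      refine sum_norm_mul_conj_le ?_ (hM t h2 F)
      simpa only [norm_mul, mul_pow, norm_neg, Complex.norm_real, Real.norm_eq_abs, sq_abs]
        using h1.sum_lap_le F)
  obtain ⟨r4, i4, s4⟩ := hasSum_integral_mul_conj (μ := volume.restrict (Ioc 0 T))
    (p := fun k t => fourierCoefficient L (nonlinearity L (v t) (φ t)) k)
    (q := fun k t => fourierCoefficient L (ψ t) k)
    (R := fun t => ∫ x, nonlinearity L (v t) (φ t) x * ψ t x) hN hc (by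
      filter_upwards [hreg, hmem] with t h1 h2
      exact hasSum_fourierCoefficient_mul_conj_of_summable
        (integrable_nonlinearity _ h1.memLp_grad) (hψi t) (hsum t h2))
    (hBint M) (by
      filter_upwards [hreg, hmem] with t h1 h2
      exact h1.sum_norm_mul_le h1.norm_nonlinearity_le (hM t h2) (hM₃ t h2))
  obtain ⟨r5, -, -⟩ := hasSum_integral_mul_conj (μ := volume.restrict (Ioc 0 T))
    (p := fun k t => fourierCoefficient L (fun x => ‖weakGrad L (φ t) x‖ ^ 2) k)
    (q := fun k t => fourierCoefficient L (ψ t) k)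
    (R := fun t => ∫ x, ‖weakGrad L (φ t) x‖ ^ 2 * ψ t x) hG hc (by
      filter_upwards [hreg, hmem] with t h1 h2
      exact hasSum_fourierCoefficient_mul_conj_of_summable
        h1.memLp_grad.norm.integrable_sq (hψi t) (hsum t h2))
    (hBint M) (by
      filter_upwards [hreg, hmem] with t h1 h2
      exact h1.sum_norm_mul_le h1.norm_gradSq_le (hM t h2) (hM₃ t h2))
  have s0 := hasSum_fourierCoefficient_mul_conj φ₀.memLp
    (memLp_of_continuous (hψ.continuous_apply 0))
  have hmode : ∀ k, (∫ t in Ioc 0 T, fourierCoefficient L (φ t) k *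
        conj (fourierCoefficient L (fun x => deriv (fun s => ψ s x) t) k)) -
      (∫ t in Ioc 0 T, -freqSq L k * fourierCoefficient L (φ t) k *
        conj (fourierCoefficient L (lap L (ψ t)) k)) +
      (∫ t in Ioc 0 T, freqSq L k * fourierCoefficient L (φ t) k *
        conj (fourierCoefficient L (ψ t) k)) -
      (∫ t in Ioc 0 T, fourierCoefficient L (nonlinearity L (v t) (φ t)) k *
        conj (fourierCoefficient L (ψ t) k)) =
      -(fourierCoefficient L φ₀ k * conj (fourierCoefficient L (ψ 0) k)) := by
    intro k
    rw [← hφ.mode_weak_form hX hT hψ hψT k, ← integral_sub (i1 k) (i2 k), sub_eq_add_neg,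
      add_assoc, ← sub_eq_add_neg, ← integral_sub (i3 k) (i4 k)]
    have h := integral_add ((i1 k).sub (i2 k)) ((i3 k).sub (i4 k))
    refine h.symm.trans ?_
    refine integral_congr_ae (Filter.Eventually.of_forall fun t => ?_)
    simp only [Pi.sub_apply, hψ.fourierCoefficient_lap, symbol, map_mul, map_neg,
      Complex.conj_ofReal]
    push_cast
    ring
  have heq := ((((s1.sub s2).add s3).sub s4).congr_fun fun k => (hmode k).symm).unique s0.neg
  norm_cast at heq
  -- The parts `|∇φ|² / 2` and `v ⋅ ∇φ` of the nonlinearity are separately integrable in time.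
  have hsplit : ∫ t in Ioc 0 T, ∫ x, nonlinearity L (v t) (φ t) x * ψ t x =
      (1 / 2) * (∫ t in Ioc 0 T, ∫ x, ‖weakGrad L (φ t) x‖ ^ 2 * ψ t x) +
        ∫ t in Ioc 0 T, ∫ x, ψ t x * inner ℝ (v t x) (weakGrad L (φ t) x) := by
    have hpt : ∀ᵐ t ∂(volume.restrict (Ioc 0 T)),
        ∫ x, ψ t x * inner ℝ (v t x) (weakGrad L (φ t) x) =
        (∫ x, nonlinearity L (v t) (φ t) x * ψ t x) -
          (1 / 2) * ∫ x, ‖weakGrad L (φ t) x‖ ^ 2 * ψ t x := by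
      filter_upwards [hreg] with t ht
      obtain ⟨C, -, hC⟩ := hψ.exists_bound t t
      have hb : ∀ᵐ x, ‖ψ t x‖ ≤ C := Filter.Eventually.of_forall fun x => hC t ⟨le_rfl, le_rfl⟩ x
      have hm := (hψ.continuous_apply t).aestronglyMeasurable (μ := (volume : Measure (Torus L)))
      have j1 := (integrable_nonlinearity (v t) ht.memLp_grad).mul_bdd hm hb
      have j2 := ht.memLp_grad.norm.integrable_sq.mul_bdd hm hb
      rw [← integral_const_mul, ← integral_sub j1 (j2.const_mul _)]
      refine integral_congr_ae (Filter.Eventually.of_forall fun x => ?_)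
      simp only [nonlinearity]
      ring
    rw [integral_congr_ae hpt, integral_sub r4 (r5.const_mul _), integral_const_mul]
    ring
  rw [hsplit] at heq
  simp only [intervalIntegral.integral_of_le hT.le]
  have hA := (inv_pos.2 (area_pos L)).ne'
  refine mul_left_cancel₀ hA ?_
  linear_combination heq

/-! ### The energy equality -/

theorem integrableOn_integral_abs_mul_gradSq (hφ : IsMildSolution L v T φ₀ φ) {m K : ℝ}
    (hreg : ∀ᵐ t ∂(volume.restrict (Ioc 0 T)), IsRegularAt L (v t) (φ t) m K)
    (hD : IntegrableOn (fun t => lapEnergy L (φ t)) (Ioc 0 T)) :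
    IntegrableOn (fun t => ∫ x, |φ t x| * ‖weakGrad L (φ t) x‖ ^ 2) (Ioc 0 T) := by
  have hB : IntegrableOn (fun t => area L * (m + lapEnergy L (φ t) +
      (2 * (m * lapEnergy L (φ t)) + 2 * K ^ 2) * weightSum L / 4)) (Ioc 0 T) :=
    (((integrable_const _).add hD).add
      (((((hD.const_mul m).const_mul 2).add (integrable_const _)).mul_const _).div_const
        4)).const_mul _
  refine Integrable.mono' hB (hφ.aestronglyMeasurable_integral_abs_mul hreg) ?_
  filter_upwards [hreg] with t ht
  rw [Real.norm_of_nonneg (integral_nonneg fun x => by positivity)]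
  exact ht.integral_abs_mul_gradSq_le

theorem integrableOn_integral_mul_gradSq (hφ : IsMildSolution L v T φ₀ φ)
    (hT : 0 < T) {m K : ℝ}
    (hreg : ∀ᵐ t ∂(volume.restrict (Ioc 0 T)), IsRegularAt L (v t) (φ t) m K)
    (hD : IntegrableOn (fun t => lapEnergy L (φ t)) (Ioc 0 T)) :
    IntegrableOn (fun t => ∫ x, φ t x * ‖weakGrad L (φ t) x‖ ^ 2) (Ioc 0 T) := by
  have h := (hasSum_integral_mul_conj (μ := volume.restrict (Ioc 0 T))
    (p := fun k t => fourierCoefficient L (fun x => ‖weakGrad L (φ t) x‖ ^ 2) k)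
    (q := fun k t => fourierCoefficient L (φ t) k)
    (R := fun t => ∫ x, ‖weakGrad L (φ t) x‖ ^ 2 * φ t x)
    (B := fun t => m + lapEnergy L (φ t) +
      (2 * (m * lapEnergy L (φ t)) + 2 * K ^ 2) * weightSum L / 4)
    (hφ.aestronglyMeasurable_gradSq hT.le) hφ.aestronglyMeasurable_fourierCoefficient (by
      filter_upwards [hreg] with t ht
      exact hasSum_fourierCoefficient_mul_conj_of_summable
        ht.memLp_grad.norm.integrable_sq (φ t).integrable ht.summable_norm)
    (((integrable_const _).add hD).add
      (((((hD.const_mul m).const_mul 2).add (integrable_const _)).mul_const _).div_const 4)) (by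
      filter_upwards [hreg] with t ht
      exact ht.sum_norm_mul_le ht.norm_gradSq_le ht.sum_le ht.sum_lap_le)).1
  simp only [mul_comm (‖_‖ ^ 2)] at h
  exact h

/-- The energy equality, by summation of the energy identities of the Fourier modes. -/
theorem energy_eq (hφ : IsMildSolution L v T φ₀ φ) (hX : HasGradBound L T φ)
    (hT : 0 < T) {m K : ℝ}
    (hreg : ∀ᵐ t ∂(volume.restrict (Ioc 0 T)), IsRegularAt L (v t) (φ t) m K)
    (hD : IntegrableOn (fun t => lapEnergy L (φ t)) (Ioc 0 T))
    (hE : IntegrableOn (fun t => gradEnergy L (φ t)) (Ioc 0 T)) {t : ℝ} (ht : t ∈ Icc 0 T) :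
    ‖φ t‖ ^ 2 + 2 * (∫ s in (0 : ℝ)..t, ∫ x, weakLap L (φ s) x ^ 2)
      = ‖φ₀‖ ^ 2 + 2 * (∫ s in (0 : ℝ)..t, ∫ x, ‖weakGrad L (φ s) x‖ ^ 2)
        - ∫ s in (0 : ℝ)..t, ∫ x, φ s x * ‖weakGrad L (φ s) x‖ ^ 2 := by
  have hA := area_pos L
  have hsub : Ioc 0 t ⊆ Ioc 0 T := Ioc_subset_Ioc_right ht.2
  have hreg' := ae_restrict_of_ae_restrict_of_subset hsub hreg
  have hD' := hD.mono_set hsub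
  have hE' := hE.mono_set hsub
  have hle := Measure.restrict_mono hsub (le_refl (volume : Measure ℝ))
  have hu := fun k => (hφ.aestronglyMeasurable_fourierCoefficient k).mono_measure hle
  obtain ⟨-, i1, s1⟩ := hasSum_integral_of_sum_norm_le (μ := volume.restrict (Ioc 0 t))
    (a := fun k s => freqSq L k ^ 2 * ‖fourierCoefficient L (φ s) k‖ ^ 2)
    (A := fun s => lapEnergy L (φ s)) (B := fun s => lapEnergy L (φ s))
    (fun k => ((hu k).norm.pow 2).const_mul _)
    (by filter_upwards [hreg'] with s hs using hs.summable_lap.hasSum) hD' (by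
      filter_upwards [hreg'] with s hs F
      simpa only [Real.norm_of_nonneg (mul_nonneg (sq_nonneg (freqSq L _)) (sq_nonneg ‖_‖))]
        using hs.sum_lap_le F)
  obtain ⟨-, i2, s2⟩ := hasSum_integral_of_sum_norm_le (μ := volume.restrict (Ioc 0 t))
    (a := fun k s => freqSq L k * ‖fourierCoefficient L (φ s) k‖ ^ 2)
    (A := fun s => gradEnergy L (φ s)) (B := fun s => gradEnergy L (φ s))
    (fun k => ((hu k).norm.pow 2).const_mul _)
    (by filter_upwards [hreg'] with s hs using hs.hasSum_grad) hE' (by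
      filter_upwards [hreg'] with s hs F
      simpa only [Real.norm_of_nonneg (mul_nonneg (freqSq_nonneg _) (sq_nonneg ‖_‖))]
        using sum_le_hasSum F (fun k _ => mul_nonneg (freqSq_nonneg k) (sq_nonneg _))
          hs.hasSum_grad)
  obtain ⟨-, i3, s3⟩ := hasSum_integral_mul_conj (μ := volume.restrict (Ioc 0 t))
    (p := fun k s => fourierCoefficient L (nonlinearity L (v s) (φ s)) k)
    (q := fun k s => fourierCoefficient L (φ s) k)
    (R := fun s => (1 / 2) * ∫ x, φ s x * ‖weakGrad L (φ s) x‖ ^ 2)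
    (B := fun s => m + lapEnergy L (φ s) +
      (2 * (m * lapEnergy L (φ s)) + 2 * K ^ 2) * weightSum L / 4)
    (fun k => (hφ.aestronglyMeasurable_nonlinearity hX hT.le k).mono_measure hle) hu (by
      filter_upwards [hreg'] with s hs
      have := hasSum_fourierCoefficient_mul_conj_of_summable
        (integrable_nonlinearity (v s) hs.memLp_grad) (φ s).integrable hs.summable_norm
      rwa [hs.integral_mul_nonlinearity] at this)
    (((integrable_const _).add hD').add
      (((((hD'.const_mul m).const_mul 2).add (integrable_const _)).mul_const _).div_const 4)) (by
      filter_upwards [hreg'] with s hs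
      exact hs.sum_norm_mul_le hs.norm_nonlinearity_le hs.sum_le hs.sum_lap_le)
  have hmode : ∀ k, ‖fourierCoefficient L (φ t) k‖ ^ 2 = ‖fourierCoefficient L φ₀ k‖ ^ 2 -
      2 * (∫ s in Ioc 0 t, freqSq L k ^ 2 * ‖fourierCoefficient L (φ s) k‖ ^ 2) +
      2 * (∫ s in Ioc 0 t, freqSq L k * ‖fourierCoefficient L (φ s) k‖ ^ 2) -
      2 * (∫ s in Ioc 0 t, fourierCoefficient L (nonlinearity L (v s) (φ s)) k *
        conj (fourierCoefficient L (φ s) k)).re := by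
    intro k
    obtain ⟨h0, h1⟩ := hφ.fourierCoefficient_eq_integral hX hT.le k
    have h2 := (mode_energy hT.le (hφ.continuousOn_fourierCoefficient k)
      (hφ.intervalIntegrable_fourierCoefficient_nonlinearity hX hT.le k) h1).2 t ht
    rw [h0, intervalIntegral.integral_of_le ht.1] at h2
    have h3 : (∫ s in Ioc 0 t, fourierCoefficient L (nonlinearity L (v s) (φ s)) k *
        conj (fourierCoefficient L (φ s) k)).re = ∫ s in Ioc 0 t,
        (fourierCoefficient L (nonlinearity L (v s) (φ s)) k *
          conj (fourierCoefficient L (φ s) k)).re := (integral_re (i3 k)).symm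
    have i3' : Integrable (fun s => (fourierCoefficient L (nonlinearity L (v s) (φ s)) k *
        conj (fourierCoefficient L (φ s) k)).re) (volume.restrict (Ioc 0 t)) := (i3 k).re
    have h4 := integral_sub_sub ((i2 k).const_mul 2) ((i1 k).const_mul 2) (i3'.const_mul 2)
    simp only [integral_const_mul] at h4
    rw [h2, h3, sub_add_eq_add_sub, add_sub_assoc, add_sub_assoc]
    simp only [integral_const_mul]
    rw [← h4]
    congr 1
    refine integral_congr_ae (Filter.Eventually.of_forall fun s => ?_)
    simp only [symbol]
    ring
  have s3' := Complex.hasSum_re s3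
  rw [Complex.ofReal_re, integral_const_mul] at s3'
  have h0 := hasSum_norm_fourierCoefficient_sq φ₀.memLp
  have h1 := hasSum_norm_fourierCoefficient_sq (φ t).memLp
  rw [integral_sq_eq_norm_sq] at h0 h1
  have heq := h1.unique ((((h0.sub (s1.mul_left 2)).add (s2.mul_left 2)).sub
    (s3'.mul_left 2)).congr_fun hmode)
  have e1 : ∫ s in Ioc 0 t, lapEnergy L (φ s) =
      (area L)⁻¹ * ∫ s in Ioc 0 t, ∫ x, weakLap L (φ s) x ^ 2 := by
    rw [← integral_const_mul]
    refine integral_congr_ae ?_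
    filter_upwards [hreg'] with s hs using hs.lapEnergy_eq
  have e2 : ∫ s in Ioc 0 t, gradEnergy L (φ s) =
      (area L)⁻¹ * ∫ s in Ioc 0 t, ∫ x, ‖weakGrad L (φ s) x‖ ^ 2 := by
    rw [← integral_const_mul]
    rfl
  rw [e1, e2] at heq
  simp only [intervalIntegral.integral_of_le ht.1]
  refine mul_left_cancel₀ (inv_pos.2 hA).ne' ?_
  linear_combination heq

end IsMildSolution

end

end AdvectiveKSE

theorem proposition2p5 (L : Fin 2 → ℝ) [∀ j, Fact (0 < L j)]
    (v : ℝ → AdvectiveKSE.L2Vec L)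
    (hv : MemLp v ⊤ (volume.restrict (Ioi (0 : ℝ))))
    (hdiv : AdvectiveKSE.IsDivFree L v)
    (φ₀ : AdvectiveKSE.L2 L) (T : ℝ) (hT : 0 < T) (φ : ℝ → AdvectiveKSE.L2 L)
    (hφ : AdvectiveKSE.IsMildSolution L v T φ₀ φ)
    (hX : AdvectiveKSE.HasGradBound L T φ) :
    AdvectiveKSE.IsWeakSolution L v T φ₀ φ ∧
    (IntegrableOn (fun s => ∫ x, AdvectiveKSE.weakLap L (φ s) x ^ 2) (Ioo 0 T) ∧
      IntegrableOn (fun s => ∫ x, ‖AdvectiveKSE.weakGrad L (φ s) x‖ ^ 2) (Ioo 0 T) ∧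
      (∀ᵐ s ∂(volume.restrict (Ioo 0 T)),
        Integrable (fun x => φ s x * ‖AdvectiveKSE.weakGrad L (φ s) x‖ ^ 2) volume) ∧
      IntegrableOn (fun s => ∫ x, |φ s x| * ‖AdvectiveKSE.weakGrad L (φ s) x‖ ^ 2) (Ioo 0 T) ∧
      IntegrableOn (fun s => ∫ x, φ s x * ‖AdvectiveKSE.weakGrad L (φ s) x‖ ^ 2) (Ioo 0 T)) ∧
    ∀ t ∈ Ico 0 T,
      ‖φ t‖ ^ 2 + 2 * (∫ s in (0 : ℝ)..t, ∫ x, AdvectiveKSE.weakLap L (φ s) x ^ 2)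
        = ‖φ₀‖ ^ 2 + 2 * (∫ s in (0 : ℝ)..t, ∫ x, ‖AdvectiveKSE.weakGrad L (φ s) x‖ ^ 2)
          - ∫ s in (0 : ℝ)..t, ∫ x, φ s x * ‖AdvectiveKSE.weakGrad L (φ s) x‖ ^ 2 := by
  obtain ⟨⟨m, K, hreg⟩, hD, hE⟩ := hφ.exists_isRegularAt hX hv hdiv hT
  have hA := (AdvectiveKSE.area_pos L).ne'
  have hreg' := ae_restrict_of_ae_restrict_of_subset (Ioo_subset_Ioc_self (a := T) (b := 0)) hreg
  refine ⟨⟨?_, ?_, hφ.timeDerivMemL2Sobolev hX hT hreg hD, ?_⟩,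
    ⟨?_, ?_, ?_, ?_, ?_⟩, fun t ht => hφ.energy_eq hX hT hreg hD hE ⟨ht.1, ht.2.le⟩⟩
  · obtain ⟨M, hM⟩ := isCompact_Icc.exists_bound_of_continuousOn hφ.continuousOn
    refine memLp_top_of_bound ((hφ.continuousOn.mono Ioo_subset_Icc_self).aestronglyMeasurable
      measurableSet_Ioo) M ?_
    filter_upwards [ae_restrict_mem measurableSet_Ioo] with t ht
    exact hM t (Ioo_subset_Icc_self ht)
  · refine AdvectiveKSE.lintegral_sobolevNormSq_lt_top (B := fun t =>
      2 * m + 2 * AdvectiveKSE.lapEnergy L (φ t)) ?_ ?_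
    · exact (integrable_const _).add ((hD.mono_set Ioo_subset_Ioc_self).const_mul 2)
    · filter_upwards [hreg'] with t ht
      exact ht.sum_sobolev_two_le
  · intro ψ hψ
    obtain ⟨T', hT', h0⟩ := hψ.support
    exact hφ.weak_form hX hT hreg hD hψ.smooth (h0 T hT'.le)
  · refine ((hD.mono_set Ioo_subset_Ioc_self).const_mul (AdvectiveKSE.area L)).congr ?_
    filter_upwards [hreg'] with t ht
    rw [ht.lapEnergy_eq, mul_inv_cancel_left₀ hA]
  · refine ((hE.mono_set Ioo_subset_Ioc_self).const_mul (AdvectiveKSE.area L)).congr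
      (Filter.Eventually.of_forall fun t => ?_)
    simp only [AdvectiveKSE.gradEnergy]
    rw [mul_inv_cancel_left₀ hA]
  · filter_upwards [hreg'] with t ht using ht.integrable_mul_gradSq
  · exact (hφ.integrableOn_integral_abs_mul_gradSq hreg hD).mono_set Ioo_subset_Ioc_self
  · exact (hφ.integrableOn_integral_mul_gradSq hT hreg hD).mono_set Ioo_subset_Ioc_self
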